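/- Let $\Sigma$ be a finite alphabet with at least two symbols, one of which is designated as $\mathtt 1$, and let $\mathcal B$ be the set of all functions $\varphi\colon\Sigma^*\to\Sigma^*$. The \emph{size} of $\varphi\in\mathcal B$ is $|\varphi|(n)=\max\{|\varphi(\mathbf a)| : |\mathbf a|\le n\}$, and $\varphi$ is \emph{length-monotone} if $|\mathbf a|\le|\mathbf b|$ implies $|\varphi(\mathbf a)|\le|\varphi(\mathbf b)|$. \emph{Second-order polynomials} form the smallest class of functions $\mathbb N^{\mathbb N}\times\mathbb N\to\mathbb N$ that contains $(l,n)\mapsto p(n)$ for all $p\in\mathbb N[X]$ and is closed under pointwise sums, pointwise products and $P\mapsto\big((l,n)\mapsto l(P(l,n))\big)$. An oracle Turing machine $M^?$ with oracle $\varphi\in\mathcal B$ replaces, in one step and without moving its heads, the content of its answer tape by the value of $\varphi$ on the content of its query tape; it computes the partial operator on $\mathcal B$ that sends each $\varphi$ with which $M$ halts on all inputs to the function $M^\varphi$, and $\mathrm{Time}_M(\varphi,\mathbf a)$ is its number of steps on input $\mathbf a$. A \emph{preparametrised space} $(X,\xi,\mu)$ is a set $X$ with a partial surjection $\xi\colon\subseteq\mathcal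 B\to X$ (the representation) and a map $\mu\colon\mathrm{dom}(\xi)\to\mathbb N^{\mathbb N}$ (the parameter) all of whose values are non-decreasing functions. A function $f\colon X\to Y$ between preparametrised spaces $(X,\xi_X,\mu_X)$ and $(Y,\xi_Y,\mu_Y)$ is \emph{polytime computable} if there are an oracle machine $M^?$ and second-order polynomials $P,Q$ such that for all $\varphi\in\mathrm{dom}(\xi_X)$: $M^\varphi$ is total and $\xi_Y(M^\varphi)=f(\xi_X(\varphi))$; $\mathrm{Time}_M(\varphi,\mathbf a)\le P(\mu_X(\varphi),|\mathbf a|)$ for all strings $\mathbf a$; and $\mu_Y(M^\varphi)(n)\le Q(\mu_X(\varphi),n)$ for all $n$. A \emph{parametrised space} is a preparametrised space whose identity function is polytime computable. Two spaces are \emph{polytime isomorphic} if there is a bijection between them that is polytime computable in both directions. A \emph{Kawamura--Cook space} is a parametrised space such that all elements of the domain of its representation are length-monotone and whose parameter is the standard one, $\mu(\varphi)=|\varphi|$. Make $\mathbb N^{\mathbb N}$ a parametrised space through the total representation that sends $\varphi$ to $n\mapsto|\varphi(\mathtt 1^n)|$, with the standard parameter. A space $(X,\xi,\mu)$ has a \emph{polytime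 computable parameter} if $\mu\colon\mathrm{dom}(\xi)\to\mathbb N^{\mathbb N}$ is polytime computable, where each element of $\mathrm{dom}(\xi)$ has itself as its only name and $\mu$ is the parameter on $\mathrm{dom}(\xi)$. \textbf{Theorem.} A parametrised space is polytime isomorphic to a Kawamura--Cook space if and only if it is polytime isomorphic to a parametrised space with polytime computable parameter. -/

import Mathlib

universe u

namespace SecondOrder

/-! ### String functions and second-order polynomials -/

/-- Baire space over the alphabet `S`: the total functions from strings to strings. -/
abbrev Baire (S : Type) : Type := List S → List S

/-- The size of a string function: `size φ n = max {|φ(a)| : |a| ≤ n}`. -/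
noncomputable def size {S : Type} (φ : Baire S) (n : ℕ) : ℕ :=
  sSup {k : ℕ | ∃ a : List S, a.length ≤ n ∧ (φ a).length = k}

theorem size_bddAbove {S : Type} [Finite S] (φ : Baire S) (n : ℕ) :
    BddAbove {k : ℕ | ∃ a : List S, a.length ≤ n ∧ (φ a).length = k} :=
  ((List.finite_length_le S n).image fun a => (φ a).length).bddAbove

theorem length_le_size {S : Type} [Finite S] (φ : Baire S) {a : List S} {n : ℕ}
    (h : a.length ≤ n) : (φ a).length ≤ size φ n :=
  le_csSup (size_bddAbove φ n) ⟨a, h, rfl⟩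

theorem size_le {S : Type} (φ : Baire S) {n B : ℕ}
    (h : ∀ a : List S, a.length ≤ n → (φ a).length ≤ B) : size φ n ≤ B := by
  refine csSup_le ⟨_, [], Nat.zero_le n, rfl⟩ ?_
  rintro k ⟨a, ha, rfl⟩
  exact h a ha

theorem size_mono {S : Type} [Finite S] (φ : Baire S) : Monotone (size φ) :=
  fun _ _ hmn => size_le φ fun _ ha => length_le_size φ (ha.trans hmn)

/-- Length-monotone string functions. -/
def IsLengthMonotone {S : Type} (φ : Baire S) : Prop :=
  ∀ a b : List S, a.length ≤ b.length → (φ a).length ≤ (φ b).length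

/-- The class of second-order polynomials, as the smallest class of functions
`ℕ^ℕ × ℕ → ℕ` with the closure properties below. -/
inductive IsSOP : ((ℕ → ℕ) → ℕ → ℕ) → Prop
  | poly (p : Polynomial ℕ) : IsSOP fun _ n => p.eval n
  | app {P : (ℕ → ℕ) → ℕ → ℕ} : IsSOP P → IsSOP fun l n => l (P l n)
  | add {P Q : (ℕ → ℕ) → ℕ → ℕ} : IsSOP P → IsSOP Q → IsSOP fun l n => P l n + Q l n
  | mul {P Q : (ℕ → ℕ) → ℕ → ℕ} : IsSOP P → IsSOP Q → IsSOP fun l n => P l n * Q l n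

/-! ### Oracle Turing machines -/

/-- Tape symbols: letters of the alphabet `S`, auxiliary symbols from `A`, and the blank `none`. -/
abbrev Symb (S A : Type) : Type := Option (S ⊕ A)

/-- The letter of `S` in a cell, if there is one. -/
def Symb.letter {S A : Type} : Symb S A → Option S
  | some (Sum.inl s) => some s
  | _ => none

/-- A two-way infinite tape; the cell `0` is the start cell. -/
abbrev Tape (S A : Type) : Type := ℤ → Symb S A

/-- The tape that holds the string `a` in the cells `0, …, |a| - 1` and is blank elsewhere. -/
def Tape.ofString {S A : Type} (a : List S) : Tape S A := fun z =>
  if 0 ≤ z then (a[z.toNat]?).map Sum.inl else none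

/-- The string on a tape: the longest block of letters of `S` that starts in the cell `0`.
In a computation only finitely many cells are non-blank, so that the block is finite. -/
noncomputable def Tape.content {S A : Type} (T : Tape S A) : List S :=
  (List.range (sInf {n : ℕ | Symb.letter (T n) = none})).filterMap fun n : ℕ => Symb.letter (T n)

/-- The tapes of a machine whose further work tapes are indexed by `W`. -/
inductive TapeIdx (W : Type) : Type
  | input : TapeIdx W
  | output : TapeIdx W
  | query : TapeIdx W
  | answer : TapeIdx W
  | work : W → TapeIdx W

/-- The head movements. -/
inductive Move : Type
  | left : Move
  | stay : Move
  | right : Move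

/-- The displacement of a head. -/
def Move.toInt : Move → ℤ
  | .left => -1
  | .stay => 0
  | .right => 1

/-- Deterministic multi-tape oracle Turing machines over the alphabet `S`, with finitely many
states, work tapes and auxiliary symbols. -/
structure OracleMachine (S : Type) where
  /-- states -/
  Q : Type
  /-- index set of the work tapes -/
  W : Type
  /-- auxiliary tape symbols -/
  A : Type
  finQ : Finite Q
  finW : Finite W
  finA : Finite A
  /-- the initial state -/
  start : Q
  /-- the final state -/
  halt : Q
  /-- the oracle state -/
  oracle : Q
  /-- the state in which the machine continues after an oracle call -/
  resume : Q
  /-- the next state, depending on the state and the scanned symbols -/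
  next : Q → (TapeIdx W → Symb S A) → Q
  /-- the symbol written on each tape -/
  write : Q → (TapeIdx W → Symb S A) → TapeIdx W → Symb S A
  /-- the movement of the head on each tape, after writing -/
  move : Q → (TapeIdx W → Symb S A) → TapeIdx W → Move

namespace OracleMachine

variable {S : Type} (M : OracleMachine S)

/-- Configurations. -/
@[ext]
structure Config where
  /-- the current state -/
  state : M.Q
  /-- the tape inscriptions -/
  tape : TapeIdx M.W → Tape S M.A
  /-- the head positions -/
  head : TapeIdx M.W → ℤ

/-- The initial configuration on the input `a`. -/
def init (a : List S) : M.Config where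
  state := M.start
  tape i := match i with
    | .input => Tape.ofString a
    | _ => fun _ => none
  head _ := 0

open Classical in
/-- One step with oracle `φ`. In the oracle state the content of the answer tape is replaced by
the value of `φ` on the content of the query tape; no head moves. -/
noncomputable def step (φ : Baire S) (c : M.Config) : M.Config :=
  if c.state = M.halt then c
  else if c.state = M.oracle then
    { state := M.resume
      tape := fun i => match i with
        | .answer => Tape.ofString (φ (c.tape .query).content)
        | j => c.tape j
      head := c.head }
  else
    { state := M.next c.state fun i => c.tape i (c.head i)
      tape := fun i => Function.update (c.tape i) (c.head i)
        (M.write c.state (fun j => c.tape j (c.head j)) i)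
      head := fun i => c.head i + (M.move c.state (fun j => c.tape j (c.head j)) i).toInt }

/-- The configuration after `t` steps on the input `a` with oracle `φ`. -/
noncomputable def run (φ : Baire S) (a : List S) (t : ℕ) : M.Config :=
  (M.step φ)^[t] (M.init a)

/-- The number of steps until the machine halts (`⊤` if it does not halt). -/
noncomputable def time (φ : Baire S) (a : List S) : ℕ∞ :=
  sInf {t : ℕ∞ | ∃ n : ℕ, (M.run φ a n).state = M.halt ∧ t = n}

/-- The string on the output tape when the machine halts (meaningful only if it halts). -/
noncomputable def result (φ : Baire S) (a : List S) : List S :=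
  ((M.run φ a (M.time φ a).toNat).tape .output).content

/-- The partial operator on Baire space computed by the machine: its domain consists of the
oracles with which the machine halts on every input. -/
noncomputable def operator : Baire S →. Baire S := fun φ =>
  ⟨∀ a, M.time φ a ≠ ⊤, fun _ => M.result φ⟩

end OracleMachine

/-! ### Parametrised spaces -/

/-- `F` is a realiser of `f` with respect to the representations `ξ` and `υ`. -/
def IsRealiser {S : Type} {X Y : Type u} (ξ : Baire S →. X) (υ : Baire S →. Y) (f : X → Y)
    (F : Baire S →. Baire S) : Prop :=
  ∀ φ, ∀ x ∈ ξ φ, ∃ ψ ∈ F φ, f x ∈ υ ψ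

/-- Preparametrised spaces: a set with a representation (a partial surjection from Baire space)
and a parameter, which assigns a non-decreasing function to each name. -/
structure PreparametrisedSpace (S : Type) : Type (u + 1) where
  /-- the underlying set -/
  carrier : Type u
  /-- the representation -/
  rep : Baire S →. carrier
  rep_surjective : ∀ x : carrier, ∃ φ, x ∈ rep φ
  /-- the parameter -/
  param : rep.Dom → ℕ → ℕ
  param_mono : ∀ φ : rep.Dom, Monotone (param φ)

/-- Polynomial-time computability of a function between preparametrised spaces: some machine
computes a realiser with running time and parameter blowup bounded by second-order polynomials
in the parameter of the input name. -/
def PolytimeComputable {S : Type} (X : PreparametrisedSpace.{u} S)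
    (Y : PreparametrisedSpace.{u} S) (f : X.carrier → Y.carrier) : Prop :=
  ∃ (M : OracleMachine S) (P Q : (ℕ → ℕ) → ℕ → ℕ), IsSOP P ∧ IsSOP Q ∧
    IsRealiser X.rep Y.rep f M.operator ∧
    (∀ (φ : X.rep.Dom) (a : List S), M.time φ a ≤ (P (X.param φ) a.length : ℕ)) ∧
    (∀ (φ : X.rep.Dom) (ψ : Y.rep.Dom), (ψ : Baire S) ∈ M.operator φ →
      ∀ n, Y.param ψ n ≤ Q (X.param φ) n)

namespace PreparametrisedSpace

variable {S : Type}

/-- A parametrised space is a preparametrised space whose identity is polytime computable. -/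
def IsParametrised (X : PreparametrisedSpace.{u} S) : Prop :=
  PolytimeComputable X X id

/-- Polytime isomorphism: a bijection that is polytime computable in both directions. -/
def PolytimeIsomorphic (X Y : PreparametrisedSpace.{u} S) : Prop :=
  ∃ e : X.carrier ≃ Y.carrier, PolytimeComputable X Y e ∧ PolytimeComputable Y X e.symm

/-- Kawamura-Cook spaces: parametrised spaces with a length-monotone representation and the
standard parameter (the restriction of the size function). -/
def IsKawamuraCook (X : PreparametrisedSpace.{u} S) : Prop :=
  X.IsParametrised ∧
  (∀ φ ∈ X.rep.Dom, IsLengthMonotone φ) ∧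
  ∀ φ : X.rep.Dom, X.param φ = size φ.1

/-- The names of a preparametrised space, as a preparametrised space: each name is represented by
itself and the parameter is that of the given space. -/
def names (X : PreparametrisedSpace.{u} S) : PreparametrisedSpace.{0} S where
  carrier := X.rep.Dom
  rep := fun φ => ⟨φ ∈ X.rep.Dom, fun h => ⟨φ, h⟩⟩
  rep_surjective := fun φ => ⟨φ.1, φ.2, rfl⟩
  param := X.param
  param_mono := X.param_mono

end PreparametrisedSpace

/-- The space `ℕ^ℕ` with the total representation `ξ(φ)(n) = |φ(1ⁿ)|`, where `one` is the letter
`1`, and the standard parameter. -/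
noncomputable def natFunSpace (S : Type) [Finite S] (one : S) : PreparametrisedSpace.{0} S where
  carrier := ℕ → ℕ
  rep := fun φ => Part.some fun n => (φ (List.replicate n one)).length
  rep_surjective := fun f => ⟨fun a => List.replicate (f a.length) one, by simp⟩
  param := fun φ => size φ.1
  param_mono := fun φ => size_mono φ.1

/-- The parameter of `X`, as a function from the names of `X` (measured by that same parameter)
to `ℕ^ℕ`, is polytime computable. -/
def PreparametrisedSpace.HasPolytimeParameter {S : Type} [Finite S] (one : S)
    (X : PreparametrisedSpace.{u} S) : Prop :=
  PolytimeComputable X.names (natFunSpace S one) X.param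

end SecondOrder

/-! A Kawamura–Cook space has a polytime computable parameter: since its names are length-monotone,
`|φ|(n) = |φ(1ⁿ)|`, so that a name is itself a name of its parameter.

Conversely, let `Z` have a polytime computable parameter. A *monotone code* of a function `φ` sends
an encoding of a string `a` and a number `k` to a code for the `k`-th letter of `φ(a)`, or for the
end of `φ(a)`, padded to a length that depends only, and monotonically, on the length of the
argument. The letters can be read off one after the other, so `φ` is recovered from the code. The
length of the padding is the parameter of `Z`, which is monotone and can be computed; hence the
codes are length-monotone, and their size is the parameter up to a constant. If `X` is isomorphic to
`Z`, the codes of those names in `X` which the isomorphism computes from the names in `Z` represent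
a Kawamura–Cook space isomorphic to `X`.

All this depends on machines that simulate others in polynomial time, in particular for the
composition of polytime computable functions, where the oracle of the simulated machine is itself
simulated. An answer of the oracle may be too long to be copied or erased in the available time. A
simulated tape therefore only records what has been written on it and lies above another tape, on
which the answer is read in place. -/

namespace SecondOrder

/-! ### Symbols and tapes -/

namespace Symb

variable {S A B : Type}

/-- Renaming of the auxiliary symbols. -/
def map (f : A → B) : Symb S A → Symb S B := Option.map (Sum.map id f)

@[simp]
theorem letter_none : letter (none : Symb S A) = none := rfl

@[simp]
theorem letter_inl (s : S) : letter (some (Sum.inl s) : Symb S A) = some s := rfl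

@[simp]
theorem letter_inr (a : A) : letter (some (Sum.inr a) : Symb S A) = none := rfl

@[simp]
theorem letter_map (f : A → B) (x : Symb S A) : letter (map f x) = letter x := by
  rcases x with _ | _ | _ <;> rfl

theorem map_injective {f : A → B} (hf : f.Injective) : (map (S := S) f).Injective :=
  Option.map_injective (Sum.map_injective.2 ⟨Function.injective_id, hf⟩)

theorem invFun_map {f : A → B} (hf : f.Injective) (x : Symb S A) :
    Function.invFun (map f) (map f x) = x :=
  Function.leftInverse_invFun (map_injective hf) x

theorem letter_eq_some {x : Symb S A} {s : S} : x.letter = some s ↔ x = some (Sum.inl s) := by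
  rcases x with _ | _ | _ <;> simp

end Symb

namespace Tape

variable {S A B : Type}

/-- Renaming of the auxiliary symbols on a tape. -/
def map (f : A → B) (T : Tape S A) : Tape S B := fun z => (T z).map f

/-- The blank tape. -/
def blank : Tape S A := fun _ => none

@[simp]
theorem blank_apply (z : ℤ) : (blank : Tape S A) z = none := rfl

@[simp]
theorem map_blank (f : A → B) : map f (blank : Tape S A) = blank := rfl

@[simp]
theorem map_ofString (f : A → B) (a : List S) :
    map f (ofString a : Tape S A) = ofString a := by
  funext z
  simp only [map, ofString]
  split_ifs
  · cases a[z.toNat]? <;> rfl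
  · rfl

theorem map_update (f : A → B) (T : Tape S A) (z : ℤ) (x : Symb S A) :
    map f (Function.update T z x) = Function.update (map f T) z (x.map f) :=
  funext fun y => Function.apply_update (fun _ => Symb.map f) T z x y

@[simp]
theorem content_map (f : A → B) (T : Tape S A) : (map f T).content = T.content := by
  simp only [content, map, Symb.letter_map]

@[simp]
theorem ofString_nil : (ofString [] : Tape S A) = blank := by
  funext z
  simp [ofString, blank]

theorem ofString_natCast (a : List S) (k : ℕ) :
    (ofString a : Tape S A) k = (a[k]?).map Sum.inl := by
  simp [ofString]

theorem ofString_of_lt (a : List S) {k : ℕ} (h : k < a.length) :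
    (ofString a : Tape S A) k = some (Sum.inl a[k]) := by
  simp [ofString_natCast, h]

theorem ofString_of_neg (a : List S) {z : ℤ} (h : z < 0) : (ofString a : Tape S A) z = none :=
  if_neg h.not_ge

theorem ofString_of_le (a : List S) {z : ℤ} (h : (a.length : ℤ) ≤ z) :
    (ofString a : Tape S A) z = none := by
  lift z to ℕ using by omega
  simp [ofString_natCast, Int.ofNat_le.1 h]

theorem letter_ofString (a : List S) (k : ℕ) : ((ofString a : Tape S A) k).letter = a[k]? := by
  rw [ofString_natCast]
  cases a[k]? <;> rfl

theorem ofString_concat (a : List S) (s : S) :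
    (ofString (a ++ [s]) : Tape S A) =
      Function.update (ofString a) (a.length : ℤ) (some (Sum.inl s)) := by
  funext z
  rcases lt_or_ge z 0 with hz | hz
  · rw [Function.update_of_ne (by omega), ofString_of_neg _ hz, ofString_of_neg _ hz]
  lift z to ℕ using hz
  rcases lt_trichotomy z a.length with hza | rfl | hza
  · rw [Function.update_of_ne (by omega), ofString_natCast, ofString_natCast,
      List.getElem?_append_left hza]
  · simp [ofString_natCast]
  · rw [Function.update_of_ne (by omega), ofString_of_le a (by omega),
      ofString_of_le _ (by rw [List.length_append, List.length_singleton]; omega)]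

/-- `T.Holds w` says that `w` is the longest block of letters of `T` that starts in the cell `0`,
without the junk value of `Tape.content` on a tape with infinitely many letters. -/
def Holds (T : Tape S A) (w : List S) : Prop :=
  (∀ k (hk : k < w.length), T k = some (Sum.inl w[k])) ∧ (T w.length).letter = none

theorem holds_ofString (a : List S) : (ofString a : Tape S A).Holds a :=
  ⟨fun _ hk => ofString_of_lt a hk, by rw [ofString_of_le a le_rfl, Symb.letter_none]⟩

theorem Holds.content_eq {T : Tape S A} {w : List S} (h : T.Holds w) : T.content = w := by
  have hlen : sInf {n : ℕ | Symb.letter (T n) = none} = w.length := by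
    refine le_antisymm (Nat.sInf_le h.2) (le_csInf ⟨_, h.2⟩ fun n hn => ?_)
    by_contra! hlt
    simp [h.1 n hlt] at hn
  have hletters : (List.range w.length).map (fun n : ℕ => Symb.letter (T n)) = w.map some := by
    refine List.ext_getElem (by simp) fun k hk _ => ?_
    simp [h.1 k (by simpa using hk)]
  have hfilter := congrArg (List.filterMap id) hletters
  rw [List.filterMap_map, List.filterMap_map] at hfilter
  rw [content, hlen]
  simpa using hfilter

@[simp]
theorem content_ofString (a : List S) : (ofString a : Tape S A).content = a :=
  (holds_ofString a).content_eq

theorem holds_content {T : Tape S A} (hT : ∃ n : ℕ, (T n).letter = none) :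
    T.Holds T.content := by
  have prefix_exists : ∀ n : ℕ, (∀ k < n, (T k).letter ≠ none) → ∃ w : List S, w.length = n ∧
      ∀ k (hk : k < w.length), T k = some (Sum.inl w[k]) := by
    intro n hn
    choose s hs using fun k : Fin n => Option.ne_none_iff_exists'.1 (hn k k.2)
    exact ⟨List.ofFn s, List.length_ofFn, fun k hk => by
      simpa using Symb.letter_eq_some.1 (hs ⟨k, by simpa using hk⟩)⟩
  obtain ⟨w, hlen, hw⟩ := prefix_exists (Nat.find hT) fun k hk => Nat.find_min hT hk
  have hHolds : T.Holds w := ⟨hw, hlen ▸ Nat.find_spec hT⟩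
  rwa [hHolds.content_eq]

end Tape

/-! ### Structured programs on tapes -/

/-- Configurations of a program: tapes, indexed by `I`, with heads. -/
@[ext]
structure Cfg (S I A : Type) where
  tape : I → Tape S A
  head : I → ℤ

namespace Cfg

variable {S I A : Type}

/-- The scanned symbols. -/
def read (C : Cfg S I A) : I → Symb S A := fun i => C.tape i (C.head i)

/-- Write on all tapes, then move all heads. -/
def act (w : (I → Symb S A) → I → Symb S A) (m : (I → Symb S A) → I → Move)
    (C : Cfg S I A) : Cfg S I A where
  tape i := Function.update (C.tape i) (C.head i) (w C.read i)
  head i := C.head i + (m C.read i).toInt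

open Classical in
/-- Replace the inscription of a tape. -/
noncomputable def setTape (C : Cfg S I A) (i : I) (T : Tape S A) : Cfg S I A where
  tape := Function.update C.tape i T
  head := C.head

open Classical in
/-- Place a head. -/
noncomputable def setHead (C : Cfg S I A) (i : I) (z : ℤ) : Cfg S I A where
  tape := C.tape
  head := Function.update C.head i z

/-- Consultation of the oracle `φ` with query tape `q` and answer tape `a`. -/
noncomputable def ask (φ : Baire S) (q a : I) (C : Cfg S I A) : Cfg S I A :=
  C.setTape a (Tape.ofString (φ (C.tape q).content))

theorem act_self_stay (C : Cfg S I A) : C.act (fun r => r) (fun _ _ => .stay) = C := by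
  ext <;> simp [act, read, Move.toInt]

@[simp]
theorem setTape_head (C : Cfg S I A) (i : I) (T : Tape S A) : (C.setTape i T).head = C.head := rfl

@[simp]
theorem setHead_tape (C : Cfg S I A) (i : I) (z : ℤ) : (C.setHead i z).tape = C.tape := rfl

@[simp]
theorem setTape_tape_self (C : Cfg S I A) (i : I) (T : Tape S A) : (C.setTape i T).tape i = T := by
  simp [setTape]

@[simp]
theorem setHead_head_self (C : Cfg S I A) (i : I) (z : ℤ) : (C.setHead i z).head i = z := by
  simp [setHead]

theorem setTape_tape_of_ne (C : Cfg S I A) {i j : I} (T : Tape S A) (h : j ≠ i) :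
    (C.setTape i T).tape j = C.tape j := by
  simp [setTape, h]

theorem setHead_head_of_ne (C : Cfg S I A) {i j : I} (z : ℤ) (h : j ≠ i) :
    (C.setHead i z).head j = C.head j := by
  simp [setHead, h]

end Cfg

/-- Atomic instructions over tapes indexed by `I`: write and move depending on the scanned symbols,
or consult the oracle. -/
inductive Instr (S I A : Type) : Type
  | act (w : (I → Symb S A) → I → Symb S A) (m : (I → Symb S A) → I → Move)
  | ask

/-- The instruction that changes nothing; it is executed while a condition is tested. -/
def Instr.skip {S I A : Type} : Instr S I A := .act (fun r => r) fun _ _ => .stay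

/-- The effect of an instruction, with oracle `φ`, query tape `q` and answer tape `a`. -/
noncomputable def Instr.apply {S I A : Type} (φ : Baire S) (q a : I) :
    Instr S I A → Cfg S I A → Cfg S I A
  | act w m, C => C.act w m
  | ask, C => C.ask φ q a

@[simp]
theorem Instr.skip_apply {S I A : Type} (φ : Baire S) (q a : I) (C : Cfg S I A) :
    Instr.skip.apply φ q a C = C :=
  C.act_self_stay

/-- Structured programs over tapes indexed by `I`. Conditions are arbitrary predicates of the
scanned symbols. -/
inductive Prog (S I A : Type) : Type
  | act (w : (I → Symb S A) → I → Symb S A) (m : (I → Symb S A) → I → Move)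
  | ask
  | seq (p q : Prog S I A)
  | ite (b : (I → Symb S A) → Prop) (p q : Prog S I A)
  | loop (b : (I → Symb S A) → Prop) (p : Prog S I A)

infixr:60 " ;; " => Prog.seq

/-- `Exec K p C C' t`: the program `p` leads from `C` to `C'` within `t` steps. The relation `K`
says what a consultation of the oracle does and what it costs, so that it can stand for a real
oracle as well as for a program that answers the queries. -/
inductive Exec {S I A : Type} (K : Cfg S I A → Cfg S I A → ℕ → Prop) :
    Prog S I A → Cfg S I A → Cfg S I A → ℕ → Prop
  | act (w m C) : Exec K (.act w m) C (C.act w m) 1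
  | ask {C C' n} : K C C' n → Exec K .ask C C' n
  | seq {p q C C' C'' s t} : Exec K p C C' s → Exec K q C' C'' t → Exec K (p ;; q) C C'' (s + t)
  | ite_pos {b p q C C' t} : b C.read → Exec K p C C' t → Exec K (.ite b p q) C C' (t + 1)
  | ite_neg {b p q C C' t} : ¬ b C.read → Exec K q C C' t → Exec K (.ite b p q) C C' (t + 1)
  | loop_pos {b p C C' C'' s t} : b C.read → Exec K p C C' s → Exec K (.loop b p) C' C'' t →
      Exec K (.loop b p) C C'' (s + t + 1)
  | loop_neg {b p C} : ¬ b C.read → Exec K (.loop b p) C C 1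
  | mono {p C C' s t} : Exec K p C C' s → s ≤ t → Exec K p C C' t

namespace Exec

variable {S I A : Type} {K : Cfg S I A → Cfg S I A → ℕ → Prop}

theorem act_of_eq {w m} {C C' : Cfg S I A} (h : C.act w m = C') : Exec K (.act w m) C C' 1 :=
  h ▸ .act w m C

theorem loop_iterate {b : (I → Symb S A) → Prop} {p : Prog S I A} (C : ℕ → Cfg S I A) (n t : ℕ)
    (hb : ∀ k < n, b (C k).read) (hp : ∀ k < n, Exec K p (C k) (C (k + 1)) t)
    (hn : ¬ b (C n).read) : Exec K (.loop b p) (C 0) (C n) (n * (t + 1) + 1) := by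
  suffices remaining : ∀ j k, j + k = n → Exec K (.loop b p) (C k) (C n) (j * (t + 1) + 1) from
    remaining n 0 rfl
  intro j
  induction j with
  | zero =>
    rintro k rfl
    rw [Nat.zero_add] at hn ⊢
    exact (Exec.loop_neg hn).mono (by omega)
  | succ j ih =>
    intro k hk
    refine (Exec.loop_pos (hb k (by omega)) (hp k (by omega)) (ih (k + 1) (by omega))).mono ?_
    rw [Nat.succ_mul]
    omega

end Exec

/-- The oracle `φ`, consulted in one step with query tape `q` and answer tape `a`. -/
def AskOracle {S I A : Type} (φ : Baire S) (q a : I) : Cfg S I A → Cfg S I A → ℕ → Prop :=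
  fun C C' n => C' = C.ask φ q a ∧ n = 1

namespace Prog

variable {S I A : Type}

/-- The nodes of the flowchart of a program. A conditional or a loop has a node of its own,
`none`, at which the condition is tested. -/
def Node : Prog S I A → Type
  | act _ _ => Unit
  | ask => Unit
  | seq p q => p.Node ⊕ q.Node
  | ite _ p q => Option (p.Node ⊕ q.Node)
  | loop _ p => Option p.Node

theorem finite_node : (p : Prog S I A) → Finite p.Node
  | act _ _ => inferInstanceAs (Finite Unit)
  | ask => inferInstanceAs (Finite Unit)
  | seq p q =>
    have := p.finite_node
    have := q.finite_node
    inferInstanceAs (Finite (p.Node ⊕ q.Node))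
  | ite _ p q =>
    have := p.finite_node
    have := q.finite_node
    inferInstanceAs (Finite (Option (p.Node ⊕ q.Node)))
  | loop _ p =>
    have := p.finite_node
    inferInstanceAs (Finite (Option p.Node))

/-- The node at which a program starts. -/
def entry : (p : Prog S I A) → p.Node
  | act _ _ => ()
  | ask => ()
  | seq p _ => Sum.inl p.entry
  | ite _ _ _ => none
  | loop _ _ => none

open Classical in
/-- The next node; `none` is the end of the program. -/
noncomputable def next : (p : Prog S I A) → p.Node → (I → Symb S A) → Option p.Node
  | act _ _, _, _ => none
  | ask, _, _ => none
  | seq p q, Sum.inl s, r => (p.next s r).elim (some (Sum.inr q.entry)) (some ∘ Sum.inl)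
  | seq _ q, Sum.inr s, r => (q.next s r).map Sum.inr
  | ite b p q, none, r => some (some (if b r then Sum.inl p.entry else Sum.inr q.entry))
  | ite _ p _, some (Sum.inl s), r => (p.next s r).map (some ∘ Sum.inl)
  | ite _ _ q, some (Sum.inr s), r => (q.next s r).map (some ∘ Sum.inr)
  | loop b p, none, r => if b r then some (some p.entry) else none
  | loop _ p, some s, r => some (p.next s r)

/-- The instruction at a node. -/
def instr : (p : Prog S I A) → p.Node → Instr S I A
  | act w m, _ => .act w m
  | ask, _ => .ask
  | seq p _, Sum.inl s => p.instr s
  | seq _ q, Sum.inr s => q.instr s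
  | ite _ _ _, none => .skip
  | ite _ p _, some (Sum.inl s) => p.instr s
  | ite _ _ q, some (Sum.inr s) => q.instr s
  | loop _ _, none => .skip
  | loop _ p, some s => p.instr s

/-- One step of the flowchart of a program. -/
noncomputable def step (φ : Baire S) (i j : I) (p : Prog S I A) :
    Option p.Node × Cfg S I A → Option p.Node × Cfg S I A
  | (none, C) => (none, C)
  | (some s, C) => (p.next s C.read, (p.instr s).apply φ i j C)

/-- `p.IsPart p₀ ι e`: the map `ι` identifies the flowchart of `p` with a part of that of `p₀`, the
end of `p` being identified with `e`. -/
def IsPart (p p₀ : Prog S I A) (ι : p.Node → p₀.Node) (e : Option p₀.Node) : Prop :=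
  ∀ s, p₀.instr (ι s) = p.instr s ∧ ∀ r, p₀.next (ι s) r = (p.next s r).elim e (some ∘ ι)

namespace IsPart

variable {p₀ p q : Prog S I A} {b : (I → Symb S A) → Prop} {e : Option p₀.Node}

theorem self (p : Prog S I A) : p.IsPart p id none :=
  fun s => ⟨rfl, fun r => by cases h : p.next s r <;> simp [h]⟩

theorem seq_left {ι} (h : (p ;; q).IsPart p₀ ι e) :
    p.IsPart p₀ (ι ∘ Sum.inl) (some (ι (Sum.inr q.entry))) :=
  fun s => ⟨(h (Sum.inl s)).1, fun r => by
    refine ((h (Sum.inl s)).2 r).trans ?_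
    cases hs : p.next s r <;> (simp only [next, hs]; rfl)⟩

theorem seq_right {ι} (h : (p ;; q).IsPart p₀ ι e) : q.IsPart p₀ (ι ∘ Sum.inr) e :=
  fun s => ⟨(h (Sum.inr s)).1, fun r => by
    refine ((h (Sum.inr s)).2 r).trans ?_
    cases hs : q.next s r <;> (simp only [next, hs]; rfl)⟩

theorem ite_left {ι} (h : (Prog.ite b p q).IsPart p₀ ι e) :
    p.IsPart p₀ (ι ∘ some ∘ Sum.inl) e :=
  fun s => ⟨(h (some (Sum.inl s))).1, fun r => by
    refine ((h (some (Sum.inl s))).2 r).trans ?_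
    cases hs : p.next s r <;> simp [next, hs]⟩

theorem ite_right {ι} (h : (Prog.ite b p q).IsPart p₀ ι e) :
    q.IsPart p₀ (ι ∘ some ∘ Sum.inr) e :=
  fun s => ⟨(h (some (Sum.inr s))).1, fun r => by
    refine ((h (some (Sum.inr s))).2 r).trans ?_
    cases hs : q.next s r <;> simp [next, hs]⟩

theorem loop_body {ι} (h : (Prog.loop b p).IsPart p₀ ι e) :
    p.IsPart p₀ (ι ∘ some) (some (ι none)) :=
  fun s => ⟨(h (some s)).1, fun r => by
    refine ((h (some s)).2 r).trans ?_
    cases hs : p.next s r <;> (simp only [next, hs]; rfl)⟩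

variable {φ : Baire S} {i j : I}

theorem step_eq {ι} (h : p.IsPart p₀ ι e) (s : p.Node) (C : Cfg S I A) :
    p₀.step φ i j (some (ι s), C) =
      ((p.next s C.read).elim e (some ∘ ι), (p.instr s).apply φ i j C) := by
  rw [step, (h s).1, (h s).2]

end IsPart

end Prog

open Prog in
theorem Exec.exists_iterate_step {S I A : Type} {φ : Baire S} {i j : I} {p : Prog S I A}
    {C C' : Cfg S I A} {t : ℕ} (h : Exec (AskOracle φ i j) p C C' t) {p₀ : Prog S I A}
    {ι : p.Node → p₀.Node} {e : Option p₀.Node} (hι : p.IsPart p₀ ι e) :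
    ∃ n ≤ t, (p₀.step φ i j)^[n] (some (ι p.entry), C) = (e, C') := by
  induction h generalizing e with
  | act w m C => exact ⟨1, le_rfl, hι.step_eq _ _⟩
  | ask h =>
    obtain ⟨rfl, rfl⟩ := h
    exact ⟨1, le_rfl, hι.step_eq _ _⟩
  | seq _ _ ihp ihq =>
    obtain ⟨m, hm, hpm⟩ := ihp hι.seq_left
    obtain ⟨n, hn, hqn⟩ := ihq hι.seq_right
    exact ⟨n + m, by omega, by
      rw [Function.iterate_add_apply]
      exact (congrArg _ hpm).trans hqn⟩
  | ite_pos hb _ ih =>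
    obtain ⟨n, hn, hpn⟩ := ih hι.ite_left
    refine ⟨n + 1, by omega, ?_⟩
    rw [Function.iterate_succ_apply, hι.step_eq]
    simp only [Prog.entry, next, instr, hb, if_true, Instr.skip_apply]
    exact hpn
  | ite_neg hb _ ih =>
    obtain ⟨n, hn, hqn⟩ := ih hι.ite_right
    refine ⟨n + 1, by omega, ?_⟩
    rw [Function.iterate_succ_apply, hι.step_eq]
    simp only [Prog.entry, next, instr, hb, if_false, Instr.skip_apply]
    exact hqn
  | loop_pos hb _ _ ihp ihloop =>
    obtain ⟨m, hm, hpm⟩ := ihp hι.loop_body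
    obtain ⟨n, hn, hloop⟩ := ihloop hι
    refine ⟨n + m + 1, by omega, ?_⟩
    rw [Function.iterate_succ_apply, hι.step_eq, Function.iterate_add_apply]
    refine Eq.trans (congrArg _ ?_) hloop
    simp only [Prog.entry, next, instr, hb, if_true, Instr.skip_apply]
    exact hpm
  | loop_neg hb =>
    refine ⟨1, le_rfl, (hι.step_eq _ _).trans ?_⟩
    simp [Prog.entry, next, instr, hb]
  | mono _ hst ih =>
    obtain ⟨n, hn, hpn⟩ := ih hι
    exact ⟨n, hn.trans hst, hpn⟩

/-! ### Running times and results of oracle machines -/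

namespace OracleMachine

variable {S : Type} (M : OracleMachine S) {φ : Baire S} {a : List S}

theorem step_of_halt {c : M.Config} (h : c.state = M.halt) : M.step φ c = c :=
  if_pos h

theorem step_of_oracle {c : M.Config} (h : c.state ≠ M.halt) (h' : c.state = M.oracle) :
    M.step φ c =
      { state := M.resume
        tape := fun i => match i with
          | .answer => Tape.ofString (φ (c.tape .query).content)
          | j => c.tape j
        head := c.head } :=
  (if_neg h).trans (if_pos h')

theorem step_of_ne {c : M.Config} (h : c.state ≠ M.halt) (h' : c.state ≠ M.oracle) :
    M.step φ c =
      { state := M.next c.state fun i => c.tape i (c.head i)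
        tape := fun i => Function.update (c.tape i) (c.head i)
          (M.write c.state (fun j => c.tape j (c.head j)) i)
        head := fun i => c.head i + (M.move c.state (fun j => c.tape j (c.head j)) i).toInt } :=
  (if_neg h).trans (if_neg h')

theorem run_succ (φ : Baire S) (a : List S) (n : ℕ) :
    M.run φ a (n + 1) = M.step φ (M.run φ a n) :=
  Function.iterate_succ_apply' _ _ _

theorem run_of_le {m n : ℕ} (h : (M.run φ a m).state = M.halt) (hmn : m ≤ n) :
    M.run φ a n = M.run φ a m := by
  induction n, hmn using Nat.le_induction with
  | base => rfl
  | succ n _ ih => rw [run_succ, ih, M.step_of_halt h]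

theorem time_le_iff {n : ℕ} : M.time φ a ≤ n ↔ (M.run φ a n).state = M.halt := by
  refine ⟨fun h => ?_, fun h => sInf_le ⟨n, h, rfl⟩⟩
  obtain ⟨_, ⟨k, hk, rfl⟩, hkn⟩ :=
    sInf_lt_iff.1 (h.trans_lt (Nat.cast_lt.2 n.lt_succ_self : (n : ℕ∞) < (n + 1 : ℕ)))
  rwa [M.run_of_le hk (Nat.le_of_lt_succ (Nat.cast_lt.1 hkn))]

theorem exists_time_eq {n : ℕ} (h : M.time φ a ≤ n) : ∃ k ≤ n, M.time φ a = k := by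
  obtain ⟨k, hk⟩ := ENat.ne_top_iff_exists.1 (ne_top_of_le_ne_top (ENat.natCast_ne_top n) h)
  exact ⟨k, Nat.cast_le.1 (hk.trans_le h), hk.symm⟩

theorem result_eq {n : ℕ} (h : M.time φ a ≤ n) :
    M.result φ a = ((M.run φ a n).tape .output).content := by
  obtain ⟨k, hkn, hk⟩ := M.exists_time_eq h
  rw [result, hk, ENat.toNat_natCast, M.run_of_le (M.time_le_iff.1 hk.le) hkn]

theorem output_blank (φ : Baire S) (a : List S) (n : ℕ) :
    (M.run φ a n).head .output ≤ n ∧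
      ∀ z : ℤ, (n : ℤ) ≤ z → (M.run φ a n).tape .output z = none := by
  have toInt_le_one : ∀ m : Move, m.toInt ≤ 1 := by rintro (_ | _ | _) <;> simp [Move.toInt]
  induction n with
  | zero => exact ⟨le_rfl, fun z _ => rfl⟩
  | succ n ih =>
    obtain ⟨hhead, hblank⟩ := ih
    rw [run_succ, step]
    push_cast
    split_ifs
    · exact ⟨by omega, fun z hz => hblank z (by omega)⟩
    · exact ⟨hhead.trans (by omega), fun z hz => hblank z (by omega)⟩
    · refine ⟨add_le_add hhead (toInt_le_one _), fun z hz => ?_⟩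
      dsimp only
      rw [Function.update_of_ne (by omega)]
      exact hblank z (by omega)

theorem length_result_le {n : ℕ} (h : M.time φ a ≤ n) : (M.result φ a).length ≤ n := by
  rw [M.result_eq h]
  have hblank := (M.output_blank φ a n).2 n le_rfl
  have holds := Tape.holds_content (T := (M.run φ a n).tape .output) ⟨n, by rw [hblank]; rfl⟩
  by_contra! hlt
  have := holds.1 n hlt
  simp [hblank] at this

end OracleMachine

/-! ### Compiling programs to oracle machines -/

/-- Renaming of the work tapes. -/
def TapeIdx.map {V W : Type} (f : V → W) : TapeIdx V → TapeIdx W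
  | .input => .input
  | .output => .output
  | .query => .query
  | .answer => .answer
  | .work w => .work (f w)

theorem TapeIdx.map_injective {V W : Type} {f : V → W} (hf : f.Injective) :
    (TapeIdx.map f).Injective := by
  rintro (_ | _ | _ | _ | _) (_ | _ | _ | _ | _) h <;>
    simp only [map, reduceCtorEq, work.injEq] at h ⊢
  exact hf h

/-- The states of a compiled program: the nodes of its flowchart and its end `at none`, which is
the final state, and two more states for the oracle calls. -/
inductive CState (σ : Type) : Type
  | at (s : Option σ)
  | oracle
  | resume

instance {σ : Type} [Finite σ] : Finite (CState σ) :=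
  Finite.of_injective
    (fun x : CState σ => match x with
      | .at s => some (some s)
      | .oracle => some none
      | .resume => none)
    (by rintro (_ | _ | _) (_ | _ | _) <;> simp)

namespace Prog

variable {S W A : Type}

/-- The symbols scanned by a program, read off the tapes of the compiled machine. -/
noncomputable def scanned (p : Prog S (TapeIdx W) A)
    (r : TapeIdx (Option W) → Symb S (A ⊕ Option p.Node)) : TapeIdx W → Symb S A :=
  fun i => Function.invFun (Symb.map Sum.inl) (r (i.map some))

/-- The state transitions of a compiled program. After an oracle call it continues at the return
address on the additional work tape. -/
noncomputable def compiledNext (p : Prog S (TapeIdx W) A) :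
    CState p.Node → (TapeIdx (Option W) → Symb S (A ⊕ Option p.Node)) → CState p.Node
  | .at (some s), r => match p.instr s with
    | .act _ _ => .at (p.next s (p.scanned r))
    | .ask => .oracle
  | .resume, r => match r (.work none) with
    | some (Sum.inr (Sum.inr s)) => .at s
    | _ => .at none
  | s, _ => s

open Classical in
/-- The symbols written by a compiled program. -/
noncomputable def compiledWrite (p : Prog S (TapeIdx W) A) :
    CState p.Node → (TapeIdx (Option W) → Symb S (A ⊕ Option p.Node)) →
      TapeIdx (Option W) → Symb S (A ⊕ Option p.Node)
  | .at (some s), r => match p.instr s with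
    | .act w _ =>
      Function.extend (TapeIdx.map some) (fun i => (w (p.scanned r) i).map Sum.inl) r
    | .ask => Function.update r (.work none) (some (Sum.inr (Sum.inr (p.next s (p.scanned r)))))
  | _, r => r

/-- The head movements of a compiled program. -/
noncomputable def compiledMove (p : Prog S (TapeIdx W) A) :
    CState p.Node → (TapeIdx (Option W) → Symb S (A ⊕ Option p.Node)) →
      TapeIdx (Option W) → Move
  | .at (some s), r => match p.instr s with
    | .act _ m => Function.extend (TapeIdx.map some) (m (p.scanned r)) fun _ => .stay
    | .ask => fun _ => .stay
  | _, _ => fun _ => .stay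

/-- The oracle machine of a program. An additional work tape keeps the return address of the
oracle calls, since the state in which a machine resumes does not depend on the calling state. -/
@[reducible]
noncomputable def compile [Finite W] [Finite A] (p : Prog S (TapeIdx W) A) : OracleMachine S where
  Q := CState p.Node
  W := Option W
  A := A ⊕ Option p.Node
  finQ := have := p.finite_node; inferInstance
  finW := inferInstance
  finA := have := p.finite_node; inferInstance
  start := .at (some p.entry)
  halt := .at none
  oracle := .oracle
  resume := .resume
  next := p.compiledNext
  write := p.compiledWrite
  move := p.compiledMove

variable [Finite W] [Finite A]

/-- The configuration `c` of the compiled machine agrees with the state `x` of the flowchart. -/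
def Matches (p : Prog S (TapeIdx W) A) (x : Option p.Node × Cfg S (TapeIdx W) A)
    (c : p.compile.Config) : Prop :=
  c.state = .at x.1 ∧ ∀ i : TapeIdx W, c.tape (i.map some) = (x.2.tape i).map Sum.inl ∧
    c.head (i.map some) = x.2.head i

variable {φ : Baire S} {p : Prog S (TapeIdx W) A} {s : p.Node} {C : Cfg S (TapeIdx W) A}
  {c : p.compile.Config}

theorem Matches.scanned_eq {x} (h : p.Matches x c) :
    p.scanned (fun i => c.tape i (c.head i)) = x.2.read := by
  funext i
  rw [scanned, (h.2 i).1, (h.2 i).2]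
  exact Symb.invFun_map Sum.inl_injective _

theorem Matches.step_act (h : p.Matches (some s, C) c) {w m} (hs : p.instr s = .act w m) :
    p.Matches (p.next s C.read, C.act w m) (p.compile.step φ c) := by
  have hstate : c.state = .at (some s) := h.1
  have hscan := h.scanned_eq
  have hinj := TapeIdx.map_injective (Option.some_injective W)
  rw [p.compile.step_of_ne (by simp [hstate]) (by simp [hstate]), hstate]
  refine ⟨by simp [compiledNext, hs, hscan], fun i => ⟨?_, ?_⟩⟩
  · simp only [compiledWrite, hs, hscan, hinj.extend_apply, (h.2 i).1, (h.2 i).2, Cfg.act,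
      Tape.map_update]
  · simp only [compiledMove, hs, hscan, hinj.extend_apply, (h.2 i).2, Cfg.act]

open Classical in
theorem Matches.step_call (h : p.Matches (some s, C) c) (hs : p.instr s = .ask) :
    p.compile.step φ c =
      { state := .oracle
        tape := Function.update c.tape (.work none) (Function.update (c.tape (.work none))
          (c.head (.work none)) (some (Sum.inr (Sum.inr (p.next s C.read)))))
        head := c.head } := by
  have hstate : c.state = .at (some s) := h.1
  have hscan := h.scanned_eq
  rw [p.compile.step_of_ne (by simp [hstate]) (by simp [hstate]), hstate]
  ext i
  · simp [compiledNext, hs]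
  · rcases eq_or_ne i (.work none) with rfl | hi
    · simp [compiledWrite, hs, hscan]
    · simp [compiledWrite, hs, hi]
  · simp [compiledMove, hs, Move.toInt]

theorem step_resume {s : Option p.Node} (h : c.state = .resume)
    (hs : c.tape (.work none) (c.head (.work none)) = some (Sum.inr (Sum.inr s))) :
    p.compile.step φ c = { c with state := .at s } := by
  rw [p.compile.step_of_ne (by simp [h]) (by simp [h]), h]
  ext i
  · simp [compiledNext, hs]
  · simp [compiledWrite]
  · simp [compiledMove, Move.toInt]

theorem Matches.iterate_step_ask (h : p.Matches (some s, C) c) (hs : p.instr s = .ask) :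
    p.Matches (p.next s C.read, C.ask φ .query .answer) ((p.compile.step φ)^[3] c) := by
  rw [Function.iterate_succ_apply, h.step_call hs, Function.iterate_succ_apply,
    p.compile.step_of_oracle (by simp) rfl, Function.iterate_one,
    step_resume rfl (s := p.next s C.read) (by simp)]
  refine ⟨rfl, fun i => ⟨?_, (h.2 i).2⟩⟩
  have hquery : (c.tape .query).content = (C.tape .query).content := by
    rw [← Tape.content_map Sum.inl (C.tape .query)]
    exact congrArg Tape.content (h.2 .query).1
  have hi := (h.2 i).1
  cases i with
  | answer => simp [TapeIdx.map, Cfg.ask, hquery]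
  | _ => simpa [TapeIdx.map, Cfg.ask, Cfg.setTape] using hi

theorem Matches.exists_iterate_step {x} (h : p.Matches x c) :
    ∃ k ≤ 3, p.Matches (p.step φ .query .answer x) ((p.compile.step φ)^[k] c) := by
  obtain ⟨_ | s, C⟩ := x
  · exact ⟨0, by omega, h⟩
  · cases hs : p.instr s with
    | act w m => exact ⟨1, by omega, by simpa [Prog.step, hs, Instr.apply] using h.step_act hs⟩
    | ask => exact ⟨3, le_rfl, by simpa [Prog.step, hs, Instr.apply] using h.iterate_step_ask hs⟩

theorem Matches.exists_iterate_iterate {x} (h : p.Matches x c) (n : ℕ) :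
    ∃ k ≤ 3 * n, p.Matches ((p.step φ .query .answer)^[n] x) ((p.compile.step φ)^[k] c) := by
  induction n with
  | zero => exact ⟨0, le_rfl, h⟩
  | succ n ih =>
    obtain ⟨k, hk, hmatch⟩ := ih
    obtain ⟨l, hl, hstep⟩ := hmatch.exists_iterate_step (φ := φ)
    refine ⟨l + k, by omega, ?_⟩
    rwa [Function.iterate_succ_apply', Function.iterate_add_apply]

/-- The initial configuration of a program for an oracle machine. -/
def initCfg (a : List S) : Cfg S (TapeIdx W) A where
  tape i := match i with
    | .input => Tape.ofString a
    | _ => Tape.blank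
  head _ := 0

theorem compile_spec {a : List S} {C' : Cfg S (TapeIdx W) A} {t : ℕ}
    (h : Exec (AskOracle φ .query .answer) p (initCfg a) C' t) :
    p.compile.time φ a ≤ (3 * t : ℕ) ∧ p.compile.result φ a = (C'.tape .output).content := by
  have hinit : p.Matches (some p.entry, initCfg a) (p.compile.init a) :=
    ⟨rfl, fun i => ⟨by cases i <;> simp [OracleMachine.init, initCfg, TapeIdx.map] <;> rfl, rfl⟩⟩
  obtain ⟨n, hnt, hn⟩ := h.exists_iterate_step (.self p)
  obtain ⟨k, hkn, hk⟩ := hinit.exists_iterate_iterate (φ := φ) n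
  rw [id_eq] at hn
  rw [hn] at hk
  have htime : p.compile.time φ a ≤ k := p.compile.time_le_iff.2 hk.1
  refine ⟨htime.trans (Nat.cast_le.2 (by omega)), ?_⟩
  rw [p.compile.result_eq htime, ← Tape.content_map Sum.inl (C'.tape .output)]
  exact congrArg Tape.content (hk.2 .output).1

end Prog

/-! ### Substituting a program for the oracle -/

section Embed

variable {S I J A B : Type}

/-- The configuration `C` placed on the tapes `e i` of the configuration `F`. -/
noncomputable def Cfg.embed (e : I → J) (f : A → B) (F : Cfg S J B) (C : Cfg S I A) :
    Cfg S J B where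
  tape := Function.extend e (fun i => (C.tape i).map f) F.tape
  head := Function.extend e C.head F.head

/-- The symbols scanned by a program on the tapes `e i`. -/
noncomputable def pullRead (e : I → J) (f : A → B) (r : J → Symb S B) : I → Symb S A :=
  fun i => Function.invFun (Symb.map f) (r (e i))

/-- A program moved to the tapes `e i`, with the subroutine `H` in place of the oracle. -/
noncomputable def Prog.subst (p : Prog S I A) (e : I → J) (f : A → B) (H : Prog S J B) :
    Prog S J B :=
  match p with
  | .act w m => .act
      (fun r => Function.extend e (fun i => (w (pullRead e f r) i).map f) r)
      (fun r => Function.extend e (m (pullRead e f r)) fun _ => .stay)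
  | .ask => H
  | .seq p q => p.subst e f H ;; q.subst e f H
  | .ite b p q => .ite (fun r => b (pullRead e f r)) (p.subst e f H) (q.subst e f H)
  | .loop b p => .loop (fun r => b (pullRead e f r)) (p.subst e f H)

variable {e : I → J} {f : A → B}

namespace Cfg

theorem embed_tape (he : e.Injective) (F : Cfg S J B) (C : Cfg S I A) (i : I) :
    (embed e f F C).tape (e i) = (C.tape i).map f :=
  he.extend_apply (fun i => (C.tape i).map f) F.tape i

theorem embed_head (he : e.Injective) (F : Cfg S J B) (C : Cfg S I A) (i : I) :
    (embed e f F C).head (e i) = C.head i :=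
  he.extend_apply ..

theorem embed_tape_of_notMem (F : Cfg S J B) (C : Cfg S I A) {j : J} (h : ¬ ∃ i, e i = j) :
    (embed e f F C).tape j = F.tape j :=
  Function.extend_apply' (fun i => (C.tape i).map f) F.tape j h

theorem embed_head_of_notMem (F : Cfg S J B) (C : Cfg S I A) {j : J} (h : ¬ ∃ i, e i = j) :
    (embed e f F C).head j = F.head j :=
  Function.extend_apply' _ _ _ h

theorem embed_eq_iff (he : e.Injective) {F G : Cfg S J B} {C : Cfg S I A} :
    embed e f F C = G ↔ (∀ i, G.tape (e i) = (C.tape i).map f ∧ G.head (e i) = C.head i) ∧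
      ∀ j, (¬ ∃ i, e i = j) → G.tape j = F.tape j ∧ G.head j = F.head j := by
  constructor
  · rintro rfl
    exact ⟨fun i => ⟨embed_tape he .., embed_head he ..⟩,
      fun j hj => ⟨embed_tape_of_notMem _ _ hj, embed_head_of_notMem _ _ hj⟩⟩
  · rintro ⟨hmem, hnotMem⟩
    refine Cfg.ext (funext fun j => ?_) (funext fun j => ?_) <;> by_cases hj : ∃ i, e i = j
    · obtain ⟨i, rfl⟩ := hj
      rw [embed_tape he, (hmem i).1]
    · rw [embed_tape_of_notMem _ _ hj, (hnotMem j hj).1]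
    · obtain ⟨i, rfl⟩ := hj
      rw [embed_head he, (hmem i).2]
    · rw [embed_head_of_notMem _ _ hj, (hnotMem j hj).2]

theorem embed_setTape (he : e.Injective) (F : Cfg S J B) (C : Cfg S I A) (i : I) (T : Tape S A) :
    embed e f F (C.setTape i T) = (embed e f F C).setTape (e i) (T.map f) := by
  refine (embed_eq_iff he).2 ⟨fun k => ⟨?_, embed_head (f := f) he ..⟩, fun j hj => ⟨?_, ?_⟩⟩
  · rcases eq_or_ne k i with rfl | hk
    · simp
    · rw [setTape_tape_of_ne _ _ hk, setTape_tape_of_ne _ _ (he.ne hk), embed_tape he]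
  · rw [setTape_tape_of_ne _ _ fun h => hj ⟨i, h.symm⟩, embed_tape_of_notMem F _ hj]
  · rw [setTape_head, embed_head_of_notMem F _ hj]

theorem embed_setTape_of_notMem (he : e.Injective) (F : Cfg S J B) (C : Cfg S I A) {j : J}
    (h : ¬ ∃ i, e i = j) (T : Tape S B) :
    embed e f (F.setTape j T) C = (embed e f F C).setTape j T := by
  refine (embed_eq_iff he).2 ⟨fun i => ⟨?_, embed_head (f := f) he ..⟩, fun k hk => ⟨?_, ?_⟩⟩
  · rw [setTape_tape_of_ne _ _ fun h' => h ⟨i, h'⟩, embed_tape he]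
  · rcases eq_or_ne k j with rfl | hkj
    · simp
    · rw [setTape_tape_of_ne _ _ hkj, setTape_tape_of_ne _ _ hkj, embed_tape_of_notMem _ _ hk]
  · exact embed_head_of_notMem (f := f) _ _ hk

theorem pullRead_embed (he : e.Injective) (hf : f.Injective) (F : Cfg S J B) (C : Cfg S I A) :
    pullRead e f (embed e f F C).read = C.read := by
  funext i
  rw [pullRead, read, embed_tape he, embed_head he]
  exact Symb.invFun_map hf _

theorem embed_act (he : e.Injective) (hf : f.Injective) (F : Cfg S J B) (C : Cfg S I A) (w m) :
    (embed e f F C).act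
      (fun r => Function.extend e (fun i => (w (pullRead e f r) i).map f) r)
      (fun r => Function.extend e (m (pullRead e f r)) fun _ => .stay) =
    embed e f F (C.act w m) := by
  refine ((embed_eq_iff he).2 ⟨fun i => ⟨?_, ?_⟩, fun j hj => ⟨?_, ?_⟩⟩).symm <;>
    simp only [act, pullRead_embed he hf]
  · rw [he.extend_apply, embed_tape he, embed_head he, Tape.map_update]
  · rw [he.extend_apply, embed_head he]
  · rw [Function.extend_apply' _ _ _ hj, read, Function.update_eq_self, embed_tape_of_notMem _ _ hj]
  · rw [Function.extend_apply' _ _ _ hj, embed_head_of_notMem _ _ hj, Move.toInt, add_zero]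

end Cfg

/-- The tapes that the program does not use are subject to the invariant `Φ` of the subroutine. -/
theorem Exec.subst {K : Cfg S I A → Cfg S I A → ℕ → Prop} {K' : Cfg S J B → Cfg S J B → ℕ → Prop}
    {H : Prog S J B} (he : e.Injective) (hf : f.Injective) (Φ : Cfg S J B → Prop)
    (hH : ∀ C C' n F, K C C' n → Φ F →
      ∃ F', Φ F' ∧ Exec K' H (Cfg.embed e f F C) (Cfg.embed e f F' C') n)
    {p : Prog S I A} {C C' : Cfg S I A} {t : ℕ} (h : Exec K p C C' t) {F : Cfg S J B} (hF : Φ F) :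
    ∃ F', Φ F' ∧ Exec K' (p.subst e f H) (Cfg.embed e f F C) (Cfg.embed e f F' C') t := by
  induction h generalizing F with
  | act w m C => exact ⟨F, hF, .act_of_eq (Cfg.embed_act he hf F C w m)⟩
  | ask h => exact hH _ _ _ F h hF
  | seq _ _ ihp ihq =>
    obtain ⟨F₁, hF₁, hp⟩ := ihp hF
    obtain ⟨F₂, hF₂, hq⟩ := ihq hF₁
    exact ⟨F₂, hF₂, hp.seq hq⟩
  | ite_pos hb _ ih =>
    obtain ⟨F₁, hF₁, hp⟩ := ih hF
    exact ⟨F₁, hF₁, .ite_pos (by rwa [Cfg.pullRead_embed he hf]) hp⟩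
  | ite_neg hb _ ih =>
    obtain ⟨F₁, hF₁, hq⟩ := ih hF
    exact ⟨F₁, hF₁, .ite_neg (by rwa [Cfg.pullRead_embed he hf]) hq⟩
  | loop_pos hb _ _ ihp ihloop =>
    obtain ⟨F₁, hF₁, hp⟩ := ihp hF
    obtain ⟨F₂, hF₂, hloop⟩ := ihloop hF₁
    exact ⟨F₂, hF₂, .loop_pos (by rwa [Cfg.pullRead_embed he hf]) hp hloop⟩
  | loop_neg hb => exact ⟨F, hF, .loop_neg (by rwa [Cfg.pullRead_embed he hf])⟩
  | mono _ hst ih =>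
    obtain ⟨F₁, hF₁, hp⟩ := ih hF
    exact ⟨F₁, hF₁, hp.mono hst⟩

end Embed

/-! ### Programs that handle strings -/

namespace Move

@[simp] theorem toInt_left : left.toInt = -1 := rfl

@[simp] theorem toInt_stay : stay.toInt = 0 := rfl

@[simp] theorem toInt_right : right.toInt = 1 := rfl

open Classical in
/-- The movement of a single head. -/
noncomputable def only {I : Type} (i : I) (d : Move) : I → Move :=
  Function.update (fun _ => .stay) i d

end Move

section Strings

variable {S I A : Type}

namespace Cfg

/-- Move all heads `n` times. -/
def moved (D : I → Move) (n : ℕ) (C : Cfg S I A) : Cfg S I A where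
  tape := C.tape
  head j := C.head j + n * (D j).toInt

@[simp]
theorem moved_zero (D : I → Move) (C : Cfg S I A) : C.moved D 0 = C := by
  simp [moved]

theorem moved_only (C : Cfg S I A) (i : I) (d : Move) (n : ℕ) :
    C.moved (.only i d) n = C.setHead i (C.head i + n * d.toInt) := by
  refine Cfg.ext rfl (funext fun j => ?_)
  rcases eq_or_ne j i with rfl | hj
  · simp [moved, Move.only]
  · simp [moved, Move.only, setHead, hj]

theorem setTape_moved (D : I → Move) (n : ℕ) (C : Cfg S I A) (i : I) (T : Tape S A) :
    (C.moved D n).setTape i T = (C.setTape i T).moved D n := rfl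

@[simp]
theorem setHead_setHead (C : Cfg S I A) (i : I) (y z : ℤ) :
    (C.setHead i y).setHead i z = C.setHead i z := by
  simp [setHead]

@[simp]
theorem setTape_setTape (C : Cfg S I A) (i : I) (T U : Tape S A) :
    (C.setTape i T).setTape i U = C.setTape i U := by
  simp [setTape]

theorem setTape_setHead (C : Cfg S I A) (i j : I) (T : Tape S A) (z : ℤ) :
    (C.setHead j z).setTape i T = (C.setTape i T).setHead j z := rfl

theorem setTape_comm (C : Cfg S I A) {i j : I} (h : i ≠ j) (T U : Tape S A) :
    (C.setTape i T).setTape j U = (C.setTape j U).setTape i T := by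
  classical simp [setTape, Function.update_comm h]

theorem setHead_eq {C : Cfg S I A} {i : I} {z : ℤ} (h : C.head i = z) : C.setHead i z = C := by
  simp [setHead, ← h]

theorem setTape_eq {C : Cfg S I A} {i : I} {T : Tape S A} (h : C.tape i = T) :
    C.setTape i T = C := by
  simp [setTape, ← h]

end Cfg

/-- Move all heads. -/
def Prog.shift (D : I → Move) : Prog S I A := .act (fun r => r) fun _ => D

open Classical in
/-- Write on one tape, then move all heads. -/
noncomputable def Prog.put (i : I) (g : (I → Symb S A) → Symb S A) (D : I → Move) : Prog S I A :=
  .act (fun r => Function.update r i (g r)) fun _ => D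

variable {K : Cfg S I A → Cfg S I A → ℕ → Prop}

theorem Exec.shift (D : I → Move) (C : Cfg S I A) : Exec K (.shift D) C (C.moved D 1) 1 :=
  .act_of_eq (by simp [Cfg.act, Cfg.moved, Cfg.read])

theorem Exec.shift_only (i : I) (d : Move) (C : Cfg S I A) (z : ℤ) :
    Exec K (.shift (.only i d)) (C.setHead i z) (C.setHead i (z + d.toInt)) 1 := by
  simpa [Cfg.moved_only] using Exec.shift (K := K) (.only i d) (C.setHead i z)

theorem Exec.put (i : I) (g : (I → Symb S A) → Symb S A) (D : I → Move) (C : Cfg S I A) :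
    Exec K (.put i g D) C
      ((C.setTape i (Function.update (C.tape i) (C.head i) (g C.read))).moved D 1) 1 := by
  refine .act_of_eq (Cfg.ext (funext fun j => ?_) (by simp [Cfg.act, Cfg.moved]))
  rcases eq_or_ne j i with rfl | hj
  · simp [Cfg.act, Cfg.moved]
  · simp [Cfg.act, Cfg.moved, Cfg.setTape, Cfg.read, hj]

theorem Exec.scan (i : I) (d : Move) {b : (I → Symb S A) → Prop} (C : Cfg S I A) (z : ℤ) (n : ℕ)
    (hb : ∀ k < n, b (C.setHead i (z + k * d.toInt)).read)
    (hn : ¬ b (C.setHead i (z + n * d.toInt)).read) :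
    Exec K (.loop b (.shift (.only i d))) (C.setHead i z) (C.setHead i (z + n * d.toInt))
      (2 * n + 1) := by
  have iterations := Exec.loop_iterate (K := K) (p := .shift (.only i d))
    (fun k => C.setHead i (z + k * d.toInt)) n 1 hb
    (fun k _ => by
      rw [Nat.cast_succ, add_one_mul, ← add_assoc]
      exact Exec.shift_only i d C _) hn
  rw [Nat.cast_zero, zero_mul, add_zero] at iterations
  exact iterations.mono (by omega)

/-- A loop that passes over a tape: `U k` is the inscription of the tape after `k` iterations. -/
theorem Exec.sweep (i : I) (D : I → Move) {b : (I → Symb S A) → Prop}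
    {g : (I → Symb S A) → Symb S A} (C : Cfg S I A) (U : ℕ → Tape S A) (n : ℕ)
    (hb : ∀ k < n, b ((C.setTape i (U k)).moved D k).read)
    (hn : ¬ b ((C.setTape i (U n)).moved D n).read)
    (hU : ∀ k < n, U (k + 1) = Function.update (U k) (C.head i + k * (D i).toInt)
      (g ((C.setTape i (U k)).moved D k).read)) :
    Exec K (.loop b (.put i g D)) (C.setTape i (U 0)) ((C.setTape i (U n)).moved D n)
      (2 * n + 1) := by
  have iterations := Exec.loop_iterate (K := K) (p := .put i g D)
    (fun k => (C.setTape i (U k)).moved D k) n 1 hb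
    (fun k hk => by
      have hput := Exec.put (K := K) i g D ((C.setTape i (U k)).moved D k)
      rw [Cfg.setTape_moved, Cfg.setTape_setTape] at hput
      convert hput using 1
      simp [Cfg.moved, hU k hk, add_assoc, add_mul]) hn
  rw [Cfg.moved_zero] at iterations
  exact iterations.mono (by omega)

/-- The scanned symbol is a letter. -/
def IsLetter (i : I) (r : I → Symb S A) : Prop := (r i).letter ≠ none

theorem isLetter_read_iff {C : Cfg S I A} {i : I} {w : List S} (h : C.tape i = Tape.ofString w) :
    IsLetter i C.read ↔ 0 ≤ C.head i ∧ C.head i < w.length := by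
  rw [IsLetter, Cfg.read, h]
  rcases lt_or_ge (C.head i) 0 with hneg | hnonneg
  · simp [Tape.ofString_of_neg w hneg, hneg]
  · lift C.head i to ℕ using hnonneg with k
    simp [Tape.letter_ofString]

/-- Return to the start of a string from its end. -/
noncomputable def Prog.rewind (i : I) : Prog S I A :=
  .shift (.only i .left) ;; .loop (IsLetter i) (.shift (.only i .left)) ;;
    .shift (.only i .right)

theorem Exec.rewind (i : I) (C : Cfg S I A) (w : List S) (h : C.tape i = Tape.ofString w) {n : ℕ}
    (hn : n ≤ w.length) : Exec K (.rewind i) (C.setHead i n) (C.setHead i 0) (2 * n + 3) := by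
  have hscan := Exec.scan (K := K) i .left (b := IsLetter i) C (n + Move.left.toInt) n
    (fun k hk => (isLetter_read_iff (C := C.setHead i _) h).2 (by simp; omega))
    (fun hletter => by
      simpa using (isLetter_read_iff (C := C.setHead i _) h).1 hletter)
  have hrewind := (Exec.shift_only (K := K) i .left C n).seq
    (hscan.seq (Exec.shift_only i .right C _))
  have hend : (n : ℤ) + Move.left.toInt + n * Move.left.toInt + Move.right.toInt = 0 := by simp
  rw [hend] at hrewind
  exact hrewind.mono (by omega)

/-- Erase a string from its last letter to its first one. -/
noncomputable def Prog.eraseLeft (i : I) : Prog S I A :=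
  .loop (IsLetter i) (.put i (fun _ => none) (.only i .left))

theorem Exec.eraseLeft (i : I) (C : Cfg S I A) (w : List S) :
    Exec K (.eraseLeft i) ((C.setTape i (Tape.ofString w)).setHead i (w.length - 1))
      ((C.setTape i Tape.blank).setHead i (-1)) (2 * w.length + 1) := by
  induction w using List.reverseRecOn with
  | nil =>
    rw [Tape.ofString_nil, List.length_nil, Nat.cast_zero, zero_sub]
    exact .loop_neg (by simp [IsLetter, Cfg.read])
  | append_singleton w s ih =>
    have erased : Function.update (Tape.ofString (w ++ [s]) : Tape S A) w.length none =
        Tape.ofString w := by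
      rw [Tape.ofString_concat, Function.update_idem, Function.update_eq_self_iff,
        Tape.ofString_of_le w le_rfl]
    have hput := Exec.put (K := K) i (fun _ => none) (.only i .left)
      ((C.setTape i (Tape.ofString (w ++ [s]))).setHead i w.length)
    simp only [Cfg.moved_only, Cfg.setTape_setHead, Cfg.setTape_setTape, Cfg.setHead_setHead,
      Cfg.setHead_tape, Cfg.setTape_tape_self, Cfg.setHead_head_self, erased, Nat.cast_one,
      one_mul, Move.toInt_left] at hput
    simp only [List.length_append, List.length_singleton, Nat.cast_add, Nat.cast_one,
      add_sub_cancel_right]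
    refine (Exec.loop_pos ?_ hput ih).mono (by omega)
    simp [isLetter_read_iff (w := w ++ [s])]

/-- Erase a string, starting and ending with the head on its first cell. -/
noncomputable def Prog.eraseString (i : I) : Prog S I A :=
  .loop (IsLetter i) (.shift (.only i .right)) ;; .shift (.only i .left) ;;
    .eraseLeft i ;; .shift (.only i .right)

theorem Exec.eraseString (i : I) (C : Cfg S I A) (w : List S) (h : C.tape i = Tape.ofString w)
    (h0 : C.head i = 0) :
    Exec K (.eraseString i) C (C.setTape i Tape.blank) (5 * w.length + 5) := by
  have hscan := Exec.scan (K := K) i .right (b := IsLetter i) C 0 w.length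
    (fun k hk => (isLetter_read_iff (C := C.setHead i _) h).2 (by simpa using hk))
    (fun hletter => by
      simpa using (isLetter_read_iff (C := C.setHead i _) h).1 hletter)
  have hleft := Exec.shift_only (K := K) i .left C w.length
  have herase := Exec.eraseLeft (K := K) i C w
  have hright := Exec.shift_only (K := K) i .right (C.setTape i Tape.blank) (-1)
  rw [zero_add, Move.toInt_right, mul_one] at hscan
  rw [Move.toInt_left] at hleft
  rw [Move.toInt_right, neg_add_cancel] at hright
  rw [Cfg.setHead_eq h0] at hscan
  rw [Cfg.setTape_eq h] at herase
  rw [Cfg.setHead_eq (C := C.setTape i Tape.blank) h0] at hright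
  exact (hscan.seq (hleft.seq (herase.seq hright))).mono (by omega)

open Classical in
/-- Append the letters that `rd` reads to the string on the tape `i`, until there is none,
with the head movements `D` on the other tapes. -/
noncomputable def Prog.copy (rd : (I → Symb S A) → Option S) (i : I) (D : I → Move) :
    Prog S I A :=
  .loop (fun r => rd r ≠ none)
    (.put i (fun r => (rd r).map Sum.inl) (Function.update D i .right))

theorem Exec.copy (rd : (I → Symb S A) → Option S) (i : I) (D : I → Move) (C : Cfg S I A)
    (v w : List S)
    (hrd : ∀ k ≤ w.length, ∀ r : I → Symb S A, (∀ j ≠ i, r j = (C.moved D k).read j) →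
      rd r = w[k]?) :
    Exec K (.copy rd i D) ((C.setTape i (Tape.ofString v)).setHead i v.length)
      (((C.moved D w.length).setTape i (Tape.ofString (v ++ w))).setHead i (v.length + w.length))
      (2 * w.length + 1) := by
  classical
  have hread : ∀ k ≤ w.length, rd ((((C.setHead i v.length).setTape i
      (Tape.ofString (v ++ w.take k))).moved (Function.update D i .right) k).read) = w[k]? :=
    fun k hk => hrd k hk _ fun j hj => by
      simp [Cfg.read, Cfg.moved, Cfg.setTape_tape_of_ne _ _ hj, Cfg.setHead_head_of_ne _ _ hj, hj]
  have hsweep := Exec.sweep (K := K) i (Function.update D i .right) (b := fun r => rd r ≠ none)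
    (g := fun r => (rd r).map Sum.inl) (C.setHead i v.length)
    (fun k => Tape.ofString (v ++ w.take k)) w.length
    (fun k hk => by rw [hread k hk.le, List.getElem?_eq_getElem hk]; exact Option.some_ne_none _)
    (by rw [hread _ le_rfl, List.getElem?_eq_none le_rfl]; exact not_not.2 rfl)
    (fun k hk => by
      have hpos : (v.length : ℤ) + k * Move.right.toInt = ((v ++ w.take k).length : ℕ) := by
        simp; omega
      rw [hread k hk.le, Cfg.setHead_head_self, Function.update_self, hpos, List.take_add_one,
        List.getElem?_eq_getElem hk, ← List.append_assoc]
      exact Tape.ofString_concat _ _)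
  rw [List.take_zero, List.append_nil, List.take_length] at hsweep
  have hend : ((C.moved D w.length).setTape i (Tape.ofString (v ++ w))).setHead i
      (v.length + w.length) = ((C.setHead i v.length).setTape i
        (Tape.ofString (v ++ w))).moved (Function.update D i .right) w.length := by
    refine Cfg.ext rfl (funext fun j => ?_)
    rcases eq_or_ne j i with rfl | hj
    · simp [Cfg.moved]
    · simp [Cfg.moved, Cfg.setHead_head_of_ne _ _ hj, hj]
  rw [hend]
  exact hsweep

end Strings

/-! ### Virtual tapes -/

/-- The auxiliary symbols of a simulation. A cell of a virtual tape holds a symbol if the simulated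
machine has written one there, a mark for the origin and a mark for the position of the head. The
other symbols hold a state and the information whether the oracle has been consulted. -/
inductive SimSym (S Q A : Type) : Type
  | cell (x : Option (Symb S A)) (org hd : Bool)
  | st (q : Q) (asked : Bool)

section VirtualTapes

variable {S Q A : Type}

/-- The symbol written in a cell. -/
def cellVal : Symb S (SimSym S Q A) → Option (Symb S A)
  | some (Sum.inr (.cell x _ _)) => x
  | _ => none

/-- The origin mark of a cell. -/
def cellOrg : Symb S (SimSym S Q A) → Bool
  | some (Sum.inr (.cell _ o _)) => o
  | _ => false

/-- The head mark of a cell. -/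
def cellHd : Symb S (SimSym S Q A) → Bool
  | some (Sum.inr (.cell _ _ h)) => h
  | _ => false

/-- A virtual tape: the symbols that have been written, and the interval of the cells that have
been visited. A cell in which nothing has been written is not blank: it shows the symbol of a tape
beneath the virtual one. In this way the input and the answers of the oracle are read in place;
the latter may be too long to be copied or erased in the available time. -/
structure VTape (S A : Type) where
  val : ℤ → Option (Symb S A)
  lo : ℤ
  hi : ℤ
  lo_nonpos : lo ≤ 0
  hi_nonneg : 0 ≤ hi
  val_eq_none : ∀ z, ¬ (lo ≤ z ∧ z ≤ hi) → val z = none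

namespace VTape

/-- The virtual tape on which only the origin has been visited. -/
def empty : VTape S A where
  val _ := none
  lo := 0
  hi := 0
  lo_nonpos := le_rfl
  hi_nonneg := le_rfl
  val_eq_none _ _ := rfl

/-- The visited cells lie between `-N` and `N`. -/
def Within (T : VTape S A) (N : ℕ) : Prop := -(N : ℤ) ≤ T.lo ∧ T.hi ≤ N

/-- The cell `z` has been visited or is adjacent to a visited one. -/
def Near (T : VTape S A) (z : ℤ) : Prop := T.lo - 1 ≤ z ∧ z ≤ T.hi + 1

/-- Visit the cell `z` and leave the value `v` there. -/
def write (T : VTape S A) (z : ℤ) (v : Option (Symb S A)) : VTape S A where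
  val := Function.update T.val z v
  lo := min T.lo z
  hi := max T.hi z
  lo_nonpos := (min_le_left ..).trans T.lo_nonpos
  hi_nonneg := T.hi_nonneg.trans (le_max_left ..)
  val_eq_none y hy := by
    rw [Function.update_of_ne (by omega)]
    exact T.val_eq_none y (by omega)

/-- Visit the cell `z` without writing. -/
def visit (T : VTape S A) (z : ℤ) : VTape S A := T.write z (T.val z)

/-- Forget all symbols, but not which cells have been visited. -/
def erase (T : VTape S A) : VTape S A where
  __ := T
  val _ := none
  val_eq_none _ _ := rfl

@[simp]
theorem visit_val (T : VTape S A) (z : ℤ) : (T.visit z).val = T.val :=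
  Function.update_eq_self ..

theorem visit_of_mem (T : VTape S A) {z : ℤ} (h : T.lo ≤ z ∧ z ≤ T.hi) : T.visit z = T := by
  cases T
  simp [visit, write, h.1, h.2]

theorem Within.write {T : VTape S A} {N : ℕ} (h : T.Within N) {z : ℤ} (hz : T.Near z)
    (v : Option (Symb S A)) : (T.write z v).Within (N + 1) := by
  simp only [Within, VTape.write, Near] at h hz ⊢
  omega

theorem mem_write (T : VTape S A) (z : ℤ) (v : Option (Symb S A)) :
    (T.write z v).lo ≤ z ∧ z ≤ (T.write z v).hi :=
  ⟨min_le_right .., le_max_right ..⟩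

theorem mem_visit (T : VTape S A) (z : ℤ) : (T.visit z).lo ≤ z ∧ z ≤ (T.visit z).hi :=
  mem_write ..

theorem Within.visit {T : VTape S A} {N : ℕ} (h : T.Within N) {z : ℤ} (hz : T.Near z) :
    (T.visit z).Within (N + 1) :=
  h.write hz _

theorem near_of_mem {T : VTape S A} {z : ℤ} (h : T.lo ≤ z ∧ z ≤ T.hi) : T.Near z := by
  simp only [Near]
  omega

/-- The inscription of a virtual tape with a head mark in the cell `m`. -/
def tape (T : VTape S A) (m : Option ℤ) : Tape S (SimSym S Q A) := fun z =>
  if T.lo ≤ z ∧ z ≤ T.hi then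
    some (Sum.inr (.cell (T.val z) (decide (z = 0)) (decide (m = some z))))
  else none

variable {T : VTape S A} {m : Option ℤ} {z : ℤ}

theorem tape_of_mem (h : T.lo ≤ z ∧ z ≤ T.hi) : (T.tape m z : Symb S (SimSym S Q A)) =
    some (Sum.inr (.cell (T.val z) (decide (z = 0)) (decide (m = some z)))) :=
  if_pos h

theorem tape_eq_none_iff :
    (T.tape m z : Symb S (SimSym S Q A)) = none ↔ ¬ (T.lo ≤ z ∧ z ≤ T.hi) := by
  rw [tape]
  split_ifs with h <;> simp [h]

theorem cellVal_tape : cellVal (T.tape m z : Symb S (SimSym S Q A)) = T.val z := by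
  by_cases h : T.lo ≤ z ∧ z ≤ T.hi
  · rw [tape_of_mem h, cellVal]
  · rw [tape_eq_none_iff.2 h, T.val_eq_none z h, cellVal]
    simp

theorem cellOrg_tape : cellOrg (T.tape m z : Symb S (SimSym S Q A)) = decide (z = 0) := by
  by_cases h : T.lo ≤ z ∧ z ≤ T.hi
  · rw [tape_of_mem h, cellOrg]
  · have hz : z ≠ 0 := by
      rintro rfl
      exact h ⟨T.lo_nonpos, T.hi_nonneg⟩
    simp [tape_eq_none_iff.2 h, cellOrg, hz]

theorem cellHd_tape (h : T.lo ≤ z ∧ z ≤ T.hi) :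
    cellHd (T.tape m z : Symb S (SimSym S Q A)) = decide (m = some z) := by
  rw [tape_of_mem h, cellHd]

theorem tape_write (hz : T.Near z) (v : Option (Symb S A)) {m' : Option ℤ}
    (hm : ∀ y ≠ z, m = some y ↔ m' = some y) :
    (T.write z v).tape m' = Function.update (T.tape m : Tape S (SimSym S Q A)) z
      (some (Sum.inr (.cell v (decide (z = 0)) (decide (m' = some z))))) := by
  funext y
  rcases eq_or_ne y z with rfl | hy
  · rw [Function.update_self, tape_of_mem (mem_write ..)]
    simp [write]
  · have hmem : (min T.lo z ≤ y ∧ y ≤ max T.hi z) ↔ (T.lo ≤ y ∧ y ≤ T.hi) := by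
      simp only [Near] at hz
      omega
    simp only [Function.update_of_ne hy, tape, write, hmem, hm y hy]

end VTape

end VirtualTapes

/-! ### Simulation of an oracle machine by a program -/

/-- The tapes of a simulation: virtual tapes, a tape for the state, and four tapes that hold the
input, a query to the oracle, its last answer, and the output. -/
inductive SimTape (W : Type) : Type
  | virt (i : TapeIdx W)
  | st
  | inp
  | qry
  | ans
  | out

section Simulation

variable {S : Type} (M : OracleMachine S)

/-- The configurations of the simulation of `M`. -/
abbrev SimCfg : Type := Cfg S (SimTape M.W) (SimSym S M.Q M.A)

/-- The programs in the simulation of `M`. -/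
abbrev SimProg : Type := Prog S (SimTape M.W) (SimSym S M.Q M.A)

/-- The data that determine a configuration of the simulation of `M`: the state symbol, the virtual
tapes with their heads, and the strings on the other tapes. -/
structure SimState where
  state : Symb S (SimSym S M.Q M.A)
  tape : TapeIdx M.W → Tape S (SimSym S M.Q M.A)
  head : TapeIdx M.W → ℤ
  input : List S
  query : List S
  answer : List S
  output : List S

variable {M}

open Classical in
/-- Move the head of a virtual tape; the heads on the input and on the answer of the oracle, which
lie beneath the virtual tapes `input` and `answer`, follow. -/
noncomputable def vmove {W : Type} (i : TapeIdx W) (d : Move) : SimTape W → Move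
  | .virt j => if j = i then d else .stay
  | .inp => if .input = i then d else .stay
  | .ans => if .answer = i then d else .stay
  | _ => .stay

namespace SimState

/-- The configuration that is given by `s`. -/
noncomputable def cfg (s : SimState M) : SimCfg M where
  tape j := match j with
    | .virt i => s.tape i
    | .st => Function.update Tape.blank 0 s.state
    | .inp => Tape.ofString s.input
    | .qry => Tape.ofString s.query
    | .ans => Tape.ofString s.answer
    | .out => Tape.ofString s.output
  head j := match j with
    | .virt i => s.head i
    | .inp => s.head .input
    | .ans => s.head .answer
    | _ => 0

open Classical in
/-- Replace the virtual tape `i` and the position of its head. -/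
noncomputable def put (s : SimState M) (i : TapeIdx M.W) (T : Tape S (SimSym S M.Q M.A)) (z : ℤ) :
    SimState M where
  __ := s
  tape := Function.update s.tape i T
  head := Function.update s.head i z

variable (s : SimState M) (i : TapeIdx M.W) (T U : Tape S (SimSym S M.Q M.A)) (z : ℤ)

@[simp]
theorem put_self : s.put i (s.tape i) (s.head i) = s := by
  simp [put]

@[simp]
theorem put_cfg_read_virt : (s.put i T z).cfg.read (.virt i) = T z := by
  simp [Cfg.read, cfg, put]

@[simp]
theorem cfg_setTape_virt : (s.put i T z).cfg.setTape (.virt i) U = (s.put i U z).cfg := by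
  refine Cfg.ext (funext fun j => ?_) rfl
  rcases eq_or_ne j (.virt i) with rfl | hj
  · simp [cfg, put]
  · rw [Cfg.setTape_tape_of_ne _ _ hj]
    cases j with
    | virt k =>
      have hk : k ≠ i := fun h => hj (h ▸ rfl)
      simp [cfg, put, hk]
    | _ => rfl

@[simp]
theorem cfg_setTape_qry (w : List S) :
    s.cfg.setTape .qry (Tape.ofString w) = { s with query := w }.cfg :=
  Cfg.ext (funext fun j => by cases j <;> simp [cfg, Cfg.setTape]) rfl

@[simp]
theorem cfg_setTape_ans (w : List S) :
    s.cfg.setTape .ans (Tape.ofString w) = { s with answer := w }.cfg :=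
  Cfg.ext (funext fun j => by cases j <;> simp [cfg, Cfg.setTape]) rfl

@[simp]
theorem cfg_setTape_out (w : List S) :
    s.cfg.setTape .out (Tape.ofString w) = { s with output := w }.cfg :=
  Cfg.ext (funext fun j => by cases j <;> simp [cfg, Cfg.setTape]) rfl

theorem cfg_moved (d : Move) (n : ℕ) :
    (s.put i T z).cfg.moved (vmove i d) n = (s.put i T (z + n * d.toInt)).cfg := by
  classical
  have follow (j : TapeIdx M.W) : (s.put i T z).head j + n * (if j = i then d else .stay).toInt =
      (s.put i T (z + n * d.toInt)).head j := by
    rcases eq_or_ne j i with rfl | hj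
    · simp [put]
    · simp [put, hj]
  refine Cfg.ext rfl (funext fun j => ?_)
  cases j with
  | virt j => exact follow j
  | inp => exact follow .input
  | ans => exact follow .answer
  | _ => simp [cfg, Cfg.moved, vmove]

end SimState

variable {s : SimState M} {i : TapeIdx M.W} {K : SimCfg M → SimCfg M → ℕ → Prop}

theorem Exec.vshift (d : Move) (T : Tape S (SimSym S M.Q M.A)) (z : ℤ) :
    Exec K (.shift (vmove i d)) (s.put i T z).cfg (s.put i T (z + d.toInt)).cfg 1 := by
  simpa [s.cfg_moved] using Exec.shift (K := K) (vmove i d) (s.put i T z).cfg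

/-- Transform the cells of a virtual tape, starting with the scanned one, as long as `P` holds. -/
noncomputable def Prog.vsweep (i : TapeIdx M.W) (P : Symb S (SimSym S M.Q M.A) → Prop)
    (g : Symb S (SimSym S M.Q M.A) → Symb S (SimSym S M.Q M.A)) (d : Move) : SimProg M :=
  .loop (fun r => P (r (.virt i))) (.put (.virt i) (fun r => g (r (.virt i))) (vmove i d))

theorem Exec.vsweep {P : Symb S (SimSym S M.Q M.A) → Prop}
    {g : Symb S (SimSym S M.Q M.A) → Symb S (SimSym S M.Q M.A)} {d : Move}
    (U : ℕ → Tape S (SimSym S M.Q M.A)) (z : ℤ) (n : ℕ)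
    (hP : ∀ k < n, P (U k (z + k * d.toInt))) (hn : ¬ P (U n (z + n * d.toInt)))
    (hU : ∀ k < n, U (k + 1) =
      Function.update (U k) (z + k * d.toInt) (g (U k (z + k * d.toInt)))) :
    Exec K (.vsweep i P g d) (s.put i (U 0) z).cfg (s.put i (U n) (z + n * d.toInt)).cfg
      (2 * n + 1) := by
  have read_virt (k : ℕ) : ((((s.put i (U 0) z).cfg.setTape (.virt i) (U k)).moved
      (vmove i d) k).read) (.virt i) = U k (z + k * d.toInt) := by
    rw [s.cfg_setTape_virt, s.cfg_moved, s.put_cfg_read_virt]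
  have hsweep := Exec.sweep (K := K) (.virt i) (vmove i d) (b := fun r => P (r (.virt i)))
    (g := fun r => g (r (.virt i))) (s.put i (U 0) z).cfg U n
    (fun k hk => by rw [read_virt]; exact hP k hk) (by rwa [read_virt])
    (fun k hk => by rw [read_virt, hU k hk]; simp [SimState.cfg, SimState.put, vmove])
  rwa [s.cfg_setTape_virt, s.cfg_setTape_virt, s.cfg_moved] at hsweep

theorem Exec.vscan {P : Symb S (SimSym S M.Q M.A) → Prop} {d : Move}
    (T : Tape S (SimSym S M.Q M.A)) (z : ℤ) (n : ℕ)
    (hP : ∀ k < n, P (T (z + k * d.toInt))) (hn : ¬ P (T (z + n * d.toInt))) :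
    Exec K (.vsweep i P id d) (s.put i T z).cfg (s.put i T (z + n * d.toInt)).cfg (2 * n + 1) :=
  Exec.vsweep (fun _ => T) z n hP hn fun k _ => by simp

/-- Go to the leftmost visited cell. -/
noncomputable def Prog.leftEnd (i : TapeIdx M.W) : SimProg M :=
  .vsweep i (· ≠ none) id .left ;; .shift (vmove i .right)

/-- Go to the leftmost cell with property `P`. -/
noncomputable def Prog.seek (i : TapeIdx M.W) (P : Symb S (SimSym S M.Q M.A) → Prop) : SimProg M :=
  .leftEnd i ;; .vsweep i (fun c => ¬ P c) id .right

/-- Apply `g` to all visited cells and go to the origin. -/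
noncomputable def Prog.mapCells (i : TapeIdx M.W)
    (g : Symb S (SimSym S M.Q M.A) → Symb S (SimSym S M.Q M.A)) : SimProg M :=
  .leftEnd i ;; .vsweep i (· ≠ none) g .right ;; .vsweep i (fun c => cellOrg c = false) id .left

variable {T : VTape S M.A} {m : Option ℤ} {N : ℕ} {h : ℤ}

theorem Exec.leftEnd (hT : T.Within N) (hh : T.lo - 1 ≤ h ∧ h ≤ T.hi) :
    Exec K (.leftEnd i) (s.put i (T.tape m) h).cfg (s.put i (T.tape m) T.lo).cfg (4 * N + 4) := by
  obtain ⟨hlo, hhi⟩ := hT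
  have hscan := Exec.vscan (K := K) (s := s) (i := i) (P := (· ≠ none)) (d := .left) (T.tape m) h
    (h - (T.lo - 1)).toNat
    (fun k hk => by rw [Ne, VTape.tape_eq_none_iff, Move.toInt_left]; omega)
    (by rw [Ne, VTape.tape_eq_none_iff, Move.toInt_left]; omega)
  have hshift := Exec.vshift (K := K) (s := s) (i := i) .right (T.tape m) (T.lo - 1)
  rw [Move.toInt_left, show h + ((h - (T.lo - 1)).toNat : ℤ) * -1 = T.lo - 1 by omega] at hscan
  rw [Move.toInt_right, sub_add_cancel] at hshift
  exact (hscan.seq hshift).mono (by omega)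

theorem Exec.seek {P : Symb S (SimSym S M.Q M.A) → Prop} {z : ℤ} (hT : T.Within N)
    (hh : T.lo - 1 ≤ h ∧ h ≤ T.hi) (hz : T.lo ≤ z ∧ z ≤ T.hi)
    (hP : ∀ y, T.lo ≤ y → y ≤ z → (P (T.tape m y) ↔ y = z)) :
    Exec K (.seek i P) (s.put i (T.tape m) h).cfg (s.put i (T.tape m) z).cfg (8 * N + 5) := by
  have hscan := Exec.vscan (K := K) (s := s) (i := i) (P := fun c => ¬ P c) (d := .right)
    (T.tape m) T.lo (z - T.lo).toNat
    (fun k hk => by rw [Move.toInt_right, hP] <;> omega)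
    (by rw [Move.toInt_right, not_not, hP] <;> omega)
  rw [Move.toInt_right, show T.lo + ((z - T.lo).toNat : ℤ) * 1 = z by omega] at hscan
  simp only [VTape.Within] at hT
  exact ((Exec.leftEnd hT hh).seq hscan).mono (by omega)

theorem Exec.seek_org (hT : T.Within N) (hh : T.lo - 1 ≤ h ∧ h ≤ T.hi) :
    Exec K (.seek i fun c => cellOrg c = true) (s.put i (T.tape m) h).cfg
      (s.put i (T.tape m) 0).cfg (8 * N + 5) :=
  Exec.seek hT hh ⟨T.lo_nonpos, T.hi_nonneg⟩ fun y _ _ => by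
    rw [VTape.cellOrg_tape, decide_eq_true_iff]

theorem Exec.seek_hd {z : ℤ} (hT : T.Within N) (hh : T.lo - 1 ≤ h ∧ h ≤ T.hi)
    (hz : T.lo ≤ z ∧ z ≤ T.hi) :
    Exec K (.seek i fun c => cellHd c = true) (s.put i (T.tape (some z)) h).cfg
      (s.put i (T.tape (some z)) z).cfg (8 * N + 5) :=
  Exec.seek hT hh hz fun y hlo hle => by
    rw [VTape.cellHd_tape ⟨hlo, hle.trans hz.2⟩, decide_eq_true_iff, Option.some_inj, eq_comm]

theorem Exec.vmap {g : Symb S (SimSym S M.Q M.A) → Symb S (SimSym S M.Q M.A)}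
    (hg : g none = none) :
    Exec K (.vsweep i (· ≠ none) g .right) (s.put i (T.tape m) T.lo).cfg
      (s.put i (fun z => g (T.tape m z)) (T.hi + 1)).cfg (2 * (T.hi + 1 - T.lo).toNat + 1) := by
  set n := (T.hi + 1 - T.lo).toNat
  have hlo := T.lo_nonpos
  have hhi := T.hi_nonneg
  let U (k : ℕ) : Tape S (SimSym S M.Q M.A) := fun z =>
    if z < T.lo + k then g (T.tape m z) else T.tape m z
  have hU0 : U 0 = T.tape m := funext fun z => ite_eq_right_iff.2 fun hz => by
    rw [VTape.tape_eq_none_iff.2 (by omega), hg]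
  have hUn : U n = fun z => g (T.tape m z) := funext fun z => ite_eq_left_iff.2 fun hz => by
    rw [VTape.tape_eq_none_iff.2 (by omega), hg]
  have hUk (k : ℕ) : U k (T.lo + k) = T.tape m (T.lo + k) := if_neg (lt_irrefl _)
  have hmap := Exec.vsweep (K := K) (s := s) (i := i) (P := (· ≠ none)) (g := g) (d := .right) U
    T.lo n
    (fun k hk => by rw [Move.toInt_right, mul_one, hUk, Ne, VTape.tape_eq_none_iff]; omega)
    (by rw [Move.toInt_right, mul_one, hUk, Ne, VTape.tape_eq_none_iff]; omega)
    (fun k _ => by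
      funext z
      rw [Move.toInt_right, mul_one]
      rcases eq_or_ne z (T.lo + k) with rfl | hz
      · simp [U]
      · have hlt : z < T.lo + (k + 1) ↔ z < T.lo + k := by omega
        simp [U, hz, hlt])
  rwa [hU0, hUn, Move.toInt_right, show T.lo + (n : ℤ) * 1 = T.hi + 1 by omega] at hmap

theorem Exec.mapCells {g : Symb S (SimSym S M.Q M.A) → Symb S (SimSym S M.Q M.A)}
    (hg : g none = none) (hg_org : ∀ c, cellOrg (g c) = cellOrg c) (hT : T.Within N)
    (hh : T.lo - 1 ≤ h ∧ h ≤ T.hi) :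
    Exec K (.mapCells i g) (s.put i (T.tape m) h).cfg
      (s.put i (fun z => g (T.tape m z)) 0).cfg (10 * N + 10) := by
  have hhi := T.hi_nonneg
  have hreturn := Exec.vscan (K := K) (s := s) (i := i) (P := fun c => cellOrg c = false)
    (d := .left) (fun z => g (T.tape m z)) (T.hi + 1) (T.hi + 1).toNat
    (fun k hk => by
      rw [hg_org, VTape.cellOrg_tape, Move.toInt_left, decide_eq_false_iff_not]
      omega)
    (by rw [hg_org, VTape.cellOrg_tape, Move.toInt_left, decide_eq_false_iff_not]; omega)
  rw [Move.toInt_left, show T.hi + 1 + ((T.hi + 1).toNat : ℤ) * -1 = 0 by omega] at hreturn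
  have hbounds := hT
  simp only [VTape.Within] at hbounds
  exact ((Exec.leftEnd hT hh).seq ((Exec.vmap hg).seq hreturn)).mono (by omega)

/-- The cell without the symbol written in it. -/
def clearCell : Symb S (SimSym S M.Q M.A) → Symb S (SimSym S M.Q M.A)
  | some (Sum.inr (.cell _ org hd)) => some (Sum.inr (.cell none org hd))
  | c => c

/-- Erase the symbols on a virtual tape and go to the origin. -/
noncomputable def Prog.clear (i : TapeIdx M.W) : SimProg M := .mapCells i clearCell

theorem Exec.clear (hT : T.Within N) (hh : T.lo - 1 ≤ h ∧ h ≤ T.hi) :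
    Exec K (.clear i) (s.put i (T.tape m) h).cfg (s.put i (T.erase.tape m) 0).cfg
      (10 * N + 10) := by
  have hmap := Exec.mapCells (K := K) (s := s) (i := i) (m := m) (g := clearCell) rfl
    (fun c => by rcases c with _ | _ | _ | _ <;> rfl) hT hh
  suffices T.erase.tape m = fun z => clearCell (T.tape m z) by rwa [this]
  funext z
  by_cases hz : T.lo ≤ z ∧ z ≤ T.hi
  · rw [VTape.tape_of_mem hz, VTape.tape_of_mem (T := T.erase) hz]
    rfl
  · rw [VTape.tape_eq_none_iff.2 hz, VTape.tape_eq_none_iff (T := T.erase) |>.2 hz]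
    rfl

/-- Make a virtual tape blank and go to the origin. -/
noncomputable def Prog.clean (i : TapeIdx M.W) : SimProg M :=
  .mapCells i (fun c => if cellOrg c then c else none) ;;
    .put (.virt i) (fun _ => none) (vmove i .stay)

theorem Exec.clean (hT : T.Within N) (hh : T.lo - 1 ≤ h ∧ h ≤ T.hi) :
    Exec K (.clean i) (s.put i (T.tape m) h).cfg (s.put i Tape.blank 0).cfg (10 * N + 12) := by
  have hmap := Exec.mapCells (K := K) (s := s) (i := i) (m := m)
    (g := fun c => if cellOrg c then c else none) (by simp)
    (fun c => by split_ifs with hc <;> simp_all [cellOrg]) hT hh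
  set U : Tape S (SimSym S M.Q M.A) := fun z => if cellOrg (T.tape m z) then T.tape m z else none
    with hU
  have hblank : Function.update U 0 none = Tape.blank := by
    funext z
    rcases eq_or_ne z 0 with rfl | hz
    · simp
    · simp [hU, VTape.cellOrg_tape, hz]
  have hput := Exec.put (K := K) (.virt i) (fun _ => none) (vmove i .stay) (s.put i U 0).cfg
  have htape : (s.put i U 0).cfg.tape (.virt i) = U := by simp [SimState.cfg, SimState.put]
  have hhead : (s.put i U 0).cfg.head (.virt i) = 0 := by simp [SimState.cfg, SimState.put]
  rw [htape, hhead, hblank, s.cfg_setTape_virt, s.cfg_moved] at hput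
  exact (hmap.seq hput).mono (by omega)

end Simulation

/-! ### Correctness of the simulation -/

section Simulation

variable {S : Type} {M : OracleMachine S} {s : SimState M} {i : TapeIdx M.W}
  {K : SimCfg M → SimCfg M → ℕ → Prop}

/-- The string on a virtual tape with a blank tape beneath it. -/
noncomputable def VTape.content {A : Type} (T : VTape S A) : List S :=
  Tape.content fun z => (T.val z).getD none

theorem VTape.holds_content {A : Type} (T : VTape S A) :
    Tape.Holds (fun z => (T.val z).getD none) T.content :=
  Tape.holds_content ⟨(T.hi + 1).toNat, by
    have := T.hi_nonneg
    rw [T.val_eq_none _ (by omega), Option.getD_none, Symb.letter_none]⟩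

theorem VTape.length_content_le {A : Type} (T : VTape S A) : (T.content.length : ℤ) ≤ T.hi + 1 := by
  by_contra! hlt
  have hhi := T.hi_nonneg
  have hletter : (T.val (T.hi + 1).toNat).getD none = _ :=
    T.holds_content.1 (T.hi + 1).toNat (by omega)
  rw [T.val_eq_none _ (by omega)] at hletter
  cases hletter

/-- The letter written in a cell. -/
def cellLetter {Q A : Type} (c : Symb S (SimSym S Q A)) : Option S := ((cellVal c).getD none).letter

theorem cellLetter_tape {T : VTape S M.A} {m : Option ℤ} {k : ℕ} (hk : k ≤ T.content.length) :
    cellLetter (T.tape m k : Symb S (SimSym S M.Q M.A)) = T.content[k]? := by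
  rw [cellLetter, VTape.cellVal_tape]
  rcases hk.lt_or_eq with hk | rfl
  · rw [List.getElem?_eq_getElem hk]
    exact congrArg Symb.letter (T.holds_content.1 k hk)
  · rw [List.getElem?_eq_none le_rfl]
    exact T.holds_content.2

/-- Copy the string on a virtual tape to one of the tapes for strings, starting in the origin. -/
noncomputable def Prog.grab (i : TapeIdx M.W) (j : SimTape M.W) : SimProg M :=
  .copy (fun r => cellLetter (r (.virt i))) j (vmove i .right) ;; .rewind j ;;
    .shift (vmove i .left)

theorem Exec.grab {T : VTape S M.A} {m : Option ℤ} {j : SimTape M.W} (hj : j = .qry ∨ j = .out)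
    (hblank : s.cfg.tape j = Tape.blank) :
    Exec K (.grab i j) (s.put i (T.tape m) 0).cfg
      ((s.put i (T.tape m) (T.content.length - 1)).cfg.setTape j (Tape.ofString T.content))
      (4 * T.content.length + 5) := by
  set w := T.content
  have hvirt : j ≠ .virt i := by rcases hj with rfl | rfl <;> simp
  have hhead (z : ℤ) : (s.put i (T.tape m) z).cfg.head j = 0 := by
    rcases hj with rfl | rfl <;> rfl
  have htape (z : ℤ) : (s.put i (T.tape m) z).cfg.tape j = Tape.ofString [] := by
    rw [Tape.ofString_nil, ← hblank]
    rcases hj with rfl | rfl <;> rfl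
  have hcopy := Exec.copy (K := K) (fun r => cellLetter (r (.virt i))) j (vmove i .right)
    (s.put i (T.tape m) 0).cfg [] w (fun k hk r hr => by
      rw [hr _ hvirt.symm, s.cfg_moved, s.put_cfg_read_virt, ← cellLetter_tape (m := m) hk]
      simp)
  have hrewind := Exec.rewind (K := K) j
    ((s.put i (T.tape m) w.length).cfg.setTape j (Tape.ofString w)) w
    (Cfg.setTape_tape_self ..) le_rfl
  have hleft := Exec.shift (K := K) (vmove i .left)
    ((s.put i (T.tape m) w.length).cfg.setTape j (Tape.ofString w))
  rw [Cfg.setTape_eq (htape _), List.length_nil, Nat.cast_zero, Cfg.setHead_eq (hhead _),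
    s.cfg_moved, List.nil_append, Move.toInt_right, zero_add, mul_one, zero_add] at hcopy
  rw [Cfg.setHead_eq (C := (s.put i _ _).cfg.setTape j _) (hhead _)] at hrewind
  rw [← Cfg.setTape_moved, s.cfg_moved, Nat.cast_one, one_mul, Move.toInt_left,
    ← sub_eq_add_neg] at hleft
  exact (hcopy.seq (hrewind.seq hleft)).mono (by omega)

/-- Transform the scanned cells of all virtual tapes and the state symbol. -/
noncomputable def Prog.touch (f g : Symb S (SimSym S M.Q M.A) → Symb S (SimSym S M.Q M.A)) :
    SimProg M :=
  .act (fun r j => match j with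
    | .virt i => f (r (.virt i))
    | .st => g (r .st)
    | j => r j) fun _ _ => .stay

theorem Exec.touch (f g : Symb S (SimSym S M.Q M.A) → Symb S (SimSym S M.Q M.A)) :
    Exec K (.touch f g) s.cfg
      { s with
        state := g s.state
        tape := fun i => Function.update (s.tape i) (s.head i) (f (s.tape i (s.head i))) }.cfg
      1 := by
  refine .act_of_eq (Cfg.ext (funext fun j => ?_) (funext fun j => ?_)) <;>
    cases j <;> simp [SimState.cfg, Cfg.act, Cfg.read]

/-- Set or remove the head mark in a cell. -/
def setMark {Q A : Type} (b : Bool) (c : Symb S (SimSym S Q A)) : Symb S (SimSym S Q A) :=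
  some (Sum.inr (.cell (cellVal c) (cellOrg c) b))

theorem setMark_tape {T : VTape S M.A} {m : Option ℤ} {b : Bool} {z : ℤ} :
    setMark b (T.tape m z : Symb S (SimSym S M.Q M.A)) =
      some (Sum.inr (.cell (T.val z) (decide (z = 0)) b)) := by
  rw [setMark, VTape.cellVal_tape, VTape.cellOrg_tape]

/-- The state of a simulation with the state symbol `σ`, the virtual tapes `T` with head marks in
the cells `m`, and no query and no output. -/
def SimState.ofVTapes (σ : Symb S (SimSym S M.Q M.A)) (T : TapeIdx M.W → VTape S M.A)
    (m : TapeIdx M.W → Option ℤ) (H : TapeIdx M.W → ℤ) (x y : List S) : SimState M where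
  state := σ
  tape i := (T i).tape (m i)
  head := H
  input := x
  query := []
  answer := y
  output := []

variable {σ : Symb S (SimSym S M.Q M.A)} {T : TapeIdx M.W → VTape S M.A} {H : TapeIdx M.W → ℤ}
  {x y : List S} {N : ℕ}

theorem Exec.touch_ofVTapes {f g : Symb S (SimSym S M.Q M.A) → Symb S (SimSym S M.Q M.A)}
    {T' : TapeIdx M.W → VTape S M.A} {m m' : TapeIdx M.W → Option ℤ}
    (hT' : ∀ i, (T' i).tape (m' i) =
      Function.update ((T i).tape (m i)) (H i) (f ((T i).tape (m i) (H i)))) :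
    Exec K (.touch f g) (SimState.ofVTapes σ T m H x y).cfg
      (SimState.ofVTapes (g σ) T' m' H x y).cfg 1 := by
  simp only [SimState.ofVTapes, hT']
  exact Exec.touch f g

theorem Exec.mark (hH : ∀ i, (T i).Near (H i)) :
    Exec K (.touch (setMark true) id) (SimState.ofVTapes σ T (fun _ => none) H x y).cfg
      (SimState.ofVTapes σ (fun i => (T i).visit (H i)) (fun i => some (H i)) H x y).cfg 1 := by
  refine Exec.touch_ofVTapes (g := id) fun i => ?_
  rw [VTape.visit, VTape.tape_write (m := none) (hH i) _ (by simp [eq_comm]), setMark_tape]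
  simp

theorem Exec.unmark (τ : Symb S (SimSym S M.Q M.A)) (hH : ∀ i, (T i).lo ≤ H i ∧ H i ≤ (T i).hi) :
    Exec K (.touch (setMark false) fun _ => τ)
      (SimState.ofVTapes σ T (fun i => some (H i)) H x y).cfg
      (SimState.ofVTapes τ T (fun _ => none) H x y).cfg 1 := by
  refine Exec.touch_ofVTapes (g := fun _ => τ) fun i => ?_
  have hwrite := VTape.tape_write (Q := M.Q) (m := some (H i)) (m' := none)
    (VTape.near_of_mem (hH i)) ((T i).val (H i)) (by simp [eq_comm])
  rw [← VTape.visit, VTape.visit_of_mem _ (hH i)] at hwrite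
  rw [hwrite, setMark_tape]
  simp

/-- Mark the positions of all heads and copy the string on a virtual tape. -/
noncomputable def Prog.extract (i : TapeIdx M.W) (j : SimTape M.W) : SimProg M :=
  .touch (setMark true) id ;; .seek i (fun c => cellOrg c = true) ;; .grab i j

theorem VTape.content_visit {A : Type} (T : VTape S A) (z : ℤ) :
    (T.visit z).content = T.content := by
  rw [VTape.content, VTape.visit_val, VTape.content]

theorem Exec.extract (hH : ∀ i, (T i).Near (H i)) (hT : ∀ i, (T i).Within N) {j : SimTape M.W}
    (hj : j = .qry ∨ j = .out) :
    Exec K (.extract i j) (SimState.ofVTapes σ T (fun _ => none) H x y).cfg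
      (((SimState.ofVTapes σ (fun i => (T i).visit (H i)) (fun i => some (H i)) H x y).put i
        (((T i).visit (H i)).tape (some (H i))) ((T i).content.length - 1)).cfg.setTape j
          (Tape.ofString (T i).content))
      (12 * N + 23) := by
  set s₁ := SimState.ofVTapes σ (fun i => (T i).visit (H i)) (fun i => some (H i)) H x y
  have hmem := (T i).mem_visit (H i)
  have hwithin := (hT i).visit (hH i)
  have hseek := Exec.seek_org (K := K) (s := s₁) (i := i) (m := some (H i)) (h := H i) hwithin
    ⟨by omega, hmem.2⟩
  have hgrab := Exec.grab (K := K) (s := s₁) (i := i) (T := (T i).visit (H i)) (m := some (H i)) hj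
    (by rcases hj with rfl | rfl <;> exact Tape.ofString_nil)
  have hlen := (T i).length_content_le
  have hhi := (hT i).2
  rw [VTape.content_visit] at hgrab
  rw [show s₁.put i (((T i).visit (H i)).tape (some (H i))) (H i) = s₁ from s₁.put_self i] at hseek
  exact ((Exec.mark hH).seq (hseek.seq hgrab)).mono (by omega)

/-- The symbol in a cell that only holds letters. -/
def letterSymb {A A' : Type} (c : Symb S A) : Symb S A' := c.letter.map Sum.inl

theorem letterSymb_ofString {A A' : Type} (w : List S) (z : ℤ) :
    letterSymb (Tape.ofString w z : Symb S A) = (Tape.ofString w z : Symb S A') := by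
  rw [letterSymb, Tape.ofString, Tape.ofString]
  split_ifs
  · cases w[z.toNat]? <;> rfl
  · rfl

/-- The state in a state symbol. -/
def stState : Symb S (SimSym S M.Q M.A) → M.Q
  | some (Sum.inr (.st q _)) => q
  | _ => M.start

/-- The information in a state symbol whether the oracle has been consulted. -/
def stAsked : Symb S (SimSym S M.Q M.A) → Bool
  | some (Sum.inr (.st _ b)) => b
  | _ => false

/-- The symbols in the cells that the simulated machine has not written. -/
def vreadBase (r : SimTape M.W → Symb S (SimSym S M.Q M.A)) (i : TapeIdx M.W) : Symb S M.A :=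
  match i with
  | .input => letterSymb (r .inp)
  | .answer => if stAsked (r .st) then letterSymb (r .ans) else none
  | _ => none

/-- The symbols scanned by the simulated machine. -/
def vread (r : SimTape M.W → Symb S (SimSym S M.Q M.A)) (i : TapeIdx M.W) : Symb S M.A :=
  (cellVal (r (.virt i))).getD (vreadBase r i)

/-- The content of the tapes of a machine as far as it has not been written by the machine. -/
def vbase (x y : List S) (asked : Bool) : TapeIdx M.W → Tape S M.A
  | .input => Tape.ofString x
  | .answer => if asked then Tape.ofString y else Tape.blank
  | _ => Tape.blank

/-- The virtual tapes `T`, above the input `x` and, if the oracle has been consulted, its answer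
`y`, show the configuration `c`, and no cell beyond the distance `N` has been visited. -/
structure Represents (x y : List S) (asked : Bool) (T : TapeIdx M.W → VTape S M.A) (c : M.Config)
    (N : ℕ) : Prop where
  tape_eq : ∀ i z, c.tape i z = ((T i).val z).getD (vbase x y asked i z)
  near : ∀ i, (T i).Near (c.head i)
  within : ∀ i, (T i).Within N

/-- The configuration `C` of the simulation represents the configuration `c`. -/
def SimRep (P : List S → Prop) (x : List S) (c : M.Config) (N : ℕ) (C : SimCfg M) : Prop :=
  ∃ T asked y, P y ∧ Represents x y asked T c N ∧
    C = (SimState.ofVTapes (some (Sum.inr (.st c.state asked))) T (fun _ => none) c.head x y).cfg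

variable {ψ : Baire S} {P : List S → Prop} {B n : ℕ} {asked : Bool} {c : M.Config} {C : SimCfg M}

theorem SimRep.stState_read (h : SimRep P x c N C) : stState (C.read .st) = c.state := by
  obtain ⟨T, asked, y, -, -, rfl⟩ := h
  simp [Cfg.read, SimState.cfg, SimState.ofVTapes, stState]

theorem Represents.vread_eq (h : Represents x y asked T c N) :
    vread (SimState.ofVTapes (some (Sum.inr (.st c.state asked))) T (fun _ => none) c.head
      x y).cfg.read = fun i => c.tape i (c.head i) := by
  funext i
  rw [vread, h.tape_eq]
  congr 1
  · exact VTape.cellVal_tape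
  · cases i with
    | input => exact letterSymb_ofString ..
    | answer =>
      cases asked
      · simp [vreadBase, vbase, Cfg.read, SimState.cfg, SimState.ofVTapes, stAsked]
      · simpa [vreadBase, vbase, Cfg.read, SimState.cfg, SimState.ofVTapes, stAsked]
          using letterSymb_ofString ..
    | _ => rfl

/-- Simulation of an ordinary step. -/
noncomputable def Prog.vstep : SimProg M :=
  .act
    (fun r j => match j with
      | .virt i => some (Sum.inr (.cell (some (M.write (stState (r .st)) (vread r) i))
          (cellOrg (r (.virt i))) false))
      | .st => some (Sum.inr (.st (M.next (stState (r .st)) (vread r)) (stAsked (r .st))))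
      | j => r j)
    (fun r j => match j with
      | .virt i => M.move (stState (r .st)) (vread r) i
      | .inp => M.move (stState (r .st)) (vread r) .input
      | .ans => M.move (stState (r .st)) (vread r) .answer
      | _ => .stay)

theorem Represents.step (h : Represents x y asked T c N) (hhalt : c.state ≠ M.halt)
    (horacle : c.state ≠ M.oracle) :
    Represents x y asked
      (fun i => (T i).write (c.head i) (some (M.write c.state (fun j => c.tape j (c.head j)) i)))
      (M.step ψ c) (N + 1) := by
  rw [M.step_of_ne hhalt horacle]
  refine ⟨fun i z => ?_, fun i => ?_, fun i => (h.within i).write (h.near i) _⟩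
  · rcases eq_or_ne z (c.head i) with rfl | hz
    · simp [VTape.write]
    · simpa [VTape.write, hz] using h.tape_eq i z
  · simp only [VTape.Near, VTape.write]
    cases M.move c.state (fun j => c.tape j (c.head j)) i <;> simp <;> omega

theorem Exec.vstep (h : SimRep P x c N C) (hhalt : c.state ≠ M.halt)
    (horacle : c.state ≠ M.oracle) :
    ∃ C', SimRep P x (M.step ψ c) (N + 1) C' ∧ Exec K .vstep C C' 1 := by
  obtain ⟨T, asked, y, hy, hT, rfl⟩ := h
  refine ⟨_, ⟨_, asked, y, hy, hT.step hhalt horacle, rfl⟩, .act_of_eq ?_⟩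
  set s := SimState.ofVTapes (some (Sum.inr (.st c.state asked))) T (fun _ => none) c.head x y
    with hs
  have hst : s.cfg.read .st = some (Sum.inr (.st c.state asked)) := by
    simp [hs, Cfg.read, SimState.cfg, SimState.ofVTapes]
  have hvirt (i : TapeIdx M.W) : s.cfg.read (.virt i) = (T i).tape none (c.head i) := rfl
  have hread : vread s.cfg.read = fun i => c.tape i (c.head i) := hT.vread_eq
  rw [M.step_of_ne hhalt horacle]
  refine Cfg.ext (funext fun j => ?_) (funext fun j => ?_)
  · cases j with
    | virt i =>
      have hwrite := VTape.tape_write (Q := M.Q) (m := none) (m' := none) (hT.near i)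
        (some (M.write c.state (fun j => c.tape j (c.head j)) i)) (by simp)
      simp only [Cfg.act, hst, hread, hvirt, stState, VTape.cellOrg_tape]
      rw [decide_eq_false (Option.some_ne_none _).symm] at hwrite
      exact hwrite.symm
    | st =>
      simp only [Cfg.act, hst, hread, stState, stAsked]
      simp [hs, SimState.cfg, SimState.ofVTapes]
    | _ => simp [hs, Cfg.act, SimState.cfg, SimState.ofVTapes, Cfg.read]
  · cases j <;> simp only [Cfg.act, hst, hread, stState] <;>
      simp [hs, SimState.cfg, SimState.ofVTapes]

/-- The ask relation in a simulation: the oracle is `ψ`, queries have length at most `B`, the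
strings on the answer tape satisfy `P`, and a consultation, which erases the query, takes at most
`n` steps. -/
def AskErase (ψ : Baire S) (B : ℕ) (P : List S → Prop) (n : ℕ) :
    SimCfg M → SimCfg M → ℕ → Prop := fun C C' t =>
  ∃ w y, w.length ≤ B ∧ P y ∧ C.tape .qry = Tape.ofString w ∧ C.head .qry = 0 ∧
    C.tape .ans = Tape.ofString y ∧ C.head .ans = 0 ∧
    C' = (C.setTape .qry Tape.blank).setTape .ans (Tape.ofString (ψ w)) ∧ t = n

/-- Copy the query to the oracle. -/
noncomputable def Prog.extractQuery (M : OracleMachine S) : SimProg M :=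
  .extract .query .qry ;; .seek .query (fun c => cellHd c = true)

/-- Consult the oracle and forget what the simulated machine has written over its last answer. -/
noncomputable def Prog.consult (M : OracleMachine S) : SimProg M :=
  .clear .answer ;; .ask ;; .seek .answer (fun c => cellHd c = true)

/-- Simulation of a consultation of the oracle. -/
noncomputable def Prog.vask (M : OracleMachine S) : SimProg M :=
  .extractQuery M ;; .consult M ;;
    .touch (setMark false) fun _ => some (Sum.inr (.st M.resume true))

theorem Exec.extract_query (hH : ∀ i, (T i).Near (H i)) (hT : ∀ i, (T i).Within N) :
    Exec K (.extractQuery M)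
      (SimState.ofVTapes σ T (fun _ => none) H x y).cfg
      { SimState.ofVTapes σ (fun i => (T i).visit (H i)) (fun i => some (H i)) H x y with
        query := (T .query).content }.cfg
      (20 * N + 36) := by
  have hmem := (T .query).mem_visit (H .query)
  have hwithin := (hT .query).visit (hH .query)
  have hlen := (T .query).length_content_le
  have hle : (T .query).hi ≤ ((T .query).visit (H .query)).hi := le_max_left ..
  have hlo := ((T .query).visit (H .query)).lo_nonpos
  have hextract := Exec.extract (K := K) (i := .query) (σ := σ) (x := x) (y := y) hH hT (.inl rfl)
  rw [SimState.cfg_setTape_qry] at hextract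
  have hseek := Exec.seek_hd (K := K) (i := .query) (h := (T .query).content.length - 1)
    (s := { SimState.ofVTapes σ (fun i => (T i).visit (H i)) (fun i => some (H i)) H x y with
      query := (T .query).content }) hwithin ⟨by omega, by omega⟩ hmem
  rw [show SimState.put _ .query _ (H .query) = _ from SimState.put_self _ _] at hseek
  exact (hextract.seq hseek).mono (by omega)

open Classical in
theorem SimState.ofVTapes_put (m : TapeIdx M.W → Option ℤ) (i : TapeIdx M.W) (U : VTape S M.A) :
    (SimState.ofVTapes σ T m H x y).put i (U.tape (m i)) (H i) =
      SimState.ofVTapes σ (Function.update T i U) m H x y := by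
  have htape : Function.update (fun j => ((T j).tape (m j) : Tape S (SimSym S M.Q M.A))) i
      (U.tape (m i)) = fun j => (Function.update T i U j).tape (m j) := by
    funext j
    rcases eq_or_ne j i with rfl | hj
    · simp
    · simp [hj]
  simp [SimState.ofVTapes, SimState.put, htape]

open Classical in
theorem Exec.consult {w : List S} (hw : w.length ≤ B) (hy : P y)
    (hH : ∀ i, (T i).lo ≤ H i ∧ H i ≤ (T i).hi) (hT : ∀ i, (T i).Within N) :
    Exec (AskErase ψ B P n) (.consult M)
      { SimState.ofVTapes σ T (fun i => some (H i)) H x y with query := w }.cfg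
      (SimState.ofVTapes σ (Function.update T .answer (T .answer).erase) (fun i => some (H i)) H x
        (ψ w)).cfg
      (18 * N + 15 + n) := by
  set s : SimState M := { SimState.ofVTapes σ T (fun i => some (H i)) H x y with query := w }
  set U := (T .answer).erase
  have hmem := hH .answer
  have hclear := Exec.clear (K := AskErase ψ B P n) (s := s) (i := .answer)
    (m := some (H .answer)) (hT .answer) ⟨by omega, hmem.2⟩
  have hask : Exec (AskErase ψ B P n) .ask (s.put .answer (U.tape (some (H .answer))) 0).cfg
      ((SimState.ofVTapes σ T (fun i => some (H i)) H x (ψ w)).put .answer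
        (U.tape (some (H .answer))) 0).cfg n := by
    refine .ask ⟨w, y, hw, hy, rfl, rfl, rfl, by simp [SimState.cfg, SimState.put], ?_, rfl⟩
    rw [← Tape.ofString_nil, SimState.cfg_setTape_qry, SimState.cfg_setTape_ans]
    rfl
  have hseek := Exec.seek_hd (K := AskErase ψ B P n) (i := .answer) (T := U) (h := 0)
    (s := SimState.ofVTapes σ T (fun i => some (H i)) H x (ψ w)) (hT .answer)
    ⟨by linarith [U.lo_nonpos], U.hi_nonneg⟩ hmem
  rw [show s.put .answer ((T .answer).tape (some (H .answer))) (H .answer) = s from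
    s.put_self .answer] at hclear
  rw [SimState.ofVTapes_put (fun i => some (H i))] at hseek
  exact (hclear.seq (hask.seq hseek)).mono (by omega)

theorem Represents.query_eq (h : Represents x y asked T c N) :
    (c.tape .query).content = (T .query).content :=
  congrArg Tape.content (funext (h.tape_eq .query))

open Classical in
theorem Represents.ask (h : Represents x y asked T c N) (hhalt : c.state ≠ M.halt)
    (horacle : c.state = M.oracle) :
    Represents x (ψ (T .query).content) true
      (Function.update (fun i => (T i).visit (c.head i)) .answer
        ((T .answer).visit (c.head .answer)).erase)
      (M.step ψ c) (N + 1) := by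
  rw [M.step_of_oracle hhalt horacle, h.query_eq]
  refine ⟨fun i z => ?_, fun i => ?_, fun i => ?_⟩
  · rcases eq_or_ne i .answer with rfl | hi
    · simp [VTape.erase, vbase]
    · rw [Function.update_of_ne hi, VTape.visit_val,
        show vbase x (ψ (T .query).content) true i = vbase x y asked i by cases i <;> trivial,
        ← h.tape_eq]
      cases i <;> trivial
  · rcases eq_or_ne i .answer with rfl | hi
    · rw [Function.update_self]
      exact VTape.near_of_mem ((T .answer).mem_visit _)
    · simpa [hi] using VTape.near_of_mem (VTape.mem_visit ..)
  · rcases eq_or_ne i .answer with rfl | hi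
    · rw [Function.update_self]
      exact (h.within .answer).visit (h.near .answer)
    · simpa [hi] using (h.within i).visit (h.near i)

theorem Exec.vask (hP : ∀ w, w.length ≤ B → P (ψ w)) (h : SimRep P x c N C) (hB : N + 2 ≤ B)
    (hhalt : c.state ≠ M.halt) (horacle : c.state = M.oracle) :
    ∃ C', SimRep P x (M.step ψ c) (N + 1) C' ∧
      Exec (AskErase ψ B P n) (.vask M) C C' (60 * (N + 2) + n) := by
  classical
  obtain ⟨T, asked, y, hy, hT, rfl⟩ := h
  have hlen := (T .query).length_content_le
  have hhi := (hT.within .query).2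
  have hrep := hT.ask (ψ := ψ) hhalt horacle
  have hextract := Exec.extract_query (K := AskErase ψ B P n) (x := x) (y := y)
    (σ := some (Sum.inr (.st c.state asked))) hT.near hT.within
  have hconsult := Exec.consult (ψ := ψ) (P := P) (B := B) (n := n) (x := x)
    (σ := some (Sum.inr (.st c.state asked))) (w := (T .query).content) (by omega) hy
    (fun i => (T i).mem_visit (c.head i)) fun i => (hT.within i).visit (hT.near i)
  have hunmark := Exec.unmark (K := AskErase ψ B P n) (x := x) (y := ψ (T .query).content)
    (T := Function.update (fun i => (T i).visit (c.head i)) .answer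
      ((T .answer).visit (c.head .answer)).erase)
    (σ := some (Sum.inr (.st c.state asked))) (some (Sum.inr (.st M.resume true))) (H := c.head)
    fun i => by
      rcases eq_or_ne i .answer with rfl | hi
      · rw [Function.update_self]
        exact (T .answer).mem_visit (c.head .answer)
      · simpa [hi] using (T i).mem_visit (c.head i)
  refine ⟨_, ⟨_, true, _, hP (T .query).content (by omega), hrep, rfl⟩, ?_⟩
  rw [M.step_of_oracle hhalt horacle]
  exact (hextract.seq (hconsult.seq hunmark)).mono (by omega)

/-- Make a list of virtual tapes blank. -/
noncomputable def Prog.cleanAll : List (TapeIdx M.W) → SimProg M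
  | [] => .shift fun _ => .stay
  | i :: l => .clean i ;; .cleanAll l

open Classical in
theorem Exec.cleanAll (l : List (TapeIdx M.W)) (hl : l.Nodup) {s : SimState M}
    (hs : ∀ i ∈ l, ∃ (T : VTape S M.A) (m : Option ℤ), s.tape i = T.tape m ∧ T.Within N ∧
      T.lo - 1 ≤ s.head i ∧ s.head i ≤ T.hi) :
    Exec K (.cleanAll l) s.cfg
      { s with
        tape := fun i => if i ∈ l then Tape.blank else s.tape i
        head := fun i => if i ∈ l then 0 else s.head i }.cfg
      (l.length * (10 * N + 12) + 1) := by
  induction l generalizing s with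
  | nil =>
    have hstay : s.cfg.moved (fun _ => .stay) 1 = s.cfg := Cfg.ext rfl (by simp [Cfg.moved])
    have hshift := Exec.shift (K := K) (fun _ => .stay) s.cfg
    rw [hstay] at hshift
    simpa [Prog.cleanAll] using hshift
  | cons i l ih =>
    obtain ⟨hi, hl⟩ := List.nodup_cons.1 hl
    obtain ⟨T, m, hTm, hT, hh⟩ := hs i List.mem_cons_self
    have hclean := Exec.clean (K := K) (s := s) (i := i) (m := m) hT hh
    rw [← hTm, s.put_self] at hclean
    have hrest := ih hl (s := s.put i Tape.blank 0) fun j hj => by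
      have hji : j ≠ i := fun h => hi (h ▸ hj)
      simpa [SimState.put, hji] using hs j (List.mem_cons_of_mem _ hj)
    have htape : (fun j => if j ∈ i :: l then Tape.blank else s.tape j) =
        fun j => if j ∈ l then Tape.blank else Function.update s.tape i Tape.blank j := by
      funext j
      rcases eq_or_ne j i with rfl | hj
      · simp
      · simp [hj]
    have hhead : (fun j => if j ∈ i :: l then 0 else s.head j) =
        fun j => if j ∈ l then 0 else Function.update s.head i 0 j := by
      funext j
      rcases eq_or_ne j i with rfl | hj
      · simp
      · simp [hj]
    rw [htape, hhead]
    exact (hclean.seq hrest).mono (by rw [List.length_cons, add_one_mul l.length]; omega)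

theorem TapeIdx.finite {W : Type} [Finite W] : Finite (TapeIdx W) :=
  Finite.of_injective
    (fun i : TapeIdx W => match i with
      | .input => some (some (some (some none)))
      | .output => some (some (some none))
      | .query => some (some none)
      | .answer => some none
      | .work w => some (some (some (some (some w)))))
    (by rintro (_ | _ | _ | _ | _) (_ | _ | _ | _ | _) <;> simp)

/-- The tapes of a machine. -/
noncomputable def OracleMachine.tapes (M : OracleMachine S) : List (TapeIdx M.W) :=
  have := M.finW
  have := TapeIdx.finite (W := M.W)
  (Set.toFinite (Set.univ : Set (TapeIdx M.W))).toFinset.toList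

theorem OracleMachine.mem_tapes (i : TapeIdx M.W) : i ∈ M.tapes := by
  simp [OracleMachine.tapes]

theorem OracleMachine.nodup_tapes : M.tapes.Nodup :=
  Finset.nodup_toList _

variable (M) in
/-- The state before and after a simulation, in which all auxiliary tapes are blank. -/
def SimState.idle (x y o : List S) : SimState M where
  state := none
  tape _ := Tape.blank
  head _ := 0
  input := x
  query := []
  answer := y
  output := o

/-- Simulation of the computation up to its halting. -/
noncomputable def Prog.vrun (M : OracleMachine S) : SimProg M :=
  .loop (fun r => stState (r .st) ≠ M.halt)
    (.ite (fun r => stState (r .st) = M.oracle) (.vask M) .vstep)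

/-- Simulation of a machine: the input is on the tape `inp`, the output is written on the tape
`out`, and all virtual tapes are blank in the end. -/
noncomputable def Prog.simulate (M : OracleMachine S) : SimProg M :=
  .touch (fun _ => some (Sum.inr (.cell none true false)))
      (fun _ => some (Sum.inr (.st M.start false))) ;;
    .vrun M ;; .extract .output .out ;; .cleanAll M.tapes ;; .touch id fun _ => none

theorem Exec.vrun (hP : ∀ w, w.length ≤ B → P (ψ w)) {t : ℕ} (hB : t + 2 ≤ B)
    (htime : M.time ψ x = t) (j k : ℕ) (hjk : j + k = t) (hC : SimRep P x (M.run ψ x k) k C) :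
    ∃ C', SimRep P x (M.run ψ x t) t C' ∧
      Exec (AskErase ψ B P n) (.vrun M) C C' (j * (60 * (t + 2) + n + 2) + 1) := by
  induction j generalizing k C with
  | zero =>
    obtain rfl : k = t := by omega
    have hhalt := M.time_le_iff.1 htime.le
    exact ⟨C, hC, (Exec.loop_neg (by simp [hC.stState_read, hhalt])).mono (by omega)⟩
  | succ j ih =>
    have hk : (M.run ψ x k).state ≠ M.halt := by
      rw [Ne, ← M.time_le_iff, htime, Nat.cast_le]
      omega
    obtain ⟨C₁, hC₁, hstep⟩ : ∃ C₁, SimRep P x (M.run ψ x (k + 1)) (k + 1) C₁ ∧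
        Exec (AskErase ψ B P n) (.ite (fun r => stState (r .st) = M.oracle) (.vask M) .vstep) C C₁
          (60 * (t + 2) + n + 1) := by
      rw [M.run_succ]
      by_cases horacle : (M.run ψ x k).state = M.oracle
      · obtain ⟨C₁, hC₁, hask⟩ := Exec.vask (n := n) hP hC (by omega) hk horacle
        exact ⟨C₁, hC₁, (Exec.ite_pos (by rw [hC.stState_read, horacle]) hask).mono (by omega)⟩
      · obtain ⟨C₁, hC₁, hstep⟩ := Exec.vstep (K := AskErase ψ B P n) (ψ := ψ) hC hk horacle
        exact ⟨C₁, hC₁, (Exec.ite_neg (by rwa [hC.stState_read]) hstep).mono (by omega)⟩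
    obtain ⟨C₂, hC₂, hrest⟩ := ih (k + 1) (by omega) hC₁
    exact ⟨C₂, hC₂, (Exec.loop_pos (by rwa [hC.stState_read]) hstep hrest).mono
      (by rw [add_one_mul j]; omega)⟩

theorem Represents.init (x y : List S) :
    Represents x y false (fun _ => VTape.empty) (M.init x) 0 where
  tape_eq i z := by cases i <;> rfl
  near _ := by simp [VTape.Near, VTape.empty, OracleMachine.init]
  within _ := by simp [VTape.Within, VTape.empty]

theorem Exec.start (x y : List S) :
    Exec K (.touch (fun _ => some (Sum.inr (.cell none true false)))
      (fun _ => some (Sum.inr (.st M.start false)))) (SimState.idle M x y []).cfg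
      (SimState.ofVTapes (some (Sum.inr (.st M.start false))) (fun _ => VTape.empty)
        (fun _ => none) (fun _ => 0) x y).cfg 1 := by
  have hempty : (VTape.empty.tape none : Tape S (SimSym S M.Q M.A)) =
      Function.update Tape.blank 0 (some (Sum.inr (.cell none true false))) := by
    funext z
    rcases eq_or_ne z 0 with rfl | hz
    · simp [VTape.tape, VTape.empty]
    · rw [Function.update_of_ne hz]
      exact VTape.tape_eq_none_iff.2 fun h => hz (le_antisymm h.2 h.1)
  simp only [SimState.ofVTapes, hempty]
  exact Exec.touch _ _

theorem Exec.cleanup {c : M.Config} (hT : Represents x y asked T c N) :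
    Exec K (.extract .output .out ;; .cleanAll M.tapes ;; .touch id fun _ => none)
      (SimState.ofVTapes σ T (fun _ => none) c.head x y).cfg
      (SimState.idle M x y (c.tape .output).content).cfg
      (12 * N + 25 + M.tapes.length * (10 * (N + 1) + 12)) := by
  classical
  have houtput : (c.tape .output).content = (T .output).content :=
    congrArg Tape.content (funext (hT.tape_eq .output))
  have hextract := Exec.extract (K := K) (i := .output) (σ := σ) (x := x) (y := y) hT.near
    hT.within (.inr rfl)
  rw [SimState.cfg_setTape_out] at hextract
  have hclean := Exec.cleanAll (K := K) (N := N + 1) M.tapes M.nodup_tapes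
    (s := { (SimState.ofVTapes σ (fun i => (T i).visit (c.head i)) (fun i => some (c.head i)) c.head
      x y).put .output (((T .output).visit (c.head .output)).tape (some (c.head .output)))
        ((T .output).content.length - 1) with output := (T .output).content }) fun i _ => by
    refine ⟨(T i).visit (c.head i), some (c.head i), ?_, (hT.within i).visit (hT.near i), ?_⟩
    · simp [SimState.put, SimState.ofVTapes]
    · have hmem := (T i).mem_visit (c.head i)
      have hlo := ((T i).visit (c.head i)).lo_nonpos
      rcases eq_or_ne i .output with rfl | hi
      · have hlen := ((T .output).visit (c.head .output)).length_content_le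
        rw [VTape.content_visit] at hlen
        simp only [SimState.put, Function.update_self]
        omega
      · simp only [SimState.put, SimState.ofVTapes, Function.update_of_ne hi]
        omega
  simp only [M.mem_tapes, if_true] at hclean
  have hforget := Exec.touch (K := K) (s := { SimState.idle M x y (T .output).content with
    state := σ }) id fun _ => none
  simp only [id, Function.update_eq_self] at hforget
  rw [houtput]
  exact (hextract.seq (hclean.seq hforget)).mono (by omega)

theorem Exec.simulate {t : ℕ} (hP : ∀ w, w.length ≤ B → P (ψ w)) (ht : M.time ψ x ≤ t)
    (hB : t + 2 ≤ B) (hy : P y) :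
    ∃ y', P y' ∧ Exec (AskErase ψ B P n) (.simulate M) (SimState.idle M x y []).cfg
      (SimState.idle M x y' (M.result ψ x)).cfg
      ((M.tapes.length + t + 1) * (n + 100 * (t + 2))) := by
  obtain ⟨s, hs, htime⟩ := M.exists_time_eq ht
  have hinit : SimRep P x (M.run ψ x 0) 0 _ := ⟨_, false, y, hy, Represents.init x y, rfl⟩
  obtain ⟨_, ⟨T, asked, y', hy', hT, rfl⟩, hloop⟩ :=
    Exec.vrun (n := n) hP (by omega) htime s 0 (by omega) hinit
  rw [M.result_eq htime.le]
  refine ⟨y', hy', ((Exec.start x y).seq (hloop.seq (Exec.cleanup hT))).mono ?_⟩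
  have hloop_le : s * (60 * (s + 2) + n + 2) ≤ t * (n + 100 * (t + 2)) :=
    Nat.mul_le_mul hs (by omega)
  have hclean_le : M.tapes.length * (10 * (s + 1) + 12) ≤
      M.tapes.length * (n + 100 * (t + 2)) :=
    Nat.mul_le_mul_left _ (by omega)
  rw [add_mul, add_mul]
  omega

end Simulation

/-! ### Subroutines -/

instance {S Q A : Type} [Finite S] [Finite Q] [Finite A] : Finite (SimSym S Q A) :=
  Finite.of_injective
    (fun c : SimSym S Q A => match c with
      | .cell x o h => (Sum.inl (x, o, h) : Option (Option (S ⊕ A)) × Bool × Bool ⊕ Q × Bool)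
      | .st q b => Sum.inr (q, b))
    (by rintro (_ | _) (_ | _) <;> simp)

section Call

variable {S W B : Type} {M : OracleMachine S} {φ : Baire S}

namespace SimState

@[simp]
theorem idle_cfg_head (x y o : List S) (j : SimTape M.W) : (idle M x y o).cfg.head j = 0 := by
  cases j <;> rfl

@[simp]
theorem idle_cfg_tape_virt (x y o : List S) (i : TapeIdx M.W) :
    (idle M x y o).cfg.tape (.virt i) = Tape.blank := rfl

@[simp]
theorem idle_cfg_tape_st (x y o : List S) : (idle M x y o).cfg.tape .st = Tape.blank :=
  Function.update_eq_self (f := Tape.blank) 0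

@[simp]
theorem idle_cfg_tape_inp (x y o : List S) : (idle M x y o).cfg.tape .inp = Tape.ofString x := rfl

@[simp]
theorem idle_cfg_tape_qry (x y o : List S) : (idle M x y o).cfg.tape .qry = Tape.blank :=
  Tape.ofString_nil

@[simp]
theorem idle_cfg_tape_ans (x y o : List S) : (idle M x y o).cfg.tape .ans = Tape.ofString y := rfl

@[simp]
theorem idle_cfg_tape_out (x y o : List S) : (idle M x y o).cfg.tape .out = Tape.ofString o := rfl

end SimState

/-- Consult the oracle and erase the query. -/
noncomputable def Prog.askErase : Prog S (TapeIdx W) B := .ask ;; .eraseString .query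

theorem Exec.askErase {C : Cfg S (TapeIdx W) B} {w : List S}
    (htape : C.tape .query = Tape.ofString w) (hhead : C.head .query = 0) :
    Exec (AskOracle φ .query .answer) .askErase C
      ((C.setTape .query Tape.blank).setTape .answer (Tape.ofString (φ w)))
      (5 * w.length + 6) := by
  have hask : Exec (AskOracle φ .query .answer) .ask C
      (C.setTape .answer (Tape.ofString (φ w))) 1 :=
    .ask ⟨by rw [Cfg.ask, htape, Tape.content_ofString], rfl⟩
  have herase := Exec.eraseString (K := AskOracle φ .query .answer) (TapeIdx.query : TapeIdx W)
    (C.setTape .answer (Tape.ofString (φ w))) w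
    (by rw [Cfg.setTape_tape_of_ne _ _ (by simp), htape]) hhead
  rw [Cfg.setTape_comm _ (by simp)] at herase
  exact (hask.seq herase).mono (by omega)

/-- Run the machine `M` as a subroutine, where the oracle of `M` is the oracle of the program. -/
noncomputable def Prog.call (M : OracleMachine S) (e : SimTape M.W → TapeIdx W)
    (f : SimSym S M.Q M.A → B) : Prog S (TapeIdx W) B :=
  (Prog.simulate M).subst e f .askErase

theorem Exec.call {e : SimTape M.W → TapeIdx W} {f : SimSym S M.Q M.A → B} (he : e.Injective)
    (hf : f.Injective) (hqry : e .qry = .query) (hans : e .ans = .answer) {G : Cfg S (TapeIdx W) B}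
    {x y : List S} (hG : G.embed e f (SimState.idle M x y []).cfg = G) {t : ℕ}
    (ht : M.time φ x ≤ t) :
    ∃ y', Exec (AskOracle φ .query .answer) (.call M e f) G
      ((G.setTape .answer (Tape.ofString y')).setTape (e .out) (Tape.ofString (M.result φ x)))
      ((M.tapes.length + t + 1) * (108 * (t + 2))) := by
  obtain ⟨y', -, hsim⟩ := Exec.simulate (P := fun _ => True) (n := 5 * (t + 2) + 6) (y := y)
    (fun _ _ => trivial) ht le_rfl trivial
  have hask (C C' : SimCfg M) (n : ℕ) (F : Cfg S (TapeIdx W) B)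
      (h : AskErase φ (t + 2) (fun _ => True) (5 * (t + 2) + 6) C C' n) (hF : F = G) :
      ∃ F', F' = G ∧ Exec (AskOracle φ .query .answer) .askErase (F.embed e f C) (F'.embed e f C')
        n := by
    obtain ⟨w, z, hw, -, htape, hhead, -, -, rfl, rfl⟩ := h
    have herase := Exec.askErase (φ := φ) (C := F.embed e f C) (w := w)
      (by rw [← hqry, Cfg.embed_tape he, htape, Tape.map_ofString])
      (by rw [← hqry, Cfg.embed_head he, hhead])
    refine ⟨F, hF, ?_⟩
    rw [Cfg.embed_setTape he, Cfg.embed_setTape he, hqry, hans, Tape.map_blank, Tape.map_ofString]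
    exact herase.mono (by omega)
  obtain ⟨_, rfl, hcall⟩ := Exec.subst he hf (· = G) hask hsim rfl
  have hidle : (SimState.idle M x y' (M.result φ x)).cfg =
      ((SimState.idle M x y []).cfg.setTape .ans (Tape.ofString y')).setTape .out
        (Tape.ofString (M.result φ x)) := by
    rw [SimState.cfg_setTape_ans, SimState.cfg_setTape_out]
    rfl
  rw [hidle, Cfg.embed_setTape he, Cfg.embed_setTape he, hans, Tape.map_ofString,
    Tape.map_ofString, hG] at hcall
  exact ⟨y', hcall.mono (Nat.mul_le_mul_left _ (by omega))⟩

end Call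

/-! ### Composition of machines -/

section Comp

variable {S : Type} (N M : OracleMachine S)

/-- The work tapes for the composition: those of the two simulations, and two tapes for the input
and the output of the inner machine. -/
abbrev CompWork : Type := (Option (TapeIdx N.W) ⊕ Option (TapeIdx M.W)) ⊕ Bool

/-- The auxiliary symbols for the composition. -/
abbrev CompSym : Type := SimSym S N.Q N.A ⊕ SimSym S M.Q M.A

/-- The tapes of the outer simulation. -/
def outerTape : SimTape N.W → TapeIdx (CompWork N M)
  | .virt i => .work (Sum.inl (Sum.inl (some i)))
  | .st => .work (Sum.inl (Sum.inl none))
  | .inp => .input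
  | .qry => .work (Sum.inr false)
  | .ans => .work (Sum.inr true)
  | .out => .output

/-- The tapes of the inner simulation. -/
def innerTape : SimTape M.W → TapeIdx (CompWork N M)
  | .virt i => .work (Sum.inl (Sum.inr (some i)))
  | .st => .work (Sum.inl (Sum.inr none))
  | .inp => .work (Sum.inr false)
  | .qry => .query
  | .ans => .answer
  | .out => .work (Sum.inr true)

theorem outerTape_injective : (outerTape N M).Injective := by
  rintro (_ | _ | _ | _ | _ | _) (_ | _ | _ | _ | _ | _) <;> simp [outerTape]

theorem innerTape_injective : (innerTape N M).Injective := by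
  rintro (_ | _ | _ | _ | _ | _) (_ | _ | _ | _ | _ | _) <;> simp [innerTape]

/-- The inner machine as an oracle for the outer one. -/
noncomputable def Prog.innerCall : Prog S (TapeIdx (CompWork N M)) (CompSym N M) :=
  .eraseString (.work (Sum.inr true)) ;; .call M (innerTape N M) Sum.inr ;;
    .eraseString (.work (Sum.inr false))

/-- Simulation of `N`, where the oracle is computed by `M`. -/
noncomputable def Prog.comp : Prog S (TapeIdx (CompWork N M)) (CompSym N M) :=
  (Prog.simulate N).subst (outerTape N M) Sum.inl (.innerCall N M)

variable {N M}

/-- The tapes that only the inner simulation uses are ready for use. -/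
structure InnerIdle (F : Cfg S (TapeIdx (CompWork N M)) (CompSym N M)) : Prop where
  tape_work : ∀ o, F.tape (.work (Sum.inl (Sum.inr o))) = Tape.blank
  head_work : ∀ o, F.head (.work (Sum.inl (Sum.inr o))) = 0
  tape_query : F.tape .query = Tape.blank
  head_query : F.head .query = 0
  tape_answer : ∃ y, F.tape .answer = Tape.ofString y
  head_answer : F.head .answer = 0

variable {F G : Cfg S (TapeIdx (CompWork N M)) (CompSym N M)}

theorem InnerIdle.setTape_answer (h : InnerIdle F) (y : List S) :
    InnerIdle (F.setTape .answer (Tape.ofString y)) where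
  tape_work o := by rw [Cfg.setTape_tape_of_ne _ _ (by simp), h.tape_work]
  head_work := h.head_work
  tape_query := by rw [Cfg.setTape_tape_of_ne _ _ (by simp), h.tape_query]
  head_query := h.head_query
  tape_answer := ⟨y, Cfg.setTape_tape_self ..⟩
  head_answer := h.head_answer

theorem InnerIdle.embed (h : InnerIdle F) (C : SimCfg N) :
    InnerIdle (F.embed (outerTape N M) Sum.inl C) := by
  have hwork (o) : ¬ ∃ k, outerTape N M k = .work (Sum.inl (Sum.inr o)) := by
    rintro ⟨_ | _, hk⟩ <;> simp [outerTape] at hk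
  have hquery : ¬ ∃ k, outerTape N M k = .query := by rintro ⟨_ | _, hk⟩ <;> simp [outerTape] at hk
  have hanswer : ¬ ∃ k, outerTape N M k = .answer := by
    rintro ⟨_ | _, hk⟩ <;> simp [outerTape] at hk
  constructor
  · exact fun o => (Cfg.embed_tape_of_notMem _ _ (hwork o)).trans (h.tape_work o)
  · exact fun o => (Cfg.embed_head_of_notMem _ _ (hwork o)).trans (h.head_work o)
  · exact (Cfg.embed_tape_of_notMem _ _ hquery).trans h.tape_query
  · exact (Cfg.embed_head_of_notMem _ _ hquery).trans h.head_query
  · exact h.tape_answer.imp fun _ => (Cfg.embed_tape_of_notMem _ _ hanswer).trans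
  · exact (Cfg.embed_head_of_notMem _ _ hanswer).trans h.head_answer

variable {φ : Baire S}

theorem Exec.innerCall (hG : InnerIdle G) {w y : List S}
    (hinp : G.tape (.work (Sum.inr false)) = Tape.ofString w)
    (hinp_head : G.head (.work (Sum.inr false)) = 0)
    (hout : G.tape (.work (Sum.inr true)) = Tape.ofString y)
    (hout_head : G.head (.work (Sum.inr true)) = 0) {t : ℕ} (ht : M.time φ w ≤ t) :
    ∃ y', Exec (AskOracle φ .query .answer) (.innerCall N M) G
      (((G.setTape .answer (Tape.ofString y')).setTape (.work (Sum.inr false)) Tape.blank).setTape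
        (.work (Sum.inr true)) (Tape.ofString (M.result φ w)))
      ((M.tapes.length + t + 1) * (108 * (t + 2)) + 5 * y.length + 5 * w.length + 10) := by
  obtain ⟨z, hz⟩ := hG.tape_answer
  have herase_out := Exec.eraseString (K := AskOracle φ .query .answer) (.work (Sum.inr true)) G y
    hout hout_head
  have hidle : Cfg.embed (innerTape N M) Sum.inr (G.setTape (.work (Sum.inr true)) Tape.blank)
      (SimState.idle M w z []).cfg = G.setTape (.work (Sum.inr true)) Tape.blank := by
    refine (Cfg.embed_eq_iff (innerTape_injective N M)).2 ⟨?_, fun _ _ => ⟨rfl, rfl⟩⟩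
    rintro (_ | _ | _ | _ | _ | _) <;>
      simp [innerTape, Cfg.setTape, hinp, hinp_head, hout_head, hz, hG.tape_work, hG.head_work,
        hG.tape_query, hG.head_query, hG.head_answer]
  obtain ⟨y', hcall⟩ := Exec.call (innerTape_injective N M) Sum.inr_injective rfl rfl hidle ht
  have herase_inp := Exec.eraseString (K := AskOracle φ .query .answer) (.work (Sum.inr false))
    (((G.setTape (.work (Sum.inr true)) Tape.blank).setTape .answer (Tape.ofString y')).setTape
      (.work (Sum.inr true)) (Tape.ofString (M.result φ w))) w
    (by simp [Cfg.setTape, hinp]) (by simp [hinp_head])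
  have hend : (((G.setTape (.work (Sum.inr true)) Tape.blank).setTape .answer
      (Tape.ofString y')).setTape (.work (Sum.inr true)) (Tape.ofString (M.result φ w))).setTape
        (.work (Sum.inr false)) Tape.blank =
      ((G.setTape .answer (Tape.ofString y')).setTape (.work (Sum.inr false)) Tape.blank).setTape
        (.work (Sum.inr true)) (Tape.ofString (M.result φ w)) := by
    rw [Cfg.setTape_comm G (by simp), Cfg.setTape_setTape, Cfg.setTape_comm _ (by simp)]
  rw [hend] at herase_inp
  exact ⟨y', (herase_out.seq (hcall.seq herase_inp)).mono (by omega)⟩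

theorem Exec.innerCall_of_askErase {B t : ℕ} (ht : ∀ w, w.length ≤ B → M.time φ w ≤ t)
    {C C' : SimCfg N} {n : ℕ}
    (h : AskErase (M.result φ) B (fun y => y.length ≤ t)
      ((M.tapes.length + t + 1) * (108 * (t + 2)) + 5 * t + 5 * B + 10) C C' n)
    (hF : InnerIdle F) :
    ∃ F', InnerIdle F' ∧ Exec (AskOracle φ .query .answer) (.innerCall N M)
      (F.embed (outerTape N M) Sum.inl C) (F'.embed (outerTape N M) Sum.inl C') n := by
  obtain ⟨w, y, hw, hy, hqry, hqry_head, hans, hans_head, rfl, rfl⟩ := h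
  have he := outerTape_injective N M
  obtain ⟨y', hinner⟩ := Exec.innerCall (φ := φ) (hF.embed C) (w := w) (y := y)
    ((Cfg.embed_tape he F C .qry).trans (by rw [hqry, Tape.map_ofString]))
    ((Cfg.embed_head he F C .qry).trans hqry_head)
    ((Cfg.embed_tape he F C .ans).trans (by rw [hans, Tape.map_ofString]))
    ((Cfg.embed_head he F C .ans).trans hans_head) (ht w hw)
  refine ⟨_, hF.setTape_answer y', ?_⟩
  rw [Cfg.embed_setTape he, Cfg.embed_setTape he, Tape.map_blank, Tape.map_ofString,
    Cfg.embed_setTape_of_notMem he _ _ (by rintro ⟨_ | _, hk⟩ <;> simp [outerTape] at hk)]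
  exact hinner.mono (by omega)

theorem Exec.comp {a : List S} {tN tM : ℕ} (hN : N.time (M.result φ) a ≤ tN)
    (hM : ∀ w, w.length ≤ tN + 2 → M.time φ w ≤ tM) :
    ∃ C', (C'.tape .output).content = N.result (M.result φ) a ∧
      Exec (AskOracle φ .query .answer) (.comp N M) (Prog.initCfg a) C'
        ((N.tapes.length + tN + 1) * ((M.tapes.length + tM + 1) * (108 * (tM + 2)) + 5 * tM +
          5 * (tN + 2) + 10 + 100 * (tN + 2))) := by
  have he := outerTape_injective N M
  obtain ⟨y', -, hsim⟩ := Exec.simulate (x := a) (y := []) (P := fun y => y.length ≤ tM)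
    (n := (M.tapes.length + tM + 1) * (108 * (tM + 2)) + 5 * tM + 5 * (tN + 2) + 10)
    (fun w hw => M.length_result_le (hM w hw)) hN le_rfl (Nat.zero_le _)
  have hinit : InnerIdle (N := N) (M := M) (Prog.initCfg a) :=
    ⟨fun _ => rfl, fun _ => rfl, rfl, rfl, ⟨[], Tape.ofString_nil.symm⟩, rfl⟩
  obtain ⟨F, -, hcomp⟩ := Exec.subst he Sum.inl_injective InnerIdle
    (fun _ _ _ _ hask hF => Exec.innerCall_of_askErase hM hask hF) hsim hinit
  have hidle : Cfg.embed (outerTape N M) (Sum.inl : _ → CompSym N M) (Prog.initCfg a)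
      (SimState.idle N a [] []).cfg = Prog.initCfg a := by
    refine (Cfg.embed_eq_iff he).2 ⟨?_, fun _ _ => ⟨rfl, rfl⟩⟩
    rintro (_ | _ | _ | _ | _ | _) <;> simp [outerTape, Prog.initCfg]
  rw [hidle] at hcomp
  refine ⟨_, ?_, hcomp⟩
  rw [show TapeIdx.output = outerTape N M .out from rfl, Cfg.embed_tape he, Tape.content_map,
    SimState.idle_cfg_tape_out, Tape.content_ofString]

theorem OracleMachine.exists_comp [Finite S] (N M : OracleMachine S) :
    ∃ (C : OracleMachine S) (c : ℕ), ∀ (φ : Baire S) (a : List S) (tN tM : ℕ),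
      N.time (M.result φ) a ≤ tN → (∀ w, w.length ≤ tN + 2 → M.time φ w ≤ tM) →
      C.time φ a ≤ (c * (tN + tM + 1) ^ 3 : ℕ) ∧ C.result φ a = N.result (M.result φ) a := by
  have := N.finW
  have := N.finQ
  have := N.finA
  have := M.finW
  have := M.finQ
  have := M.finA
  have := TapeIdx.finite (W := N.W)
  have := TapeIdx.finite (W := M.W)
  let c := N.tapes.length + M.tapes.length + 2
  refine ⟨(Prog.comp N M).compile, 3 * (228 * c ^ 3), fun φ a tN tM hN hM => ?_⟩
  obtain ⟨C', hC', hcomp⟩ := Exec.comp hN hM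
  obtain ⟨htime, hresult⟩ := Prog.compile_spec hcomp
  refine ⟨htime.trans (Nat.cast_le.2 ?_), hresult.trans hC'⟩
  rw [mul_assoc, mul_assoc, ← mul_pow]
  refine Nat.mul_le_mul_left 3 ?_
  set u := c * (tN + tM + 1)
  have hu : N.tapes.length + M.tapes.length + tN + tM + 2 ≤ u := by
    simp only [u, c]; nlinarith
  calc _ ≤ u * (u * (108 * u) + 5 * u + 5 * u + 10 * u + 100 * u) := by gcongr <;> omega
    _ ≤ u * (u * (108 * u) + 120 * u * u) := by
      refine Nat.mul_le_mul_left u ?_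
      nlinarith [Nat.le_mul_self u]
    _ = 228 * u ^ 3 := by ring

end Comp

/-! ### The identity operator -/

section CopyMap

variable {S I A : Type} {K : Cfg S I A → Cfg S I A → ℕ → Prop}

/-- Append the image of the string on the tape `j` under a map of letters to the string on the
tape `i`. -/
noncomputable def Prog.copyMap (g : S → S) (j i : I) : Prog S I A :=
  .copy (fun r => (r j).letter.map g) i (.only j .right)

theorem Exec.copyMap (g : S → S) {j i : I} (hji : j ≠ i) (C : Cfg S I A) {u v : List S}
    (hj : C.tape j = Tape.ofString u) (hj_head : C.head j = 0)
    (hi : C.tape i = Tape.ofString v) (hi_head : C.head i = v.length) :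
    Exec K (.copyMap g j i) C
      (((C.setTape i (Tape.ofString (v ++ u.map g))).setHead j u.length).setHead i
        (v ++ u.map g).length) (2 * u.length + 1) := by
  have hcopy := Exec.copy (K := K) (fun r => (r j).letter.map g) i (.only j .right) C v (u.map g)
    (fun k _ r hr => by
      rw [hr j hji, Cfg.moved_only, hj_head]
      simp [Cfg.read, hj, Tape.letter_ofString])
  rw [Cfg.setTape_eq hi, Cfg.setHead_eq hi_head, Cfg.moved_only, hj_head, List.length_map] at hcopy
  simpa [Cfg.setTape_setHead, Prog.copyMap] using hcopy

end CopyMap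

/-- Copy the input to the query tape and the answer to the output tape. -/
noncomputable def Prog.identity (S : Type) : Prog S (TapeIdx Empty) Empty :=
  .copyMap id .input .query ;; .ask ;; .copyMap id .answer .output

theorem OracleMachine.exists_identity (S : Type) :
    ∃ M : OracleMachine S, ∀ (φ : Baire S) (a : List S),
      M.time φ a ≤ (3 * (2 * a.length + 2 * (φ a).length + 3) : ℕ) ∧ M.result φ a = φ a := by
  refine ⟨(Prog.identity S).compile, fun φ a => ?_⟩
  have hinput := Exec.copyMap (K := AskOracle φ .query .answer) id
    (j := (.input : TapeIdx Empty)) (i := .query) (by simp) (Prog.initCfg (A := Empty) a)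
    (u := a) (v := []) rfl rfl Tape.ofString_nil.symm rfl
  rw [List.map_id, List.nil_append] at hinput
  set C := (((Prog.initCfg (A := Empty) a).setTape .query (Tape.ofString a)).setHead
    (.input : TapeIdx Empty) a.length).setHead .query a.length with hC
  have hask : Exec (AskOracle φ .query .answer) .ask C
      (C.setTape .answer (Tape.ofString (φ a))) 1 :=
    .ask ⟨by simp [hC, Cfg.ask], rfl⟩
  have houtput := Exec.copyMap (K := AskOracle φ .query .answer) id
    (j := (.answer : TapeIdx Empty)) (i := .output) (by simp)
    (C.setTape .answer (Tape.ofString (φ a))) (u := φ a) (v := [])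
    (by simp) (by simp [hC, Cfg.setHead, Prog.initCfg])
    (by simp [hC, Cfg.setTape, Prog.initCfg]) (by simp [hC, Cfg.setHead, Prog.initCfg])
  obtain ⟨htime, hresult⟩ := Prog.compile_spec (hinput.seq (hask.seq houtput))
  refine ⟨htime.trans (Nat.cast_le.2 (by omega)), hresult.trans ?_⟩
  simp

/-! ### Reading strings letter by letter -/

section Decoder

variable {S : Type}

/-- The code of a pair of a string and a number. -/
def pairCode (one zero : S) (a : List S) (n : ℕ) : List S :=
  a.flatMap (fun s => [zero, s]) ++ List.replicate n one

theorem pairCode_succ (one zero : S) (a : List S) (n : ℕ) :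
    pairCode one zero a (n + 1) = pairCode one zero a n ++ [one] := by
  simp only [pairCode, List.replicate_succ', List.append_assoc]

theorem pairCode_concat (one zero : S) (a : List S) (s : S) :
    pairCode one zero (a ++ [s]) 0 = pairCode one zero a 0 ++ [zero] ++ [s] := by
  simp [pairCode]

theorem length_pairCode (one zero : S) (a : List S) (n : ℕ) :
    (pairCode one zero a n).length = 2 * a.length + n := by
  simp [pairCode, mul_comm]

/-- Append a letter to the query. -/
noncomputable def Prog.appendQuery (s : S) : Prog S (TapeIdx Empty) Empty :=
  .put .query (fun _ => some (Sum.inl s)) (.only .query .right)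

/-- Append the next letter of the input to the query. -/
noncomputable def Prog.queryInput : Prog S (TapeIdx Empty) Empty :=
  .put .query (fun r => r .input) fun j => match j with
    | .query => .right
    | .input => .right
    | _ => .stay

/-- Append the second letter of the answer to the output. -/
noncomputable def Prog.outputAnswer : Prog S (TapeIdx Empty) Empty :=
  .shift (.only .answer .right) ;; .put .output (fun r => r .answer) fun j => match j with
    | .output => .right
    | .answer => .left
    | _ => .stay

/-- Ask for the codes of the input and of successive numbers, and output the second letter of each
answer for as long as its first letter is `zero`. -/
noncomputable def Prog.decode (one zero : S) : Prog S (TapeIdx Empty) Empty :=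
  .loop (IsLetter .input) (.appendQuery zero ;; .queryInput) ;; .ask ;;
    .loop (fun r => r .answer = some (Sum.inl zero)) (.outputAnswer ;; .appendQuery one ;; .ask)

/-- The data that `Prog.decode` maintains: the number of letters of the input that have been read
and the strings on the other tapes. -/
structure DecodeState (S : Type) where
  /-- the position on the input tape -/
  pos : ℕ
  /-- the string on the query tape -/
  query : List S
  /-- the string on the answer tape -/
  answer : List S
  /-- the string on the output tape -/
  output : List S

/-- The configuration with the input `a` that is described by a state of the decoder. -/
noncomputable def DecodeState.cfg (a : List S) (s : DecodeState S) :
    Cfg S (TapeIdx Empty) Empty where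
  tape j := match j with
    | .input => Tape.ofString a
    | .output => Tape.ofString s.output
    | .query => Tape.ofString s.query
    | .answer => Tape.ofString s.answer
    | .work _ => Tape.blank
  head j := match j with
    | .input => s.pos
    | .output => s.output.length
    | .query => s.query.length
    | .answer => 0
    | .work _ => 0

variable {K : Cfg S (TapeIdx Empty) Empty → Cfg S (TapeIdx Empty) Empty → ℕ → Prop}
  (a : List S) (s : DecodeState S)

theorem Exec.appendQuery (x : S) :
    Exec K (.appendQuery x) (s.cfg a) (DecodeState.cfg a { s with query := s.query ++ [x] }) 1 := by
  have hput : Exec K (.appendQuery x) (s.cfg a) _ 1 := Exec.put .query _ _ (s.cfg a)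
  convert hput using 1
  refine Cfg.ext (funext fun j => ?_) (funext fun j => ?_)
  · cases j <;> simp [Cfg.moved, Cfg.setTape, DecodeState.cfg, Tape.ofString_concat]
  · cases j <;> simp [Cfg.moved, DecodeState.cfg, Move.only]

theorem Exec.queryInput (h : s.pos < a.length) :
    Exec K .queryInput (s.cfg a)
      (DecodeState.cfg a { s with pos := s.pos + 1, query := s.query ++ [a[s.pos]] }) 1 := by
  have hread : (s.cfg a).read .input = some (Sum.inl a[s.pos]) := Tape.ofString_of_lt a h
  have hput : Exec K .queryInput (s.cfg a) _ 1 := Exec.put .query _ _ (s.cfg a)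
  rw [hread] at hput
  convert hput using 1
  refine Cfg.ext (funext fun j => ?_) (funext fun j => ?_)
  · cases j <;> simp [Cfg.moved, Cfg.setTape, DecodeState.cfg, Tape.ofString_concat]
  · cases j <;> simp [Cfg.moved, DecodeState.cfg]

theorem Exec.ask_decode (φ : Baire S) :
    Exec (AskOracle φ .query .answer) .ask (s.cfg a)
      (DecodeState.cfg a { s with answer := φ s.query }) 1 := by
  refine .ask ⟨Cfg.ext (funext fun j => ?_) rfl, rfl⟩
  cases j <;> simp [Cfg.ask, Cfg.setTape, DecodeState.cfg]

theorem Exec.outputAnswer {x y : S} {v : List S} (h : s.answer = x :: y :: v) :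
    Exec K .outputAnswer (s.cfg a) (DecodeState.cfg a { s with output := s.output ++ [y] }) 2 := by
  have hread : ((s.cfg a).moved (.only .answer .right) 1).read .answer = some (Sum.inl y) := by
    simp [Cfg.read, Cfg.moved, DecodeState.cfg, Move.only, Tape.ofString, h]
  have hput : Exec K .outputAnswer (s.cfg a) _ 2 :=
    (Exec.shift (.only .answer .right) (s.cfg a)).seq (Exec.put .output _ _ _)
  rw [hread] at hput
  convert hput using 1
  refine Cfg.ext (funext fun j => ?_) (funext fun j => ?_)
  · cases j <;> simp [Cfg.moved, Cfg.setTape, DecodeState.cfg, Tape.ofString_concat, Move.only]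
  · cases j <;> simp [Cfg.moved, DecodeState.cfg, Move.only]

theorem Exec.query_loop (one zero : S) :
    Exec K (.loop (IsLetter .input) (.appendQuery zero ;; .queryInput)) (Prog.initCfg a)
      (DecodeState.cfg a ⟨a.length, pairCode one zero a 0, [], []⟩) (3 * a.length + 1) := by
  have hloop := Exec.loop_iterate (K := K) (b := IsLetter .input)
    (p := .appendQuery zero ;; .queryInput)
    (fun k => DecodeState.cfg a ⟨k, pairCode one zero (a.take k) 0, [], []⟩) a.length 2
    (fun k hk => by simp [IsLetter, Cfg.read, DecodeState.cfg, Tape.letter_ofString, hk])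
    (fun k hk => by
      rw [List.take_add_one, List.getElem?_eq_getElem hk, Option.toList_some, pairCode_concat]
      exact (Exec.appendQuery a _ zero).seq (Exec.queryInput a _ hk))
    (by simp [IsLetter, Cfg.read, DecodeState.cfg, Tape.letter_ofString])
  have hinit : DecodeState.cfg a ⟨0, pairCode one zero (a.take 0) 0, [], []⟩ = Prog.initCfg a := by
    refine Cfg.ext (funext fun j => ?_) (funext fun j => ?_) <;>
      cases j <;> simp [DecodeState.cfg, Prog.initCfg, pairCode]
  rw [hinit, List.take_length] at hloop
  exact hloop.mono (by omega)

theorem Exec.output_loop {one zero : S} {φ : Baire S} {a u : List S}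
    (hget : ∀ k (hk : k < u.length), ∃ v, φ (pairCode one zero a k) = zero :: u[k] :: v)
    (hend : (φ (pairCode one zero a u.length)).head? ≠ some zero) :
    Exec (AskOracle φ .query .answer)
      (.loop (fun r => r .answer = some (Sum.inl zero)) (.outputAnswer ;; .appendQuery one ;; .ask))
      (DecodeState.cfg a ⟨a.length, pairCode one zero a 0, φ (pairCode one zero a 0), []⟩)
      (DecodeState.cfg a
        ⟨a.length, pairCode one zero a u.length, φ (pairCode one zero a u.length), u⟩)
      (5 * u.length + 1) := by
  have hloop := Exec.loop_iterate (K := AskOracle φ .query .answer)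
    (b := fun r => r .answer = some (Sum.inl zero))
    (p := .outputAnswer ;; .appendQuery one ;; .ask)
    (fun k => DecodeState.cfg a
      ⟨a.length, pairCode one zero a k, φ (pairCode one zero a k), u.take k⟩) u.length 4
    (fun k hk => by
      obtain ⟨_, hv⟩ := hget k hk
      simp [Cfg.read, DecodeState.cfg, hv, Tape.ofString])
    (fun k hk => by
      obtain ⟨v, hv⟩ := hget k hk
      rw [List.take_add_one, List.getElem?_eq_getElem hk, Option.toList_some, pairCode_succ]
      exact (Exec.outputAnswer a _ hv).seq
        ((Exec.appendQuery a _ one).seq (Exec.ask_decode a _ φ)))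
    (by
      rw [List.head?_eq_getElem?] at hend
      simpa [Cfg.read, DecodeState.cfg, Tape.ofString] using hend)
  rw [List.take_zero, List.take_length] at hloop
  exact hloop.mono (by omega)

theorem OracleMachine.exists_decoder (one zero : S) :
    ∃ M : OracleMachine S, ∀ (φ : Baire S) (a u : List S),
      (∀ k (hk : k < u.length), ∃ v, φ (pairCode one zero a k) = zero :: u[k] :: v) →
      (φ (pairCode one zero a u.length)).head? ≠ some zero →
      M.time φ a ≤ (3 * (3 * a.length + 5 * u.length + 3) : ℕ) ∧ M.result φ a = u := by
  refine ⟨(Prog.decode one zero).compile, fun φ a u hget hend => ?_⟩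
  obtain ⟨htime, hresult⟩ := Prog.compile_spec ((Exec.query_loop a one zero).seq
    ((Exec.ask_decode a _ φ).seq (Exec.output_loop hget hend)))
  refine ⟨htime.trans (Nat.cast_le.2 (by omega)), hresult.trans ?_⟩
  simp [DecodeState.cfg]

end Decoder

/-! ### Monotone codes of names -/

section Encoding

variable {S : Type}

open Classical in
/-- The string in a code of a pair. The values on strings that are not such codes are those which
`Prog.readArg` computes. -/
noncomputable def pairArg (one : S) : List S → List S
  | [] => []
  | [x] => if x = one then [] else [one]
  | x :: y :: w => if x = one then [] else y :: pairArg one w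

/-- The number in a code of a pair. -/
noncomputable def pairIdx (one : S) (w : List S) : ℕ := w.length - 2 * (pairArg one w).length

theorem pairArg_pairCode {one zero : S} (h : one ≠ zero) (a : List S) (n : ℕ) :
    pairArg one (pairCode one zero a n) = a := by
  induction a with
  | nil => rcases n with _ | _ | n <;> simp [pairCode, pairArg, List.replicate_succ]
  | cons s a ih =>
    have hcons : pairCode one zero (s :: a) n = zero :: s :: pairCode one zero a n := by
      simp [pairCode]
    rw [hcons, pairArg, if_neg h.symm, ih]

theorem pairIdx_pairCode {one zero : S} (h : one ≠ zero) (a : List S) (n : ℕ) :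
    pairIdx one (pairCode one zero a n) = n := by
  rw [pairIdx, pairArg_pairCode h, length_pairCode, Nat.add_sub_cancel_left]

theorem length_pairArg_le (one : S) (w : List S) : (pairArg one w).length ≤ w.length := by
  induction w using pairArg.induct (one := one) <;> simp_all [pairArg]
  omega

theorem pairArg_drop_of_ne {one s : S} {w : List S} {n : ℕ} (h : w[n]? = some s) (hs : s ≠ one) :
    pairArg one (w.drop n) = w[n + 1]?.getD one :: pairArg one (w.drop (n + 2)) := by
  rw [← List.drop_drop, ← List.getElem?_drop]
  rw [← add_zero n, ← List.getElem?_drop] at h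
  rcases hw : w.drop n with _ | ⟨x, _ | ⟨y, v⟩⟩ <;> simp_all [pairArg]

theorem pairArg_drop_of_forall {one : S} {w : List S} {n : ℕ} (h : ∀ s, w[n]? = some s → s = one) :
    pairArg one (w.drop n) = [] := by
  rw [← add_zero n, ← List.getElem?_drop] at h
  rcases hw : w.drop n with _ | ⟨x, _ | ⟨y, v⟩⟩ <;> simp_all [pairArg]

/-- A code for an optional letter. -/
def codeLetter (one zero : S) : Option S → List S
  | none => [one, one]
  | some s => [zero, s]

theorem length_codeLetter (one zero : S) (x : Option S) : (codeLetter one zero x).length = 2 := by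
  cases x <;> rfl

theorem codeLetter_injective {one zero : S} (h : one ≠ zero) :
    (codeLetter one zero).Injective := by
  rintro (_ | x) (_ | y) he <;> simp_all [codeLetter]

/-- A name that encodes the symbols of the values of `φ`, with values padded to a length that is
controlled by `l`. -/
noncomputable def monotoneCode (one zero : S) (l : ℕ → ℕ) (φ : Baire S) : Baire S := fun w =>
  codeLetter one zero (φ (pairArg one w))[pairIdx one w]? ++ List.replicate (l w.length) one

theorem length_monotoneCode (one zero : S) (l : ℕ → ℕ) (φ : Baire S) (w : List S) :
    (monotoneCode one zero l φ w).length = l w.length + 2 := by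
  simp [monotoneCode, length_codeLetter, add_comm]

theorem monotoneCode_pairCode {one zero : S} (h : one ≠ zero) (l : ℕ → ℕ) (φ : Baire S)
    (a : List S) (n : ℕ) :
    monotoneCode one zero l φ (pairCode one zero a n) =
      codeLetter one zero (φ a)[n]? ++ List.replicate (l (2 * a.length + n)) one := by
  rw [monotoneCode, pairArg_pairCode h, pairIdx_pairCode h, length_pairCode]

theorem monotoneCode_injective {one zero : S} (h : one ≠ zero) {l l' : ℕ → ℕ} {φ φ' : Baire S}
    (he : monotoneCode one zero l φ = monotoneCode one zero l' φ') : φ = φ' := by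
  refine funext fun a => List.ext_getElem? fun n => codeLetter_injective h ?_
  have hcode := congrFun he (pairCode one zero a n)
  rw [monotoneCode_pairCode h, monotoneCode_pairCode h] at hcode
  exact (List.append_inj hcode (by rw [length_codeLetter, length_codeLetter])).1

end Encoding

section Encoder

variable {S : Type} (M N : OracleMachine S)

/-- The work tapes of the encoder: those of the two subroutines, a tape for their arguments and
one tape for the result of each. -/
abbrev EncWork : Type := (Option (TapeIdx M.W) ⊕ Option (TapeIdx N.W)) ⊕ Option Bool

/-- The auxiliary symbols of the encoder. -/
abbrev EncSym : Type := SimSym S M.Q M.A ⊕ SimSym S N.Q N.A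

/-- The tape for the arguments of the subroutines. -/
abbrev argTape : TapeIdx (EncWork M N) := .work (Sum.inr none)

/-- The tape for the result of the subroutine that computes the padding. -/
abbrev padTape : TapeIdx (EncWork M N) := .work (Sum.inr (some false))

/-- The tape for the result of the subroutine that computes the encoded value. -/
abbrev valueTape : TapeIdx (EncWork M N) := .work (Sum.inr (some true))

/-- The tapes of the subroutine that computes the padding. -/
def padTapes : SimTape M.W → TapeIdx (EncWork M N)
  | .virt i => .work (Sum.inl (Sum.inl (some i)))
  | .st => .work (Sum.inl (Sum.inl none))
  | .inp => argTape M N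
  | .qry => .query
  | .ans => .answer
  | .out => padTape M N

/-- The tapes of the subroutine that computes the encoded value. -/
def valueTapes : SimTape N.W → TapeIdx (EncWork M N)
  | .virt i => .work (Sum.inl (Sum.inr (some i)))
  | .st => .work (Sum.inl (Sum.inr none))
  | .inp => argTape M N
  | .qry => .query
  | .ans => .answer
  | .out => valueTape M N

theorem padTapes_injective : (padTapes M N).Injective := by
  rintro (_ | _ | _ | _ | _ | _) (_ | _ | _ | _ | _ | _) <;> simp [padTapes]

theorem valueTapes_injective : (valueTapes M N).Injective := by
  rintro (_ | _ | _ | _ | _ | _) (_ | _ | _ | _ | _ | _) <;> simp [valueTapes]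

/-- Copy the second of the next two letters of the input to the tape for the arguments. -/
noncomputable def Prog.readArgLetter (one : S) : Prog S (TapeIdx (EncWork M N)) (EncSym M N) :=
  .shift (.only .input .right) ;;
    .put (argTape M N) (fun r => some (Sum.inl ((r .input).letter.getD one))) fun j => match j with
      | .input => .right
      | .work (Sum.inr none) => .right
      | _ => .stay

/-- Extract the string from the code of a pair. -/
noncomputable def Prog.readArg (one : S) : Prog S (TapeIdx (EncWork M N)) (EncSym M N) :=
  .loop (fun r => ∃ s, (r .input).letter = some s ∧ s ≠ one) (.readArgLetter M N one)

/-- Move the head on the value by the number in the code of a pair. -/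
noncomputable def Prog.seekIdx : Prog S (TapeIdx (EncWork M N)) (EncSym M N) :=
  .loop (IsLetter .input) (.shift fun j => match j with
    | .input => .right
    | .work (Sum.inr (some true)) => .right
    | _ => .stay)

/-- Output a letter that depends on the scanned letter of the value. -/
noncomputable def Prog.outputLetter (g : Option S → S) :
    Prog S (TapeIdx (EncWork M N)) (EncSym M N) :=
  .put .output (fun r => some (Sum.inl (g (r (valueTape M N)).letter))) (.only .output .right)

/-- Run `M` on the unary representation of the length of the input. -/
noncomputable def Prog.computePad (one : S) : Prog S (TapeIdx (EncWork M N)) (EncSym M N) :=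
  .copyMap (fun _ => one) .input (argTape M N) ;; (.rewind (argTape M N) ;; .rewind .input) ;;
    .call M (padTapes M N) Sum.inl ;; .eraseString (argTape M N)

/-- Run `N` on the string in the code of a pair. -/
noncomputable def Prog.computeValue (one : S) : Prog S (TapeIdx (EncWork M N)) (EncSym M N) :=
  .readArg M N one ;; .rewind (argTape M N) ;; .call N (valueTapes M N) Sum.inr

/-- Output the code of a letter of the value, followed by the padding. -/
noncomputable def Prog.outputCode (one zero : S) : Prog S (TapeIdx (EncWork M N)) (EncSym M N) :=
  .seekIdx M N ;; .outputLetter M N (fun s => if s = none then one else zero) ;;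
    .outputLetter M N (fun s => s.getD one) ;; .copyMap (fun _ => one) (padTape M N) .output

/-- Compute a monotone code, where `M` computes the padding and `N` the encoded values. -/
noncomputable def Prog.encode (one zero : S) : Prog S (TapeIdx (EncWork M N)) (EncSym M N) :=
  .computePad M N one ;; .computeValue M N one ;; .outputCode M N one zero

/-- The data that `Prog.encode` maintains: the strings on the tapes, and those head positions that
vary independently of them. -/
structure EncodeState (S : Type) where
  /-- the position on the input tape -/
  pos : ℕ := 0
  /-- the string on the tape for arguments -/
  arg : List S := []
  /-- the position on the tape for arguments -/
  argPos : ℕ := 0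
  /-- the result of the subroutine that computes the padding -/
  pad : List S := []
  /-- the result of the subroutine that computes the encoded value -/
  value : List S := []
  /-- the position on the tape for the encoded value -/
  valuePos : ℕ := 0
  /-- the string on the answer tape -/
  answer : List S := []
  /-- the string on the output tape -/
  output : List S := []

namespace EncodeState

/-- The configuration with the input `w` that is described by a state of the encoder. -/
noncomputable def cfg (w : List S) (s : EncodeState S) :
    Cfg S (TapeIdx (EncWork M N)) (EncSym M N) where
  tape j := match j with
    | .input => Tape.ofString w
    | .output => Tape.ofString s.output
    | .query => Tape.blank
    | .answer => Tape.ofString s.answer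
    | .work (Sum.inr none) => Tape.ofString s.arg
    | .work (Sum.inr (some false)) => Tape.ofString s.pad
    | .work (Sum.inr (some true)) => Tape.ofString s.value
    | .work (Sum.inl _) => Tape.blank
  head j := match j with
    | .input => s.pos
    | .output => s.output.length
    | .work (Sum.inr none) => s.argPos
    | .work (Sum.inr (some true)) => s.valuePos
    | _ => 0

variable {M N} (w : List S) (s : EncodeState S)

theorem cfg_setHead_arg (n : ℕ) :
    (s.cfg M N w).setHead (argTape M N) n = cfg M N w { s with argPos := n } := by
  refine Cfg.ext rfl (funext ?_)
  rintro (_ | _ | _ | _ | (_ | _ | _ | _)) <;> simp [Cfg.setHead, cfg]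

theorem cfg_setHead_input (n : ℕ) :
    (s.cfg M N w).setHead .input n = cfg M N w { s with pos := n } := by
  refine Cfg.ext rfl (funext ?_)
  rintro (_ | _ | _ | _ | (_ | _ | _ | _)) <;> simp [Cfg.setHead, cfg]

theorem cfg_setTape_arg (u : List S) :
    (s.cfg M N w).setTape (argTape M N) (Tape.ofString u) = cfg M N w { s with arg := u } := by
  refine Cfg.ext (funext ?_) rfl
  rintro (_ | _ | _ | _ | (_ | _ | _ | _)) <;> simp [Cfg.setTape, cfg]

theorem cfg_setTape_pad (u : List S) :
    (s.cfg M N w).setTape (padTape M N) (Tape.ofString u) = cfg M N w { s with pad := u } := by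
  refine Cfg.ext (funext ?_) rfl
  rintro (_ | _ | _ | _ | (_ | _ | _ | _)) <;> simp [Cfg.setTape, cfg]

theorem cfg_setTape_value (u : List S) :
    (s.cfg M N w).setTape (valueTape M N) (Tape.ofString u) = cfg M N w { s with value := u } := by
  refine Cfg.ext (funext ?_) rfl
  rintro (_ | _ | _ | _ | (_ | _ | _ | _)) <;> simp [Cfg.setTape, cfg]

theorem cfg_setTape_answer (u : List S) :
    (s.cfg M N w).setTape .answer (Tape.ofString u) = cfg M N w { s with answer := u } := by
  refine Cfg.ext (funext ?_) rfl
  rintro (_ | _ | _ | _ | (_ | _ | _ | _)) <;> simp [Cfg.setTape, cfg]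

theorem initCfg_eq_cfg : Prog.initCfg w = cfg M N w {} := by
  refine Cfg.ext (funext ?_) (funext ?_) <;>
    rintro (_ | _ | _ | _ | (_ | _ | _ | _)) <;> simp [Prog.initCfg, cfg]

theorem embed_padTapes {s : EncodeState S} (hargPos : s.argPos = 0) (hpad : s.pad = []) :
    Cfg.embed (padTapes M N) Sum.inl (s.cfg M N w) (SimState.idle M s.arg s.answer []).cfg =
      s.cfg M N w := by
  refine (Cfg.embed_eq_iff (padTapes_injective M N)).2 ⟨?_, fun _ _ => ⟨rfl, rfl⟩⟩
  rintro (_ | _ | _ | _ | _ | _) <;> simp [padTapes, cfg, hargPos, hpad]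

theorem embed_valueTapes {s : EncodeState S} (hargPos : s.argPos = 0) (hvalue : s.value = [])
    (hvaluePos : s.valuePos = 0) :
    Cfg.embed (valueTapes M N) Sum.inr (s.cfg M N w) (SimState.idle N s.arg s.answer []).cfg =
      s.cfg M N w := by
  refine (Cfg.embed_eq_iff (valueTapes_injective M N)).2 ⟨?_, fun _ _ => ⟨rfl, rfl⟩⟩
  rintro (_ | _ | _ | _ | _ | _) <;> simp [valueTapes, cfg, hargPos, hvalue, hvaluePos]

end EncodeState

end Encoder

/-! ### Computing monotone codes -/

section Encoder

variable {S : Type} {M N : OracleMachine S}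
  {K : Cfg S (TapeIdx (EncWork M N)) (EncSym M N) →
    Cfg S (TapeIdx (EncWork M N)) (EncSym M N) → ℕ → Prop}
  (w : List S) (s : EncodeState S)

theorem EncodeState.letter_read_input : ((s.cfg M N w).read .input).letter = w[s.pos]? :=
  Tape.letter_ofString w s.pos

theorem Exec.readArgLetter (one : S) (h : s.argPos = s.arg.length) :
    Exec K (.readArgLetter M N one) (s.cfg M N w)
      (EncodeState.cfg M N w { s with
        pos := s.pos + 2
        arg := s.arg ++ [w[s.pos + 1]?.getD one]
        argPos := s.argPos + 1 }) 2 := by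
  have hread : (((s.cfg M N w).moved (.only .input .right) 1).read .input).letter =
      w[s.pos + 1]? := by
    rw [← Tape.letter_ofString (A := EncSym M N)]
    simp [Cfg.read, Cfg.moved, EncodeState.cfg, Move.only]
  have hput : Exec K (.readArgLetter M N one) (s.cfg M N w) _ 2 :=
    (Exec.shift (.only .input .right) (s.cfg M N w)).seq (Exec.put (argTape M N) _ _ _)
  rw [hread] at hput
  convert hput using 1
  refine Cfg.ext (funext ?_) (funext ?_)
  · rintro (_ | _ | _ | _ | (_ | _ | _ | _)) <;>
      simp [Cfg.moved, Cfg.setTape, EncodeState.cfg, Tape.ofString_concat, Move.only, h]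
  · rintro (_ | _ | _ | _ | (_ | _ | _ | _)) <;>
      simp [Cfg.moved, EncodeState.cfg, Move.only]
    ring

theorem Exec.readArg (one : S) (h : s.argPos = s.arg.length) :
    Exec K (.readArg M N one) (s.cfg M N w)
      (EncodeState.cfg M N w { s with
        pos := s.pos + 2 * (pairArg one (w.drop s.pos)).length
        arg := s.arg ++ pairArg one (w.drop s.pos)
        argPos := s.argPos + (pairArg one (w.drop s.pos)).length })
      (3 * (pairArg one (w.drop s.pos)).length + 1) := by
  induction hn : w.length - s.pos using Nat.strong_induction_on generalizing s with
  | _ n ih =>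
    subst hn
    by_cases hmore : ∃ x, w[s.pos]? = some x ∧ x ≠ one
    · obtain ⟨x, hx, hne⟩ := hmore
      have hlt : s.pos < w.length := (List.getElem?_eq_some_iff.1 hx).1
      have hloop : Exec K (.readArg M N one) (s.cfg M N w) _ _ := Exec.loop_pos
        ⟨x, (s.letter_read_input w).trans hx, hne⟩ (Exec.readArgLetter (K := K) w s one h)
        (ih _ (by dsimp only; omega) { s with
          pos := s.pos + 2
          arg := s.arg ++ [w[s.pos + 1]?.getD one]
          argPos := s.argPos + 1 } (by simp [h]) rfl)
      rw [pairArg_drop_of_ne hx hne, List.length_cons]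
      convert hloop.mono (t := 3 * ((pairArg one (w.drop (s.pos + 2))).length + 1) + 1)
        (by dsimp only; omega) using 3
      · ring
      · simp
      · ring
    · rw [pairArg_drop_of_forall fun x hx => of_not_not fun hne => hmore ⟨x, hx, hne⟩]
      simp only [List.length_nil, mul_zero, add_zero, List.append_nil]
      refine Exec.loop_neg ?_
      rwa [EncodeState.letter_read_input]

theorem Exec.seekIdx :
    Exec K (.seekIdx M N) (s.cfg M N w)
      (EncodeState.cfg M N w { s with
        pos := s.pos + (w.length - s.pos)
        valuePos := s.valuePos + (w.length - s.pos) })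
      (2 * (w.length - s.pos) + 1) := by
  have hloop := Exec.loop_iterate (K := K) (b := IsLetter .input)
    (p := .shift fun j => match j with
      | .input => .right
      | .work (Sum.inr (some true)) => .right
      | _ => .stay)
    (fun k => EncodeState.cfg M N w { s with pos := s.pos + k, valuePos := s.valuePos + k })
    (w.length - s.pos) 1
    (fun k hk => by
      have hlt : s.pos + k < w.length := by omega
      simp [IsLetter, EncodeState.letter_read_input, hlt])
    (fun k _ => by
      convert Exec.shift _ _ using 1
      refine Cfg.ext (funext fun _ => rfl) (funext ?_)
      rintro (_ | _ | _ | _ | (_ | _ | _ | _)) <;>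
        simp [Cfg.moved, EncodeState.cfg, add_assoc])
    (by
      have hle : w.length ≤ s.pos + (w.length - s.pos) := by omega
      simp [IsLetter, EncodeState.letter_read_input, hle])
  exact hloop.mono (by omega)

theorem Exec.outputLetter (g : Option S → S) :
    Exec K (.outputLetter M N g) (s.cfg M N w)
      (EncodeState.cfg M N w { s with output := s.output ++ [g s.value[s.valuePos]?] }) 1 := by
  have hread : ((s.cfg M N w).read (valueTape M N)).letter = s.value[s.valuePos]? :=
    Tape.letter_ofString s.value s.valuePos
  have hput : Exec K (.outputLetter M N g) (s.cfg M N w) _ 1 :=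
    Exec.put TapeIdx.output _ _ _
  rw [hread] at hput
  convert hput using 1
  refine Cfg.ext (funext ?_) (funext ?_)
  · rintro (_ | _ | _ | _ | (_ | _ | _ | _)) <;>
      simp [Cfg.moved, Cfg.setTape, EncodeState.cfg, Tape.ofString_concat]
  · rintro (_ | _ | _ | _ | (_ | _ | _ | _)) <;> simp [Cfg.moved, EncodeState.cfg, Move.only]

theorem Exec.rewindArg (h : s.argPos ≤ s.arg.length) :
    Exec K (.rewind (argTape M N)) (s.cfg M N w) (EncodeState.cfg M N w { s with argPos := 0 })
      (2 * s.argPos + 3) := by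
  have hrewind := Exec.rewind (K := K) (argTape M N) (s.cfg M N w) s.arg rfl h
  rwa [← Nat.cast_zero, EncodeState.cfg_setHead_arg, EncodeState.cfg_setHead_arg] at hrewind

theorem Exec.rewindInput (h : s.pos ≤ w.length) :
    Exec K (.rewind .input) (s.cfg M N w) (EncodeState.cfg M N w { s with pos := 0 })
      (2 * s.pos + 3) := by
  have hrewind := Exec.rewind (K := K) .input (s.cfg M N w) w rfl h
  rwa [← Nat.cast_zero, EncodeState.cfg_setHead_input, EncodeState.cfg_setHead_input] at hrewind

theorem Exec.computePad (one : S) (φ : Baire S) {t : ℕ}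
    (ht : M.time φ (List.replicate w.length one) ≤ t) :
    ∃ y, Exec (AskOracle φ .query .answer) (.computePad M N one) (EncodeState.cfg M N w {})
      (EncodeState.cfg M N w
        { pad := M.result φ (List.replicate w.length one), answer := y })
      (11 * w.length + 12 + (M.tapes.length + t + 1) * (108 * (t + 2))) := by
  set x := List.replicate w.length one with hx
  have hxlen : x.length = w.length := List.length_replicate
  have hcopy := Exec.copyMap (K := AskOracle φ .query .answer) (fun _ => one)
    (j := .input) (i := argTape M N) (v := []) (u := w) (by simp) (EncodeState.cfg M N w {})
    rfl rfl rfl rfl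
  rw [List.map_const', List.nil_append, ← hx, EncodeState.cfg_setTape_arg,
    EncodeState.cfg_setHead_input, EncodeState.cfg_setHead_arg] at hcopy
  have hrewind := (Exec.rewindArg (K := AskOracle φ .query .answer) (M := M) (N := N) w
    { pos := w.length, arg := x, argPos := x.length } le_rfl).seq (Exec.rewindInput w _ le_rfl)
  obtain ⟨y, hcall⟩ := Exec.call (padTapes_injective M N) Sum.inl_injective rfl rfl
    (EncodeState.embed_padTapes w (s := { arg := x }) rfl rfl) ht
  rw [EncodeState.cfg_setTape_answer, padTapes, EncodeState.cfg_setTape_pad] at hcall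
  have herase := Exec.eraseString (K := AskOracle φ .query .answer) (argTape M N)
    (EncodeState.cfg M N w { arg := x, pad := M.result φ x, answer := y }) x rfl rfl
  rw [← Tape.ofString_nil, EncodeState.cfg_setTape_arg] at herase
  exact ⟨y, (hcopy.seq (hrewind.seq (hcall.seq herase))).mono (by dsimp only; omega)⟩

theorem Exec.computeValue (one : S) (φ : Baire S) (u y : List S) {t : ℕ}
    (ht : N.time φ (pairArg one w) ≤ t) :
    ∃ y', Exec (AskOracle φ .query .answer) (.computeValue M N one)
      (EncodeState.cfg M N w { pad := u, answer := y })
      (EncodeState.cfg M N w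
        { pos := 2 * (pairArg one w).length
          arg := pairArg one w
          pad := u
          value := N.result φ (pairArg one w)
          answer := y' })
      (5 * w.length + 4 + (N.tapes.length + t + 1) * (108 * (t + 2))) := by
  have hread := Exec.readArg (K := AskOracle φ .query .answer) (M := M) (N := N) w
    { pad := u, answer := y } one rfl
  simp only [List.drop_zero, List.nil_append, zero_add] at hread
  have hrewind := Exec.rewindArg (K := AskOracle φ .query .answer) (M := M) (N := N) w
    { pos := 2 * (pairArg one w).length
      arg := pairArg one w
      argPos := (pairArg one w).length
      pad := u
      answer := y } le_rfl
  obtain ⟨y', hcall⟩ := Exec.call (valueTapes_injective M N) Sum.inr_injective rfl rfl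
    (EncodeState.embed_valueTapes w
      (s :=
        { pos := 2 * (pairArg one w).length
          arg := pairArg one w
          pad := u
          answer := y }) rfl rfl rfl) ht
  rw [EncodeState.cfg_setTape_answer, valueTapes, EncodeState.cfg_setTape_value] at hcall
  have hlen := length_pairArg_le one w
  exact ⟨y', (hread.seq (hrewind.seq hcall)).mono (by dsimp only; omega)⟩

theorem Exec.copyPad (one : S) :
    Exec K (.copyMap (fun _ => one) (padTape M N) .output) (s.cfg M N w)
      ((EncodeState.cfg M N w
        { s with output := s.output ++ List.replicate s.pad.length one }).setHead
          (padTape M N) s.pad.length) (2 * s.pad.length + 1) := by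
  convert Exec.copyMap (K := K) (fun _ => one) (j := padTape M N) (i := .output) (by simp)
    (s.cfg M N w) (u := s.pad) (v := s.output) rfl rfl rfl rfl using 1
  rw [List.map_const']
  refine Cfg.ext (funext ?_) (funext ?_) <;>
    rintro (_ | _ | _ | _ | (_ | _ | _ | _)) <;> simp [Cfg.setHead, Cfg.setTape, EncodeState.cfg]

theorem Exec.outputCode (one zero : S) (hvaluePos : s.valuePos = 0) (houtput : s.output = []) :
    Exec K (.outputCode M N one zero) (s.cfg M N w)
      ((EncodeState.cfg M N w { s with
          pos := s.pos + (w.length - s.pos)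
          valuePos := w.length - s.pos
          output := codeLetter one zero s.value[w.length - s.pos]? ++
            List.replicate s.pad.length one }).setHead (padTape M N) s.pad.length)
      (2 * w.length + 2 * s.pad.length + 4) := by
  have hseek := Exec.seekIdx (K := K) w s
  have hletters := (Exec.outputLetter (K := K) w { s with
      pos := s.pos + (w.length - s.pos)
      valuePos := s.valuePos + (w.length - s.pos) } (fun x => if x = none then one else zero)).seq
    ((Exec.outputLetter w _ (fun x => x.getD one)).seq (Exec.copyPad w _ one))
  have hcode : ([] ++ [if s.value[w.length - s.pos]? = none then one else zero]) ++
      [s.value[w.length - s.pos]?.getD one] = codeLetter one zero s.value[w.length - s.pos]? := by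
    cases s.value[w.length - s.pos]? <;> rfl
  simp only [hvaluePos, zero_add, houtput, hcode] at hseek hletters
  exact (hseek.seq hletters).mono (by omega)

theorem Exec.encode (one zero : S) (φ : Baire S) {tM tN : ℕ}
    (hM : M.time φ (List.replicate w.length one) ≤ tM) (hN : N.time φ (pairArg one w) ≤ tN) :
    ∃ C : Cfg S (TapeIdx (EncWork M N)) (EncSym M N),
      (C.tape .output).content = monotoneCode one zero
        (fun n => (M.result φ (List.replicate n one)).length) (N.result φ) w ∧
      Exec (AskOracle φ .query .answer) (.encode M N one zero) (Prog.initCfg w) C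
        (18 * w.length + 2 * tM + 20 + (M.tapes.length + tM + 1) * (108 * (tM + 2)) +
          (N.tapes.length + tN + 1) * (108 * (tN + 2))) := by
  obtain ⟨y, hpad⟩ := Exec.computePad (N := N) w one φ hM
  obtain ⟨y', hvalue⟩ := Exec.computeValue (M := M) w one φ _ y hN
  have houtput := Exec.outputCode (K := AskOracle φ .query .answer) (M := M) (N := N) w
    { pos := 2 * (pairArg one w).length
      arg := pairArg one w
      pad := M.result φ (List.replicate w.length one)
      value := N.result φ (pairArg one w)
      answer := y' } one zero rfl rfl
  have hlen := M.length_result_le hM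
  rw [EncodeState.initCfg_eq_cfg]
  exact ⟨_, Tape.content_ofString _, (hpad.seq (hvalue.seq houtput)).mono (by dsimp only; omega)⟩

theorem OracleMachine.exists_encoder [Finite S] (M N : OracleMachine S) (one zero : S) :
    ∃ (E : OracleMachine S) (c : ℕ), ∀ (φ : Baire S) (w : List S) (tM tN : ℕ),
      M.time φ (List.replicate w.length one) ≤ tM → N.time φ (pairArg one w) ≤ tN →
      E.time φ w ≤ (c * (tM + tN + w.length + 1) ^ 2 : ℕ) ∧
      E.result φ w = monotoneCode one zero
        (fun n => (M.result φ (List.replicate n one)).length) (N.result φ) w := by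
  have := N.finW
  have := N.finQ
  have := N.finA
  have := M.finW
  have := M.finQ
  have := M.finA
  have := TapeIdx.finite (W := N.W)
  have := TapeIdx.finite (W := M.W)
  let c := M.tapes.length + N.tapes.length + 1
  refine ⟨(Prog.encode M N one zero).compile, 3 * (452 * c ^ 2), fun φ w tM tN hM hN => ?_⟩
  obtain ⟨C, hC, hencode⟩ := Exec.encode w one zero φ hM hN
  obtain ⟨htime, hresult⟩ := Prog.compile_spec hencode
  refine ⟨htime.trans (Nat.cast_le.2 ?_), hresult.trans hC⟩
  rw [mul_assoc, mul_assoc, ← mul_pow]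
  refine Nat.mul_le_mul_left 3 ?_
  set u := c * (tM + tN + w.length + 1)
  have hu : M.tapes.length + N.tapes.length + tM + tN + w.length + 1 ≤ u := by
    simp only [u, c]; nlinarith
  calc _ ≤ 20 * u + u * (108 * (2 * u)) + u * (108 * (2 * u)) := by gcongr <;> omega
    _ ≤ 20 * (u * u) + 432 * u ^ 2 := by nlinarith [Nat.le_mul_self u]
    _ = 452 * u ^ 2 := by ring

end Encoder

/-! ### Closure properties of polynomial-time computability -/

namespace IsSOP

variable {P Q : (ℕ → ℕ) → ℕ → ℕ}

theorem const (c : ℕ) : IsSOP fun _ _ => c := by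
  simpa only [Polynomial.eval_C] using IsSOP.poly (Polynomial.C c)

theorem arg : IsSOP fun _ n => n := by
  simpa only [Polynomial.eval_X] using IsSOP.poly Polynomial.X

theorem apply : IsSOP fun l n => l n := arg.app

theorem pow (h : IsSOP P) (k : ℕ) : IsSOP fun l n => P l n ^ k := by
  induction k with
  | zero => simpa only [pow_zero] using const 1
  | succ k ih => simpa only [pow_succ] using ih.mul h

theorem eval (p : Polynomial ℕ) (h : IsSOP P) : IsSOP fun l n => p.eval (P l n) := by
  induction p using Polynomial.induction_on' with
  | add p q hp hq => simpa only [Polynomial.eval_add] using hp.add hq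
  | monomial k a => simpa only [Polynomial.eval_monomial] using (const a).mul (h.pow k)

theorem comp (hP : IsSOP P) (hQ : IsSOP Q) : IsSOP fun l n => P l (Q l n) := by
  induction hP with
  | poly p => exact hQ.eval p
  | app _ ih => exact ih.app
  | add _ _ ih ih' => exact ih.add ih'
  | mul _ _ ih ih' => exact ih.mul ih'

theorem subst (hP : IsSOP P) (hQ : IsSOP Q) : IsSOP fun l n => P (Q l) n := by
  induction hP with
  | poly p => exact .poly p
  | app _ ih => exact hQ.comp ih
  | add _ _ ih ih' => exact ih.add ih'
  | mul _ _ ih ih' => exact ih.mul ih'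

theorem apply_le_apply (hP : IsSOP P) {l l' : ℕ → ℕ} (hl' : Monotone l') (hl : ∀ n, l n ≤ l' n)
    {n n' : ℕ} (hn : n ≤ n') : P l n ≤ P l' n' := by
  induction hP with
  | poly p =>
    simp only [Polynomial.eval_eq_sum, Polynomial.sum]
    gcongr
  | app _ ih => exact (hl _).trans (hl' ih)
  | add _ _ ih ih' => exact Nat.add_le_add ih ih'
  | mul _ _ ih ih' => exact Nat.mul_le_mul ih ih'

theorem monotone (hP : IsSOP P) {l : ℕ → ℕ} (hl : Monotone l) : Monotone (P l) :=
  fun _ _ => hP.apply_le_apply hl fun _ => le_rfl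

end IsSOP

section Polytime

variable {S : Type}

theorem OracleMachine.mem_operator {M : OracleMachine S} {φ ψ : Baire S} :
    ψ ∈ M.operator φ ↔ (∀ a, M.time φ a ≠ ⊤) ∧ M.result φ = ψ := by
  rw [operator, Part.mem_mk_iff, exists_prop]

theorem polytimeComputable_iff {X Y : PreparametrisedSpace.{u} S} {f : X.carrier → Y.carrier} :
    PolytimeComputable X Y f ↔ ∃ (M : OracleMachine S) (P Q : (ℕ → ℕ) → ℕ → ℕ),
      IsSOP P ∧ IsSOP Q ∧ ∀ φ : X.rep.Dom,
        (∀ a, M.time φ a ≤ (P (X.param φ) a.length : ℕ)) ∧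
        ∃ ψ : Y.rep.Dom, M.result φ = ψ ∧ (∀ x ∈ X.rep φ, f x ∈ Y.rep ψ) ∧
          ∀ n, Y.param ψ n ≤ Q (X.param φ) n := by
  constructor
  · rintro ⟨M, P, Q, hP, hQ, hrealises, htime, hparam⟩
    refine ⟨M, P, Q, hP, hQ, fun φ => ⟨htime φ, ?_⟩⟩
    obtain ⟨x, hx⟩ := (PFun.mem_dom _ _).1 φ.2
    obtain ⟨ψ, hψ, hfx⟩ := hrealises φ x hx
    have hdom : ψ ∈ Y.rep.Dom := (PFun.mem_dom _ _).2 ⟨_, hfx⟩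
    refine ⟨⟨ψ, hdom⟩, (M.mem_operator.1 hψ).2, fun x' hx' => ?_, hparam φ ⟨ψ, hdom⟩ hψ⟩
    rwa [Part.mem_unique hx' hx]
  · rintro ⟨M, P, Q, hP, hQ, hM⟩
    refine ⟨M, P, Q, hP, hQ, fun φ x hx => ?_, fun φ => (hM φ).1, fun φ ψ hψ => ?_⟩
    · obtain ⟨htime, ψ, hψ, hf, -⟩ := hM ⟨φ, (PFun.mem_dom _ _).2 ⟨_, hx⟩⟩
      exact ⟨ψ, M.mem_operator.2
        ⟨fun a => ne_top_of_le_ne_top (ENat.natCast_ne_top _) (htime a), hψ⟩, hf x hx⟩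
    · obtain ⟨-, ψ', hψ', -, hparam⟩ := hM φ
      obtain rfl : ψ = ψ' := Subtype.ext ((M.mem_operator.1 hψ).2.symm.trans hψ')
      exact hparam

theorem PolytimeComputable.comp [Finite S] {X Y Z : PreparametrisedSpace.{u} S}
    {g : Y.carrier → Z.carrier} {f : X.carrier → Y.carrier} (hg : PolytimeComputable Y Z g)
    (hf : PolytimeComputable X Y f) : PolytimeComputable X Z (g ∘ f) := by
  obtain ⟨M, P, Q, hP, hQ, hM⟩ := polytimeComputable_iff.1 hf
  obtain ⟨N, P', Q', hP', hQ', hN⟩ := polytimeComputable_iff.1 hg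
  obtain ⟨C, c, hC⟩ := OracleMachine.exists_comp N M
  have hT : IsSOP fun l n => P' (Q l) n := hP'.subst hQ
  have hU : IsSOP fun l n => P l (P' (Q l) n + 2) := hP.comp (hT.add (.const 2))
  refine polytimeComputable_iff.2 ⟨C, _, _,
    (IsSOP.const c).mul (((hT.add hU).add (.const 1)).pow 3), hQ'.subst hQ, fun φ => ?_⟩
  obtain ⟨hMtime, ψ, hψ, hfψ, hψ_param⟩ := hM φ
  obtain ⟨hNtime, χ, hχ, hgχ, hχ_param⟩ := hN ψ
  have hl : Monotone (X.param φ) := X.param_mono φ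
  have hQl : Monotone (Q (X.param φ)) := hQ.monotone hl
  have hCa (a : List S) := hC φ a (P' (Q (X.param φ)) a.length)
    (P (X.param φ) (P' (Q (X.param φ)) a.length + 2))
    (by
      rw [hψ]
      exact (hNtime a).trans (Nat.cast_le.2 (hP'.apply_le_apply hQl hψ_param le_rfl)))
    (fun w hw => (hMtime w).trans (Nat.cast_le.2 (hP.monotone hl hw)))
  refine ⟨fun a => (hCa a).1, χ, ?_, fun x hx => hgχ _ (hfψ x hx),
    fun n => (hχ_param n).trans (hQ'.apply_le_apply hQl hψ_param le_rfl)⟩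
  funext a
  rw [(hCa a).2, hψ, hχ]

theorem polytimeComputable_of_forall_mem_rep [Finite S] {X Y : PreparametrisedSpace.{u} S}
    {f : X.carrier → Y.carrier} (hsize : ∀ (φ : X.rep.Dom) n, size φ.1 n ≤ X.param φ n)
    (hf : ∀ φ : X.rep.Dom, ∃ ψ : Y.rep.Dom, φ.1 = ψ ∧ (∀ x ∈ X.rep φ, f x ∈ Y.rep ψ) ∧
      ∀ n, Y.param ψ n ≤ X.param φ n) :
    PolytimeComputable X Y f := by
  obtain ⟨M, hM⟩ := OracleMachine.exists_identity S
  refine polytimeComputable_iff.2 ⟨M, _, _, (IsSOP.const 3).mul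
    ((((IsSOP.const 2).mul .arg).add ((IsSOP.const 2).mul .apply)).add (.const 3)), .apply,
    fun φ => ⟨fun a => (hM φ a).1.trans (Nat.cast_le.2 ?_), ?_⟩⟩
  · have hlen := (length_le_size φ.1 (le_refl a.length)).trans (hsize φ a.length)
    gcongr
  · obtain ⟨ψ, hψ, hrep, hparam⟩ := hf φ
    exact ⟨ψ, (funext fun a => (hM φ a).2).trans hψ, hrep, hparam⟩

theorem isParametrised_of_param_eq_size [Finite S] {X : PreparametrisedSpace.{u} S}
    (h : ∀ φ : X.rep.Dom, X.param φ = size φ.1) : X.IsParametrised :=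
  polytimeComputable_of_forall_mem_rep (fun φ n => (congrFun (h φ) n).ge)
    fun φ => ⟨φ, rfl, fun _ hx => hx, fun _ => le_rfl⟩

theorem IsLengthMonotone.size_eq [Finite S] {φ : Baire S} (h : IsLengthMonotone φ) (one : S)
    (n : ℕ) : size φ n = (φ (List.replicate n one)).length :=
  le_antisymm (size_le φ fun a ha => h a _ (by simpa using ha)) (length_le_size φ (by simp))

theorem PreparametrisedSpace.IsKawamuraCook.hasPolytimeParameter [Finite S]
    {X : PreparametrisedSpace.{u} S} (h : X.IsKawamuraCook) (one : S) :
    X.HasPolytimeParameter one := by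
  obtain ⟨-, hmono, hparam⟩ := h
  refine polytimeComputable_of_forall_mem_rep (fun φ n => (congrFun (hparam φ) n).ge)
    fun φ => ⟨⟨φ, trivial⟩, rfl, ?_, fun n => (congrFun (hparam φ) n).ge⟩
  rintro x ⟨hx, rfl⟩
  refine Part.mem_some_iff.2 (funext fun n => ?_)
  exact (congrFun (hparam φ) n).trans ((hmono φ.1 φ.2).size_eq one n)

theorem PreparametrisedSpace.HasPolytimeParameter.exists_machine [Finite S] {one : S}
    {X : PreparametrisedSpace.{u} S} (h : X.HasPolytimeParameter one) :
    ∃ (M : OracleMachine S) (P : (ℕ → ℕ) → ℕ → ℕ), IsSOP P ∧ ∀ φ : X.rep.Dom,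
      (∀ a, M.time φ a ≤ (P (X.param φ) a.length : ℕ)) ∧
      ∀ n, (M.result φ (List.replicate n one)).length = X.param φ n := by
  obtain ⟨M, P, Q, hP, -, hM⟩ := polytimeComputable_iff.1 h
  refine ⟨M, P, hP, fun φ => ?_⟩
  obtain ⟨htime, ψ, hψ, hrep, -⟩ := hM φ
  have hparam := Part.mem_some_iff.1 (hrep φ ⟨φ.2, rfl⟩)
  exact ⟨htime, fun n => by rw [hparam, hψ]⟩

end Polytime

/-! ### The Kawamura–Cook space of monotone codes -/

section MonotoneSpace

variable {S : Type} (X : PreparametrisedSpace.{u} S) (P Q : (ℕ → ℕ) → ℕ → ℕ)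

/-- The function `l` controls the name `φ` of `X`: it bounds its size and its parameter, up to the
second-order functions `P` and `Q`. This is the information about `φ` that the padding of a
monotone code carries. -/
structure Controls (l : ℕ → ℕ) (φ : X.rep.Dom) : Prop where
  monotone : Monotone l
  length_le : ∀ a, (φ.1 a).length ≤ P l a.length
  param_le : ∀ n, X.param φ n ≤ Q l n

/-- The representation of `X` by the monotone codes of its names, with paddings that control
them. -/
noncomputable def monotoneRep (one zero : S) : Baire S →. X.carrier := fun χ =>
  ⟨∃ φ : X.rep.Dom, ∃ l, Controls X P Q l φ ∧ χ = monotoneCode one zero l φ,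
    fun h => (X.rep h.choose.1).get h.choose.2⟩

variable {X P Q} {one zero : S}

theorem mem_monotoneRep (h01 : one ≠ zero) {χ : Baire S} {x : X.carrier} :
    x ∈ monotoneRep X P Q one zero χ ↔ ∃ φ : X.rep.Dom, ∃ l, Controls X P Q l φ ∧
      χ = monotoneCode one zero l φ ∧ x ∈ X.rep φ := by
  constructor
  · rintro ⟨h, rfl⟩
    obtain ⟨l, hl, hcode⟩ := h.choose_spec
    exact ⟨_, l, hl, hcode, Part.get_mem _⟩
  · rintro ⟨φ, l, hl, hcode, hx⟩
    have h : (monotoneRep X P Q one zero χ).Dom := ⟨φ, l, hl, hcode⟩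
    obtain ⟨l', -, hcode'⟩ := h.choose_spec
    have hchoose : h.choose.1 = φ.1 := monotoneCode_injective h01 (hcode'.symm.trans hcode)
    exact ⟨h, Part.mem_unique (Part.get_mem h.choose.2) (hchoose ▸ hx)⟩

variable [Finite S]

theorem size_monotoneCode (one zero : S) {l : ℕ → ℕ} (hl : Monotone l) (φ : Baire S) (n : ℕ) :
    size (monotoneCode one zero l φ) n = l n + 2 := by
  refine le_antisymm (size_le _ fun a ha => ?_) ?_
  · rw [length_monotoneCode]
    exact Nat.add_le_add_right (hl ha) 2
  · have hlen := length_le_size (monotoneCode one zero l φ)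
      (List.length_replicate (n := n) (a := one)).le
    rwa [length_monotoneCode, List.length_replicate] at hlen

/-- The set `X`, represented by monotone codes and with the standard parameter. -/
noncomputable def monotoneSpace (h01 : one ≠ zero)
    (h : ∀ x, ∃ φ l, Controls X P Q l φ ∧ x ∈ X.rep φ) : PreparametrisedSpace.{u} S where
  carrier := X.carrier
  rep := monotoneRep X P Q one zero
  rep_surjective x := by
    obtain ⟨φ, l, hl, hx⟩ := h x
    exact ⟨_, (mem_monotoneRep h01).2 ⟨φ, l, hl, rfl, hx⟩⟩
  param χ := size χ.1
  param_mono χ := size_mono χ.1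

variable (h01 : one ≠ zero) (h : ∀ x, ∃ φ l, Controls X P Q l φ ∧ x ∈ X.rep φ)

theorem isKawamuraCook_monotoneSpace : (monotoneSpace h01 h).IsKawamuraCook := by
  refine ⟨isParametrised_of_param_eq_size fun _ => rfl, ?_, fun _ => rfl⟩
  rintro _ ⟨φ, l, hl, rfl⟩ a b hab
  rw [length_monotoneCode, length_monotoneCode]
  exact Nat.add_le_add_right (hl.monotone hab) 2

theorem polytimeComputable_of_monotoneSpace (hP : IsSOP P) (hQ : IsSOP Q) :
    PolytimeComputable (monotoneSpace h01 h) X id := by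
  obtain ⟨M, hM⟩ := OracleMachine.exists_decoder one zero
  refine polytimeComputable_iff.2 ⟨M, _, Q, (IsSOP.const 3).mul
    ((((IsSOP.const 3).mul .arg).add ((IsSOP.const 5).mul hP)).add (.const 3)), hQ, ?_⟩
  rintro ⟨_, φ, l, hl, rfl⟩
  have hle (n : ℕ) : l n ≤ size (monotoneCode one zero l φ) n :=
    (Nat.le_add_right _ 2).trans_eq (size_monotoneCode one zero hl.monotone φ.1 n).symm
  have hsize : Monotone (size (monotoneCode one zero l φ)) := size_mono _
  have hdecode (a : List S) := hM (monotoneCode one zero l φ) a (φ.1 a)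
    (fun k hk => by
      rw [monotoneCode_pairCode h01, List.getElem?_eq_getElem hk]
      exact ⟨_, rfl⟩)
    (by
      rw [monotoneCode_pairCode h01, List.getElem?_eq_none le_rfl]
      simpa [codeLetter] using h01)
  refine ⟨fun a => (hdecode a).1.trans (Nat.cast_le.2 ?_), φ, funext fun a => (hdecode a).2,
    fun x hx => ?_, fun n => (hl.param_le n).trans (hQ.apply_le_apply hsize hle le_rfl)⟩
  · have hlen := (hl.length_le a).trans (hP.apply_le_apply hsize hle le_rfl)
    gcongr
    exact hlen
  · obtain ⟨φ', l', -, hcode, hx'⟩ := (mem_monotoneRep h01).1 hx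
    rwa [monotoneCode_injective h01 hcode]

theorem polytimeComputable_monotoneSpace {Z : PreparametrisedSpace.{u} S}
    (hZ : Z.HasPolytimeParameter one) {f : Z.carrier → X.carrier} {N : OracleMachine S}
    (hP : IsSOP P) (htime : ∀ (ψ : Z.rep.Dom) a, N.time ψ a ≤ (P (Z.param ψ) a.length : ℕ))
    (hN : ∀ ψ : Z.rep.Dom, ∃ φ : X.rep.Dom, N.result ψ = φ ∧ (∀ z ∈ Z.rep ψ, f z ∈ X.rep φ) ∧
      Controls X P Q (Z.param ψ) φ) :
    PolytimeComputable Z (monotoneSpace h01 h) f := by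
  obtain ⟨M, R, hR, hM⟩ := hZ.exists_machine
  obtain ⟨E, c, hE⟩ := OracleMachine.exists_encoder M N one zero
  refine polytimeComputable_iff.2 ⟨E, _, _,
    (IsSOP.const c).mul ((((hR.add hP).add .arg).add (.const 1)).pow 2),
    IsSOP.apply.add (.const 2), fun ψ => ?_⟩
  obtain ⟨φ, hφ, hrep, hcontrols⟩ := hN ψ
  have hencode (a : List S) := hE ψ a (R (Z.param ψ) a.length) (P (Z.param ψ) a.length)
    (by simpa only [List.length_replicate] using (hM ψ).1 (List.replicate a.length one))
    ((htime ψ _).trans (Nat.cast_le.2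
      (hP.monotone (Z.param_mono ψ) (length_pairArg_le one a))))
  have hresult : E.result ψ = monotoneCode one zero (Z.param ψ) φ := by
    funext a
    rw [(hencode a).2, hφ, funext (hM ψ).2]
  exact ⟨fun a => (hencode a).1, ⟨_, φ, _, hcontrols, rfl⟩, hresult,
    fun z hz => (mem_monotoneRep h01).2 ⟨φ, _, hcontrols, rfl, hrep z hz⟩,
    fun n => (size_monotoneCode one zero hcontrols.monotone φ.1 n).le⟩

end MonotoneSpace

theorem PreparametrisedSpace.PolytimeIsomorphic.exists_isKawamuraCook {S : Type} [Finite S]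
    [Nontrivial S] {one : S} {X Z : PreparametrisedSpace.{u} S} (h : X.PolytimeIsomorphic Z)
    (hZ : Z.HasPolytimeParameter one) :
    ∃ Y : PreparametrisedSpace.{u} S, Y.IsKawamuraCook ∧ X.PolytimeIsomorphic Y := by
  obtain ⟨zero, h10⟩ := exists_ne one
  obtain ⟨e, he, he_symm⟩ := h
  obtain ⟨N, P, Q, hP, hQ, hN⟩ := polytimeComputable_iff.1 he_symm
  have hcontrols (ψ : Z.rep.Dom) : ∃ φ : X.rep.Dom, N.result ψ = φ ∧
      (∀ z ∈ Z.rep ψ, e.symm z ∈ X.rep φ) ∧ Controls X P Q (Z.param ψ) φ := by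
    obtain ⟨htime, φ, hφ, hrep, hparam⟩ := hN ψ
    exact ⟨φ, hφ, hrep, Z.param_mono ψ, fun a => hφ ▸ N.length_result_le (htime a), hparam⟩
  have hsurj (x : X.carrier) : ∃ φ l, Controls X P Q l φ ∧ x ∈ X.rep φ := by
    obtain ⟨ψ, hψ⟩ := Z.rep_surjective (e x)
    obtain ⟨φ, -, hrep, hl⟩ := hcontrols ⟨ψ, (PFun.mem_dom _ _).2 ⟨_, hψ⟩⟩
    exact ⟨φ, _, hl, e.symm_apply_apply x ▸ hrep _ hψ⟩
  have hencode := polytimeComputable_monotoneSpace h10.symm hsurj hZ hP (fun ψ => (hN ψ).1)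
    hcontrols
  refine ⟨monotoneSpace h10.symm hsurj, isKawamuraCook_monotoneSpace h10.symm hsurj, Equiv.refl _,
    ?_, polytimeComputable_of_monotoneSpace h10.symm hsurj hP hQ⟩
  have hid : e.symm ∘ e = Equiv.refl X.carrier := e.symm_comp_self
  exact hid ▸ hencode.comp he

end SecondOrder

theorem mainTheorem7 {S : Type} [Finite S] [Nontrivial S] (one : S)
    (X : SecondOrder.PreparametrisedSpace.{u} S) (hX : X.IsParametrised) :
    (∃ Y : SecondOrder.PreparametrisedSpace.{u} S,
        Y.IsKawamuraCook ∧ X.PolytimeIsomorphic Y) ↔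
      ∃ Y : SecondOrder.PreparametrisedSpace.{u} S,
        Y.IsParametrised ∧ Y.HasPolytimeParameter one ∧ X.PolytimeIsomorphic Y := by
  constructor
  · rintro ⟨Y, hY, h⟩
    exact ⟨Y, hY.1, hY.hasPolytimeParameter one, h⟩
  · rintro ⟨Z, -, hZ, h⟩
    exact h.exists_isKawamuraCook hZ
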